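/- **Definitions.** All graphs are finite and simple. A sequence $S=(v_1,\dots,v_k)$ of distinct vertices of a graph $G$ is *legal* if $N(v_i)\setminus\bigcup_{j<i}N(v_j)\neq\emptyset$ for every $i\in\{1,\dots,k\}$; it is a *total dominating sequence* if, in addition, every vertex of $G$ has a neighbor in $\{v_1,\dots,v_k\}$. If $G$ has no isolated vertices, a *Grundy total dominating sequence* of $G$ is a total dominating sequence of maximum length; if $G$ has isolated vertices, it is a legal sequence of maximum length. $G$ is *distance-hereditary* if $d_{G'}(x,y)=d_G(x,y)$ for every connected induced subgraph $G'$ of $G$ and all $x,y\in V(G')$. A *pruning sequence* of a graph $G$ with $n$ vertices consists of an ordering $x_1,\dots,x_n$ of $V(G)$ and words $q_i=(x_i,Z_i,y_i)$, $1\le i\le n-1$, with $Z_i\in\{P,F,T\}$, such that in $G_i=G\setminus\{x_1,\dots,x_{i-1}\}$ the vertex $x_i$ is a leaf with neighbor $y_i$ (if $Z_i=P$), or $x_i\neq y_i$ are false twins, i.e. have equal open neighborhoods (if $Z_i=F$), or $x_i\ne y_i$ are true twins, i.e. have equal closed neighborhoods (if $Z_i=T$). **Algorithm GrundyBDH.**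 Input: a bipartite distance-hereditary graph $G$. If $G$ has no edges, return the empty sequence. Otherwise obtain any pruning sequence of $G$, let $i$ be the smallest index with $Z_i\ne F$, apply the algorithm to $G'=G\setminus\{x_1,\dots,x_i,y_i\}$ to get a sequence $S'$, and return the sequence consisting of $x_i$, then $S'$, then $y_i$. **Theorem.** Let $G$ be a bipartite distance-hereditary graph. GrundyBDH, called on $G$, always returns: in every call on a graph with edges a pruning sequence exists and, whichever one is obtained, an index $i$ with $Z_i\neq F$ exists, and the recursion ends. Whichever pruning sequences are obtained, the returned sequence is a Grundy total dominating sequence of $G$. Moreover, GrundyBDH has complexity $O(|V(G)|\,(|V(G)|+|E(G)|))$: there is a program for a unit-cost random access machine with words of $O(\log(|V(G)|+|E(G)|+2))$ bits that, for every bipartite distance-hereditary graph $G$ with at least one vertex, given by the list of its edges, carries out a complete run of GrundyBDH in $O(|V(G)|\,(|V(G)|+|E(G)|))$ steps, where it writes out the pruning sequences obtained in the successive calls and leaves the sequence returned by that run in memory. -/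

import Mathlib

namespace GrundyTD

/-! ### Distance-hereditary graphs -/

/-- A graph is distance-hereditary if distances in every connected induced subgraph are the
distances in the whole graph. -/
def IsDistanceHereditary {V : Type*} (G : SimpleGraph V) : Prop :=
  ∀ s : Set V, (G.induce s).Connected →
    ∀ x y : s, (G.induce s).dist x y = G.dist (x : V) (y : V)

/-! ### Legal sequences and Grundy total dominating sequences -/

/-- `S = (v₁, …, v_k)` is legal: its vertices are distinct and each `vᵢ` has a neighbour that is
adjacent to none of `v₁, …, vᵢ₋₁`.  (For `i = 1` this says that `v₁` is not isolated, so in a graph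
without edges the empty sequence is the only legal one.) -/
def IsLegal {V : Type*} (G : SimpleGraph V) (S : List V) : Prop :=
  S.Nodup ∧ ∀ (i : ℕ) (v : V), S[i]? = some v →
    ∃ w, G.Adj v w ∧ ∀ j < i, ∀ u, S[j]? = some u → ¬ G.Adj u w

/-- A total dominating sequence: a legal sequence whose vertices totally dominate the graph. -/
def IsTotalDominatingSeq {V : Type*} (G : SimpleGraph V) (S : List V) : Prop :=
  IsLegal G S ∧ ∀ v, ∃ u ∈ S, G.Adj u v

/-- A Grundy total dominating sequence of a graph without isolated vertices is a total dominating
sequence of maximum length; in a graph with isolated vertices it is a legal sequence of maximum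
length. -/
def IsGrundyTotalDominatingSeq {V : Type*} (G : SimpleGraph V) (S : List V) : Prop :=
  ((∀ v, ∃ w, G.Adj v w) →
    IsTotalDominatingSeq G S ∧ ∀ S', IsTotalDominatingSeq G S' → S'.length ≤ S.length) ∧
  ((∃ v, ∀ w, ¬ G.Adj v w) →
    IsLegal G S ∧ ∀ S', IsLegal G S' → S'.length ≤ S.length)

/-! ### Pruning sequences

Induced subgraphs of `G` are given by their vertex sets `U`. -/

/-- The three kinds of words of a pruning sequence: `P`, `F` and `T`. -/
inductive PruneOp where
  | pendant
  | falseTwin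
  | trueTwin

/-- A word `(x, Z, y)`. -/
structure PruneWord (V : Type*) where
  x : V
  op : PruneOp
  y : V

/-- The neighbourhood of `v` in the induced subgraph `G[U]`. -/
def nbhd {V : Type*} (G : SimpleGraph V) (U : Finset V) (v : V) : Set V :=
  {w | w ∈ U ∧ G.Adj v w}

/-- The word `(x, Z, y)` is correct in `G[U]`: `x` is a leaf with support vertex `y` (`P`), or `x`
and `y` are two false twins (`F`), or two true twins (`T`), of `G[U]`. -/
def PruneWord.Valid {V : Type*} (G : SimpleGraph V) (U : Finset V) (q : PruneWord V) : Prop :=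
  q.x ∈ U ∧ q.y ∈ U ∧ q.x ≠ q.y ∧
    match q.op with
    | .pendant => nbhd G U q.x = {q.y}
    | .falseTwin => nbhd G U q.x = nbhd G U q.y
    | .trueTwin => insert q.x (nbhd G U q.x) = insert q.y (nbhd G U q.y)

/-- `σ = [x₁, …, x_n]` is an ordering of the vertices of `G[U]`, and `Q = [q₁, …, q_{n-1}]` consists
of words `qᵢ = (xᵢ, Z, yᵢ)` such that `qᵢ` is correct in `G[U] ∖ {x₁, …, xᵢ₋₁}`. -/
structure IsPruningSequence {V : Type*} [DecidableEq V] (G : SimpleGraph V) (U : Finset V)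
    (σ : List V) (Q : List (PruneWord V)) : Prop where
  nodup : σ.Nodup
  vertices : σ.toFinset = U
  words : Q.map PruneWord.x = σ.dropLast
  valid : ∀ (i : ℕ) (q : PruneWord V), Q[i]? = some q → q.Valid G (U \ (σ.take i).toFinset)

/-! ### The algorithm GrundyBDH -/

/-- `q` is the first word of `Q` that is not of kind `F`, and it stands at (zero-based) index
`i`. -/
def IsFirstNonFalseTwin {V : Type*} (Q : List (PruneWord V)) (i : ℕ) (q : PruneWord V) : Prop :=
  Q[i]? = some q ∧ q.op ≠ .falseTwin ∧
    ∀ j < i, ∀ q', Q[j]? = some q' → q'.op = .falseTwin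

/-- `G[U]` has no edges. -/
def Edgeless {V : Type*} (G : SimpleGraph V) (U : Finset V) : Prop :=
  ∀ u ∈ U, ∀ v ∈ U, ¬ G.Adj u v

/-- The vertex set of the graph `G[U] ∖ {x₁, …, xᵢ, yᵢ}` of the recursive call; the list `σ` is
indexed from zero, so that `x₁, …, xᵢ` are its first `i + 1` entries for the index `i` used here. -/
def callSet {V : Type*} [DecidableEq V] (U : Finset V) (σ : List V) (i : ℕ) (y : V) : Finset V :=
  U \ insert y (σ.take (i + 1)).toFinset

/-- `GrundyBDH G U L S`: the recursive algorithm GrundyBDH, called on `G[U]`, can return `S`, where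
`L` lists the pruning sequences that it obtains, in the order of the recursive calls.  The algorithm
is nondeterministic: in each call any pruning sequence may be obtained. -/
inductive GrundyBDH {V : Type*} [DecidableEq V] (G : SimpleGraph V) :
    Finset V → List (List (PruneWord V)) → List V → Prop where
  | done {U : Finset V} (h : Edgeless G U) : GrundyBDH G U [] []
  | call {U : Finset V} {σ : List V} {Q : List (PruneWord V)} {i : ℕ} {q : PruneWord V}
      {L : List (List (PruneWord V))} {S : List V}
      (h : ¬ Edgeless G U)
      (hQ : IsPruningSequence G U σ Q)
      (hi : IsFirstNonFalseTwin Q i q)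
      (hS : GrundyBDH G (callSet U σ i q.y) L S) :
      GrundyBDH G U (Q :: L) ([q.x] ++ S ++ [q.y])

/-- The algorithm, called on `G[U]`, always returns: it never lacks a pruning sequence to
obtain, and whichever ones it obtains, each loop finds a word that is not of kind `F` and the
recursion ends. -/
inductive AlwaysReturns {V : Type*} [DecidableEq V] (G : SimpleGraph V) : Finset V → Prop where
  | done {U : Finset V} (h : Edgeless G U) : AlwaysReturns G U
  | call {U : Finset V} (h : ¬ Edgeless G U)
      (hex : ∃ σ Q, IsPruningSequence G U σ Q)
      (hfind : ∀ σ Q, IsPruningSequence G U σ Q → ∃ i q, IsFirstNonFalseTwin Q i q)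
      (hrec : ∀ σ Q i q, IsPruningSequence G U σ Q → IsFirstNonFalseTwin Q i q →
        AlwaysReturns G (callSet U σ i q.y)) :
      AlwaysReturns G U

/-! ### A random access machine with unit cost and bounded words

A program acts on registers, on a memory that is addressed through registers, and on a write-only
output list.  Numbers are machine words, bounded by `W`: an operation whose result exceeds `W`
cannot be executed.  Each elementary operation and each test costs one step. -/

/-- States of the machine. -/
structure State where
  reg : ℕ → ℕ
  mem : ℕ → ℕ
  out : List ℕ

/-- Put `c` into register `d`. -/
def State.setReg (s : State) (d c : ℕ) : State :=
  { s with reg := Function.update s.reg d c }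

/-- Programs; the arguments `d a b` are numbers of registers, and `c` is a constant. -/
inductive Cmd where
  | skip
  | const (d c : ℕ)
  | add (d a b : ℕ)
  | sub (d a b : ℕ)
  | mul (d a b : ℕ)
  | load (d a : ℕ)
  | store (a b : ℕ)
  | emit (a : ℕ)
  | seq (P Q : Cmd)
  | ifLt (a b : ℕ) (P Q : Cmd)
  | whileLt (a b : ℕ) (P : Cmd)

/-- `Exec W P s t s'`: with words bounded by `W`, the program `P` started in state `s` halts after
exactly `t` steps in state `s'`.  Subtraction is truncated at zero. -/
inductive Exec (W : ℕ) : Cmd → State → ℕ → State → Prop where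
  | skip (s : State) : Exec W .skip s 1 s
  | const (s : State) (d c : ℕ) (h : c ≤ W) : Exec W (.const d c) s 1 (s.setReg d c)
  | add (s : State) (d a b : ℕ) (h : s.reg a + s.reg b ≤ W) :
      Exec W (.add d a b) s 1 (s.setReg d (s.reg a + s.reg b))
  | sub (s : State) (d a b : ℕ) :
      Exec W (.sub d a b) s 1 (s.setReg d (s.reg a - s.reg b))
  | mul (s : State) (d a b : ℕ) (h : s.reg a * s.reg b ≤ W) :
      Exec W (.mul d a b) s 1 (s.setReg d (s.reg a * s.reg b))
  | load (s : State) (d a : ℕ) :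
      Exec W (.load d a) s 1 (s.setReg d (s.mem (s.reg a)))
  | store (s : State) (a b : ℕ) :
      Exec W (.store a b) s 1 { s with mem := Function.update s.mem (s.reg a) (s.reg b) }
  | emit (s : State) (a : ℕ) :
      Exec W (.emit a) s 1 { s with out := s.out ++ [s.reg a] }
  | seq {P Q : Cmd} {s s₁ s₂ : State} {t₁ t₂ : ℕ}
      (h₁ : Exec W P s t₁ s₁) (h₂ : Exec W Q s₁ t₂ s₂) :
      Exec W (.seq P Q) s (t₁ + t₂) s₂
  | ifTrue {a b : ℕ} {P Q : Cmd} {s s' : State} {t : ℕ}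
      (h : s.reg a < s.reg b) (hP : Exec W P s t s') :
      Exec W (.ifLt a b P Q) s (t + 1) s'
  | ifFalse {a b : ℕ} {P Q : Cmd} {s s' : State} {t : ℕ}
      (h : ¬ s.reg a < s.reg b) (hQ : Exec W Q s t s') :
      Exec W (.ifLt a b P Q) s (t + 1) s'
  | whileTrue {a b : ℕ} {P : Cmd} {s s₁ s₂ : State} {t₁ t₂ : ℕ}
      (h : s.reg a < s.reg b) (h₁ : Exec W P s t₁ s₁)
      (h₂ : Exec W (.whileLt a b P) s₁ t₂ s₂) :
      Exec W (.whileLt a b P) s (t₁ + t₂ + 1) s₂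
  | whileFalse {a b : ℕ} {P : Cmd} {s : State} (h : ¬ s.reg a < s.reg b) :
      Exec W (.whileLt a b P) s 1 s

/-! ### Input and output of the machine -/

/-- `es` lists every edge of `G` exactly once, in any order and with its ends in any order. -/
def IsEdgeList {n : ℕ} (G : SimpleGraph (Fin n)) (es : List (Fin n × Fin n)) : Prop :=
  (es.map fun e => s(e.1, e.2)).Nodup ∧ ∀ u v, G.Adj u v ↔ s(u, v) ∈ es.map fun e => s(e.1, e.2)

/-- The machine starts with the numbers `n, m, u₁, v₁, …, u_m, v_m` in the first memory cells, where
`u₁v₁, …, u_mv_m` are the edges of the graph on the vertices `0, …, n - 1`; all other cells and all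
registers are zero and the output is empty. -/
def initState (n : ℕ) (es : List (Fin n × Fin n)) : State where
  reg := fun _ => 0
  mem := fun k =>
    ([n, es.length] ++ es.flatMap fun e => [(e.1 : ℕ), (e.2 : ℕ)]).getD k 0
  out := []

/-- The code of a kind of words. -/
def PruneOp.code : PruneOp → ℕ
  | .pendant => 0
  | .falseTwin => 1
  | .trueTwin => 2

/-- The code of a list of pruning sequences: for each of them, the number of its words and then
`x, Z, y` for each word `(x, Z, y)`. -/
def encodeLog {n : ℕ} (L : List (List (PruneWord (Fin n)))) : List ℕ :=
  L.flatMap fun Q => Q.length :: Q.flatMap fun q => [(q.x : ℕ), q.op.code, (q.y : ℕ)]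

/-- The memory holds `S = (v₁, …, v_k)`: cell `0` contains `k`, and cell `i` contains `vᵢ`. -/
def State.Holds {n : ℕ} (s : State) (S : List (Fin n)) : Prop :=
  s.mem 0 = S.length ∧ ∀ (i : ℕ) (v : Fin n), S[i]? = some v → s.mem (i + 1) = (v : ℕ)

end GrundyTD

namespace GrundyTD

/-! ### Legal sequences with footprints -/

/-! Correctness. A legal sequence amounts to a list of pairs `(v, w)` in which `w` is adjacent to
`v` but to no earlier first entry (`Footprints`). The maximum length of such lists can be followed
through one call. Replacing a false twin `x` by its twin `y` respects adjacency and non-adjacency,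
so deleting `x` costs nothing (`Footprints.erase_falseTwin`). If `x` is a leaf at `y`, then every
pair containing `x` contains `y`, and `y` occurs at most once in each coordinate, so deleting both
vertices costs at most two pairs (`Footprints.erase_leaf`). Conversely, `(x, y)` can be put in front
of a list of the smaller graph and `(y, x)` behind it. In a bipartite graph true twins form a
component with two vertices, so words of kind `T` are leaves as well. Hence a longest legal sequence
is returned (`GrundyBDH.footprints`), and such a sequence dominates every vertex that is not
isolated.

Termination. What has to be found is a pruning sequence of every induced subgraph. Root each
component and split it into distance layers. Vertices of one layer with a common neighbour above
have the same neighbours below (`IsRooting.lower_adj`), and those with a common neighbour below have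
comparable neighbourhoods there (`IsRooting.comparable`). Let `x` have minimum degree among the
vertices of the highest layer that is left. Then any two neighbours of `x` are false twins
(`IsExtremal.twins`), so `x` is isolated or a leaf, or a neighbour of `x` can be removed as a false
twin. This gives an elimination list of the whole graph, in which isolated vertices are words of
their own; such lists can be adapted to the deletion of any vertex (`Eliminates.deleteVertex`). An
elimination list becomes a pruning sequence when its isolated vertices are moved to the end, where
they are false twins of each other (`Eliminates.isPruningSequence`).

Complexity. An elimination list is computed only once, in `n` rounds of `O(n + m)` steps, after the
layers have been found by `n` rounds of edge relaxation (`run_computeKeys`, `run_eliminateAll`).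
Each call then needs only linear passes over the current list, which write out its pruning sequence
and turn it into the list of the next graph (`Eliminates.exists_call`, `run_transform`). The program
is written in a small language whose loops run over the vertices or the edges, so that a static cost
bounds both the running time and the growth of the numbers; compilation to the machine respects this
cost (`Com.simulates`). -/

/-- A list of pairs `(v, w)` in `G[U]`, where `w` is adjacent to `v` and to none of the earlier
first entries. -/
def Footprints {V : Type*} (G : SimpleGraph V) (U : Finset V) (l : List (V × V)) : Prop :=
  (∀ p ∈ l, p.1 ∈ U ∧ p.2 ∈ U ∧ G.Adj p.1 p.2) ∧ l.Pairwise fun p q => ¬ G.Adj p.1 q.2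

section Legal

variable {V : Type*} {G : SimpleGraph V} {U : Finset V}

/-- A repeated first entry would already be adjacent to the later footprint. The next lemma is the
mirror image: a repeated footprint would be adjacent to the earlier first entry. -/
theorem Footprints.nodup_fst {l : List (V × V)} (h : Footprints G U l) : (l.map Prod.fst).Nodup := by
  rw [List.Nodup, List.pairwise_map]
  refine h.2.imp_of_mem ?_
  intro p q _ hq hpq e
  exact hpq (e ▸ (h.1 q hq).2.2)

theorem Footprints.nodup_snd {l : List (V × V)} (h : Footprints G U l) : (l.map Prod.snd).Nodup := by
  rw [List.Nodup, List.pairwise_map]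
  refine h.2.imp_of_mem ?_
  intro p q hp _ hpq e
  exact hpq (e ▸ (h.1 p hp).2.2)

theorem Footprints.isLegal {l : List (V × V)} (h : Footprints G U l) :
    IsLegal G (l.map Prod.fst) := by
  refine ⟨h.nodup_fst, ?_⟩
  intro i v hv
  simp only [List.getElem?_map, Option.map_eq_some_iff] at hv
  obtain ⟨p, hp, rfl⟩ := hv
  refine ⟨p.2, (h.1 p (List.mem_of_getElem? hp)).2.2, ?_⟩
  intro j hj u hu
  simp only [List.getElem?_map, Option.map_eq_some_iff] at hu
  obtain ⟨q, hq, rfl⟩ := hu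
  obtain ⟨hi, rfl⟩ := List.getElem?_eq_some_iff.1 hp
  obtain ⟨hj', rfl⟩ := List.getElem?_eq_some_iff.1 hq
  exact List.pairwise_iff_getElem.1 h.2 j i hj' hi hj

theorem IsLegal.exists_footprints [Fintype V] {S : List V} (h : IsLegal G S) :
    ∃ l : List (V × V), l.length = S.length ∧ Footprints G Finset.univ l := by
  have hw : ∀ i : Fin S.length, ∃ w, G.Adj S[i] w ∧
      ∀ j < i.1, ∀ u, S[j]? = some u → ¬ G.Adj u w :=
    fun i => h.2 i S[i] (by simp)
  choose w hw1 hw2 using hw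
  refine ⟨List.ofFn fun i => (S[i], w i), by simp, ?_, ?_⟩
  · intro p hp
    obtain ⟨i, rfl⟩ := (List.mem_ofFn' _ _).1 hp
    simpa using hw1 i
  · rw [List.pairwise_ofFn]
    intro i j hij
    exact hw2 j i hij _ (by simp)

/-- A legal sequence of maximum length totally dominates the vertices that are not isolated. -/
theorem IsLegal.dominates_of_max {S : List V} (h : IsLegal G S)
    (hmax : ∀ S', IsLegal G S' → S'.length ≤ S.length) {v w : V} (hvw : G.Adj v w) :
    ∃ u ∈ S, G.Adj u v := by
  by_contra! hno
  have hw : w ∉ S := fun hw => hno w hw hvw.symm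
  -- As `v` is undominated, `w` can be appended with footprint `v`; this contradicts maximality.
  have := hmax (S ++ [w]) ⟨by
    rw [List.nodup_append]
    refine ⟨h.1, by simp, ?_⟩
    intro a ha b hb
    rw [List.mem_singleton.1 hb]
    rintro rfl
    exact hw ha, ?_⟩
  · simp at this
  · intro i u hu
    rcases lt_trichotomy i S.length with hi | hi | hi
    · rw [List.getElem?_append_left hi] at hu
      obtain ⟨z, hz, hz'⟩ := h.2 i u hu
      refine ⟨z, hz, fun j hj y hy => hz' j hj y ?_⟩
      rwa [List.getElem?_append_left (hj.trans hi)] at hy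
    · subst hi
      obtain rfl : w = u := by simpa using hu
      refine ⟨v, hvw.symm, fun j hj y hy => ?_⟩
      rw [List.getElem?_append_left hj] at hy
      exact hno y (List.mem_of_getElem? hy)
    · rw [List.getElem?_eq_none (by simp; omega)] at hu
      simp at hu

/-- Reduces both cases of the definition to one statement: total domination need not be proved
separately, because it follows from maximality when no vertex is isolated. -/
theorem isGrundy_of_max {S : List V} (h : IsLegal G S)
    (hmax : ∀ S', IsLegal G S' → S'.length ≤ S.length) : IsGrundyTotalDominatingSeq G S := by
  refine ⟨fun hiso => ⟨⟨h, fun v => ?_⟩, fun S' hS' => hmax S' hS'.1⟩, fun _ => ⟨h, hmax⟩⟩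
  obtain ⟨w, hw⟩ := hiso v
  exact h.dominates_of_max hmax hw

theorem mem_nbhd {v w : V} : w ∈ nbhd G U v ↔ w ∈ U ∧ G.Adj v w := Iff.rfl

section

variable [DecidableEq V]

/-- Deleting a false twin does not shorten lists of footprints. -/
theorem Footprints.erase_falseTwin {l : List (V × V)} (h : Footprints G U l) {x y : V}
    (hy : y ∈ U) (hxy : x ≠ y) (ht : nbhd G U x = nbhd G U y) :
    ∃ l', l'.length = l.length ∧ Footprints G (U.erase x) l' := by
  -- The map folds `x` onto `y`. It is not injective, but it preserves and reflects adjacency on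
  -- `U`, and this is all that footprints depend on.
  set f : V → V := fun v => if v = x then y else v
  have hf : ∀ v ∈ U, f v ∈ U.erase x := by
    intro v hv
    by_cases e : v = x
    · simp [f, e, hy, hxy.symm]
    · simp [f, e, hv]
  have e1 : ∀ w ∈ U, (G.Adj x w ↔ G.Adj y w) := fun w hw => by
    have := Set.ext_iff.1 ht w
    simpa [mem_nbhd, hw] using this
  have ha1 : ∀ v w, w ∈ U → (G.Adj (f v) w ↔ G.Adj v w) := by
    intro v w hw
    by_cases e : v = x
    · simp [f, e, e1 w hw]
    · simp [f, e]
  have ha : ∀ v w, v ∈ U → w ∈ U → (G.Adj (f v) (f w) ↔ G.Adj v w) := by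
    intro v w hv hw
    rw [ha1 v _ (Finset.mem_of_mem_erase (hf w hw)), G.adj_comm, ha1 w v hv, G.adj_comm]
  refine ⟨l.map fun p => (f p.1, f p.2), by simp, ?_, ?_⟩
  · intro p hp
    obtain ⟨q, hq, rfl⟩ := List.mem_map.1 hp
    obtain ⟨h1, h2, h3⟩ := h.1 q hq
    exact ⟨hf _ h1, hf _ h2, (ha _ _ h1 h2).2 h3⟩
  · rw [List.pairwise_map]
    refine h.2.imp_of_mem ?_
    intro p q hp hq hpq
    rwa [ha _ _ (h.1 p hp).1 (h.1 q hq).2.1]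

/-- Deleting a leaf and its support vertex shortens lists of footprints by at most two. -/
theorem Footprints.erase_leaf {l : List (V × V)} (h : Footprints G U l) {x y : V}
    (hl : nbhd G U x = {y}) :
    ∃ l', l.length ≤ l'.length + 2 ∧ Footprints G ((U.erase x).erase y) l' := by
  have hx : ∀ w ∈ U, G.Adj x w → w = y := fun w hw hxw => by
    have : w ∈ nbhd G U x := ⟨hw, hxw⟩
    rwa [hl] at this
  -- Dropping the pairs that contain `y` also drops those containing `x`, since the only neighbour
  -- of `x` is `y`.
  refine ⟨l.filter fun p => p.1 ≠ y ∧ p.2 ≠ y, ?_, ?_, h.2.filter _⟩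
  · have h1 : (l.filter fun p => p.1 = y).length ≤ 1 := by
      have := List.nodup_iff_count_le_one.1 h.nodup_fst y
      rw [List.count, List.countP_map, List.countP_eq_length_filter] at this
      convert this using 3
      funext p
      exact Bool.eq_iff_iff.2 (by simp)
    have h2 : (l.filter fun p => p.2 = y).length ≤ 1 := by
      have := List.nodup_iff_count_le_one.1 h.nodup_snd y
      rw [List.count, List.countP_map, List.countP_eq_length_filter] at this
      convert this using 3
      funext p
      exact Bool.eq_iff_iff.2 (by simp)
    have key : ∀ l : List (V × V), l.length ≤ (l.filter fun p => p.1 ≠ y ∧ p.2 ≠ y).length +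
        ((l.filter fun p => p.1 = y).length + (l.filter fun p => p.2 = y).length) := by
      intro l
      induction l with
      | nil => simp
      | cons p l ih =>
        by_cases e1 : p.1 = y <;> by_cases e2 : p.2 = y <;>
          simp [e1, e2] at ih ⊢ <;> omega
    have := key l
    omega
  · intro p hp
    rw [List.mem_filter] at hp
    obtain ⟨hp, hy⟩ := hp
    obtain ⟨hy1, hy2⟩ : p.1 ≠ y ∧ p.2 ≠ y := by simpa using hy
    obtain ⟨h1, h2, h3⟩ := h.1 p hp
    have n1 : p.1 ≠ x := fun e => hy2 (hx _ h2 (e ▸ h3))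
    have n2 : p.2 ≠ x := fun e => hy1 (hx _ h1 (e ▸ h3.symm))
    simp [*]

end

/-- True twins are adjacent, so another neighbour of one of them would complete a triangle, which no
2-colouring allows. -/
theorem nbhd_eq_of_trueTwin (hG : G.IsBipartite) {x y : V} (hxy : x ≠ y)
    (h : insert x (nbhd G U x) = insert y (nbhd G U y)) : nbhd G U x = {y} := by
  have hxy' : y ∈ nbhd G U x := by
    have : y ∈ insert x (nbhd G U x) := h ▸ Set.mem_insert _ _
    exact this.resolve_left hxy.symm
  ext w
  refine ⟨fun hw => ?_, fun hw => hw ▸ hxy'⟩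
  have : w ∈ insert y (nbhd G U y) := h ▸ Set.mem_insert_of_mem _ hw
  refine this.resolve_right fun hyw => ?_
  obtain ⟨c⟩ := hG
  have c1 := c.valid hxy'.2
  have c2 := c.valid hw.2
  have c3 := c.valid hyw.2
  revert c1 c2 c3
  generalize c x = a
  generalize c y = b
  generalize c w = d
  revert a b d
  decide

/-- A correct word of another kind than `F` is given by a leaf. -/
theorem PruneWord.Valid.nbhd_eq (hG : G.IsBipartite) {q : PruneWord V} (hq : q.Valid G U)
    (hop : q.op ≠ .falseTwin) : nbhd G U q.x = {q.y} := by
  obtain ⟨_, _, hne, h⟩ := hq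
  rcases q with ⟨x, op, y⟩
  cases op with
  | pendant => exact h
  | falseTwin => exact absurd rfl hop
  | trueTwin => exact nbhd_eq_of_trueTwin hG hne h

end Legal

/-! ### Correctness of the algorithm, and termination if pruning sequences exist. -/

section Algorithm

variable {V : Type*} [DecidableEq V] {G : SimpleGraph V} {U : Finset V}

theorem sdiff_take_succ {σ : List V} {i : ℕ} {x : V} (h : σ[i]? = some x) :
    U \ (σ.take (i + 1)).toFinset = (U \ (σ.take i).toFinset).erase x := by
  obtain ⟨hi, rfl⟩ := List.getElem?_eq_some_iff.1 h
  rw [List.take_succ_eq_append_getElem hi]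
  ext v
  simp only [Finset.mem_erase, Finset.mem_sdiff, List.mem_toFinset, List.mem_append,
    List.mem_singleton]
  tauto

theorem callSet_eq {σ : List V} {i : ℕ} {x y : V} (h : σ[i]? = some x) :
    callSet U σ i y = ((U \ (σ.take i).toFinset).erase x).erase y := by
  rw [← sdiff_take_succ h]
  ext v
  simp [callSet]
  tauto

theorem IsPruningSequence.getElem?_eq {σ : List V} {Q : List (PruneWord V)}
    (h : IsPruningSequence G U σ Q) {i : ℕ} {q : PruneWord V} (hq : Q[i]? = some q) :
    σ[i]? = some q.x := by
  have : (Q.map PruneWord.x)[i]? = some q.x := by simp [hq]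
  rw [h.words, List.getElem?_dropLast] at this
  split_ifs at this
  exact this

/-- Iterates `Footprints.erase_falseTwin` along the initial words of kind `F`. -/
theorem IsPruningSequence.footprints_le {σ : List V} {Q : List (PruneWord V)}
    (h : IsPruningSequence G U σ Q) {l : List (V × V)} (hl : Footprints G U l) {i : ℕ}
    (hi : i ≤ Q.length) (hF : ∀ j < i, ∀ q, Q[j]? = some q → q.op = .falseTwin) :
    ∃ l', l'.length = l.length ∧ Footprints G (U \ (σ.take i).toFinset) l' := by
  induction i with
  | zero => exact ⟨l, rfl, by simpa using hl⟩
  | succ i ih =>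
    obtain ⟨l', h1, h2⟩ := ih (by omega) fun j hj => hF j (by omega)
    have hq : Q[i]? = some Q[i] := by simp
    obtain ⟨_, hy, hne, hv⟩ := h.valid i _ hq
    rw [hF i (by omega) _ hq] at hv
    obtain ⟨l'', h3, h4⟩ := h2.erase_falseTwin hy hne hv
    exact ⟨l'', h3.trans h1, by rwa [sdiff_take_succ (h.getElem?_eq hq)]⟩

/-- What the algorithm returns is legal and of maximum length. -/
theorem GrundyBDH.footprints (hG : G.IsBipartite) {L : List (List (PruneWord V))} {S : List V}
    (h : GrundyBDH G U L S) :
    (∃ l, l.map Prod.fst = S ∧ Footprints G U l) ∧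
      ∀ l, Footprints G U l → l.length ≤ S.length := by
  induction h with
  | @done U h =>
    refine ⟨⟨[], rfl, by simp, by simp⟩, fun l hl => ?_⟩
    cases l with
    | nil => simp
    | cons p l =>
      obtain ⟨h1, h2, h3⟩ := hl.1 p (by simp)
      exact absurd h3 (h _ h1 _ h2)
  | @call U σ Q i q L S h hQ hi hS ih =>
    obtain ⟨⟨l, rfl, hl⟩, hmax⟩ := ih
    obtain ⟨hq, hop, hF⟩ := hi
    have hv := hQ.valid i q hq
    have hσ := hQ.getElem?_eq hq
    have hn := hv.nbhd_eq hG hop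
    rw [callSet_eq hσ] at hl hmax
    set U' := U \ (σ.take i).toFinset with hU'
    have hxy : G.Adj q.x q.y := by
      have : q.y ∈ nbhd G U' q.x := by rw [hn]; rfl
      exact this.2
    have hx : ∀ w ∈ (U'.erase q.x).erase q.y, ¬ G.Adj q.x w := by
      intro w hw hxw
      have h1 : w ∈ nbhd G U' q.x := ⟨by simp at hw; simp [hw], hxw⟩
      rw [hn] at h1
      simp at hw
      exact hw.1 h1
    have hsub : ∀ w ∈ U', w ∈ U := fun w hw => by
      rw [hU', Finset.mem_sdiff] at hw
      exact hw.1
    -- The leaf goes first with its support vertex as footprint, and the support vertex goes last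
    -- with the leaf as footprint. Nothing in between is adjacent to the leaf.
    refine ⟨⟨(q.x, q.y) :: (l ++ [(q.y, q.x)]), by simp, ?_, ?_⟩, ?_⟩
    · intro p hp
      simp only [List.mem_cons, List.mem_append, List.not_mem_nil, or_false] at hp
      rcases hp with rfl | hp | rfl
      · exact ⟨hsub _ hv.1, hsub _ hv.2.1, hxy⟩
      · obtain ⟨h1, h2, h3⟩ := hl.1 p hp
        simp only [Finset.mem_erase] at h1 h2
        exact ⟨hsub _ h1.2.2, hsub _ h2.2.2, h3⟩
      · exact ⟨hsub _ hv.2.1, hsub _ hv.1, hxy.symm⟩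
    · rw [List.pairwise_cons, List.pairwise_append]
      refine ⟨?_, hl.2, by simp, ?_⟩
      · intro p hp
        simp only [List.mem_append, List.mem_singleton] at hp
        rcases hp with hp | rfl
        · exact hx _ (hl.1 p hp).2.1
        · exact G.loopless.irrefl _
      · intro p hp p' hp'
        rw [List.mem_singleton.1 hp']
        exact fun ha => hx _ (hl.1 p hp).1 ha.symm
    -- Upper bound: the words of kind `F` cost nothing and the leaf costs at most two pairs; the
    -- rest is bounded by induction.
    · intro l' hl'
      obtain ⟨l1, h1, h2⟩ := hQ.footprints_le hl' (by
        have := (List.getElem?_eq_some_iff.1 hq).1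
        exact this.le) hF
      obtain ⟨l2, h3, h4⟩ := h2.erase_leaf hn
      have := hmax l2 h4
      simp at this ⊢
      omega

theorem GrundyBDH.isGrundy [Fintype V] (hG : G.IsBipartite) {L : List (List (PruneWord V))}
    {S : List V} (h : GrundyBDH G Finset.univ L S) : IsGrundyTotalDominatingSeq G S := by
  obtain ⟨⟨l, rfl, hl⟩, hmax⟩ := h.footprints hG
  refine isGrundy_of_max hl.isLegal fun S' hS' => ?_
  obtain ⟨l', h1, h2⟩ := hS'.exists_footprints
  rw [← h1]
  exact hmax l' h2

/-- Every pruning sequence of a graph with edges has a word of another kind than `F`. -/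
theorem IsPruningSequence.exists_isFirst {σ : List V} {Q : List (PruneWord V)}
    (h : IsPruningSequence G U σ Q) (hU : ¬ Edgeless G U) :
    ∃ i q, IsFirstNonFalseTwin Q i q := by
  classical
  by_cases hex : ∃ i : ℕ, ∃ q : PruneWord V, Q[i]? = some q ∧ q.op ≠ .falseTwin
  · obtain ⟨q, h1, h2⟩ := Nat.find_spec hex
    refine ⟨Nat.find hex, q, h1, h2, fun j hj q' hq' => ?_⟩
    by_contra hne
    exact Nat.find_min hex hj ⟨q', hq', hne⟩
  · exfalso
    push Not at hex
    simp only [Edgeless, not_forall, not_not] at hU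
    obtain ⟨u, hu, v, hv, huv⟩ := hU
    obtain ⟨l, h1, h2⟩ := h.footprints_le (l := [(u, v)]) ⟨by simp [*], by simp⟩ le_rfl
      fun j _ q hq => hex j q hq
    obtain ⟨p, rfl⟩ := List.length_eq_one_iff.1 h1
    obtain ⟨h3, h4, h5⟩ := h2.1 p (by simp)
    have hlen : Q.length = σ.length - 1 := by
      have := congrArg List.length h.words
      simpa using this
    have : (U \ (σ.take Q.length).toFinset).card ≤ 1 := by
      have hsub : (σ.take Q.length).toFinset ⊆ U := by
        rw [← h.vertices]
        intro v
        simp only [List.mem_toFinset]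
        exact List.mem_of_mem_take
      rw [Finset.card_sdiff_of_subset hsub,
        List.toFinset_card_of_nodup (h.nodup.sublist (List.take_sublist _ _)), ← h.vertices,
        List.toFinset_card_of_nodup h.nodup, List.length_take]
      omega
    exact h5.ne (Finset.card_le_one.1 this _ h3 _ h4)

/-- If every set of vertices has a pruning sequence, then the algorithm always returns. -/
theorem alwaysReturns_of_exists (hex : ∀ U, ∃ σ Q, IsPruningSequence G U σ Q) (U : Finset V) :
    AlwaysReturns G U := by
  induction U using Finset.strongInduction with
  | H U ih =>
    by_cases hU : Edgeless G U
    · exact .done hU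
    · refine .call hU (hex U) (fun σ Q h => h.exists_isFirst hU) ?_
      intro σ Q i q h hi
      refine ih _ ?_
      have hσ := h.getElem?_eq hi.1
      have hv := h.valid i q hi.1
      rw [callSet_eq hσ]
      refine Finset.ssubset_of_subset_of_ssubset (Finset.erase_subset _ _) ?_
      exact Finset.ssubset_of_ssubset_of_subset (Finset.erase_ssubset hv.1) Finset.sdiff_subset

end Algorithm

end GrundyTD

namespace GrundyTD

/-! ### Elimination lists with isolated vertices -/

/-- A word `(x, z, y)` of an elimination list: `x` is a leaf at `y` (`z = 0`), a false twin of `y`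
(`z = 1`), or isolated (`z = 2`; then `y` has no meaning). -/
structure ElimWord (V : Type*) where
  x : V
  z : ℕ
  y : V

namespace ElimWord

variable {V : Type*}

/-- The word is correct in `G[U]`. -/
def Correct (G : SimpleGraph V) (U : Finset V) (w : ElimWord V) : Prop :=
  w.x ∈ U ∧ ((w.z = 0 ∧ nbhd G U w.x = {w.y}) ∨
    (w.z = 1 ∧ w.y ∈ U ∧ w.x ≠ w.y ∧ nbhd G U w.x = nbhd G U w.y) ∨
    (w.z = 2 ∧ nbhd G U w.x = ∅))

/-- Apply a map to the vertices of a word. -/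
def map (f : V → V) (w : ElimWord V) : ElimWord V := ⟨f w.x, w.z, f w.y⟩

/-- The word of a pruning sequence for a word that does not stand for an isolated vertex. -/
def toPrune (w : ElimWord V) : PruneWord V :=
  ⟨w.x, if w.z = 0 then .pendant else .falseTwin, w.y⟩

end ElimWord

section

variable {V : Type*} [DecidableEq V] {G : SimpleGraph V} {U : Finset V}

/-- `l` eliminates the vertices of `G[U]` one by one. -/
def Eliminates (G : SimpleGraph V) : Finset V → List (ElimWord V) → Prop
  | U, [] => U = ∅
  | U, w :: l => w.Correct G U ∧ Eliminates G (U.erase w.x) l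

theorem Eliminates.length_eq {l : List (ElimWord V)} (h : Eliminates G U l) :
    l.length = U.card := by
  induction l generalizing U with
  | nil => simp [show U = ∅ from h]
  | cons w l ih =>
    rw [List.length_cons, ih h.2, Finset.card_erase_add_one h.1.1]

theorem nbhd_image {f : V → V} (hf : ∀ u ∈ U, ∀ v ∈ U, G.Adj (f u) (f v) ↔ G.Adj u v)
    {x : V} (hx : x ∈ U) : nbhd G (U.image f) (f x) = f '' nbhd G U x := by
  ext w
  simp only [mem_nbhd, Finset.mem_image, Set.mem_image]
  constructor
  · rintro ⟨⟨v, hv, rfl⟩, ha⟩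
    exact ⟨v, ⟨hv, (hf _ hx _ hv).1 ha⟩, rfl⟩
  · rintro ⟨v, ⟨hv, ha⟩, rfl⟩
    exact ⟨⟨v, hv, rfl⟩, (hf _ hx _ hv).2 ha⟩

/-- Elimination lists are carried along by isomorphisms of induced subgraphs. -/
theorem Eliminates.map {l : List (ElimWord V)} {f : V → V}
    (hf : ∀ u ∈ U, ∀ v ∈ U, G.Adj (f u) (f v) ↔ G.Adj u v) (hinj : Set.InjOn f U)
    (h : Eliminates G U l) : Eliminates G (U.image f) (l.map (ElimWord.map f)) := by
  induction l generalizing U with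
  | nil => simp [Eliminates, show U = ∅ from h]
  | cons w l ih =>
    obtain ⟨⟨hx, hw⟩, hl⟩ := h
    refine ⟨⟨Finset.mem_image_of_mem f hx, ?_⟩, ?_⟩
    · simp only [ElimWord.map]
      rw [nbhd_image hf hx]
      rcases hw with ⟨hz, hn⟩ | ⟨hz, hy, hne, hn⟩ | ⟨hz, hn⟩
      · exact .inl ⟨hz, by rw [hn, Set.image_singleton]⟩
      · refine .inr (.inl ⟨hz, Finset.mem_image_of_mem f hy, fun e => hne (hinj hx hy e), ?_⟩)
        rw [nbhd_image hf hy, hn]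
      · exact .inr (.inr ⟨hz, by rw [hn, Set.image_empty]⟩)
    · have := ih (U := U.erase w.x)
        (fun u hu v hv => hf u (Finset.mem_of_mem_erase hu) v (Finset.mem_of_mem_erase hv))
        (hinj.mono (by simp)) hl
      convert this using 1
      ext v
      simp only [ElimWord.map, Finset.mem_erase, Finset.mem_image]
      constructor
      · rintro ⟨hne, u, hu, rfl⟩
        exact ⟨u, ⟨fun e => hne (e ▸ rfl), hu⟩, rfl⟩
      · rintro ⟨u, ⟨hne, hu⟩, rfl⟩
        exact ⟨fun e => hne (hinj hu hx e), u, hu, rfl⟩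

/-- Replace `a` by `b`. -/
def rename (a b v : V) : V := if v = a then b else v

/-- Delete the vertex `y` from an elimination list. -/
def deleteVertex (y : V) : List (ElimWord V) → List (ElimWord V)
  | [] => []
  | w :: l =>
    if w.x = y then l
    else if w.z = 2 then w :: deleteVertex y l
    else if w.y = y then
      if w.z = 0 then ⟨w.x, 2, w.x⟩ :: deleteVertex y l
      else l.map (ElimWord.map (rename y w.x))
    else w :: deleteVertex y l

theorem nbhd_erase (x y : V) : nbhd G (U.erase y) x = nbhd G U x \ {y} := by
  ext w
  simp only [mem_nbhd, Finset.mem_erase, Set.mem_sdiff, Set.mem_singleton_iff]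
  tauto

/-- Up to the word that eliminates `y`, only words referring to `y` are affected. A leaf at `y`
becomes isolated. A false twin `x` of `y` takes over the role of `y`, so the word is dropped and `y`
is renamed to `x` in the rest of the list. -/
theorem Eliminates.deleteVertex {l : List (ElimWord V)} {y : V} (hy : y ∈ U)
    (h : Eliminates G U l) : Eliminates G (U.erase y) (deleteVertex y l) := by
  induction l generalizing U with
  | nil => simp [show U = ∅ from h] at hy
  | cons w l ih =>
    obtain ⟨⟨hx, hw⟩, hl⟩ := h
    rw [GrundyTD.deleteVertex]
    split_ifs with h1 h2 h3 h4
    · rwa [h1] at hl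
    · have h' := ih (Finset.mem_erase.2 ⟨Ne.symm h1, hy⟩) hl
      rw [Finset.erase_right_comm] at h'
      refine ⟨⟨Finset.mem_erase.2 ⟨h1, hx⟩, .inr (.inr ⟨h2, ?_⟩)⟩, h'⟩
      rw [nbhd_erase]
      simp only [h2] at hw
      simp at hw
      simp [hw]
    · have h' := ih (Finset.mem_erase.2 ⟨Ne.symm h1, hy⟩) hl
      rw [Finset.erase_right_comm] at h'
      refine ⟨⟨Finset.mem_erase.2 ⟨h1, hx⟩, .inr (.inr ⟨rfl, ?_⟩)⟩, h'⟩
      simp [h4, h3] at hw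
      simp [nbhd_erase, hw]
    · simp only [h4, h2, h3, false_and, or_false, false_or] at hw
      obtain ⟨-, -, hne, hn⟩ := hw
      have hadj : ∀ v ∈ U, (G.Adj w.x v ↔ G.Adj y v) := fun v hv => by
        have := Set.ext_iff.1 hn v
        simpa [mem_nbhd, hv] using this
      -- Renaming `y` to its twin is an isomorphism from the graph without `w.x` to the graph
      -- without `y`.
      have h' := Eliminates.map (f := rename y w.x) ?_ ?_ hl
      · convert h' using 1
        ext v
        simp only [Finset.mem_erase, Finset.mem_image, rename]
        constructor
        · rintro ⟨h5, h6⟩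
          by_cases h7 : v = w.x
          · exact ⟨y, ⟨hne.symm, hy⟩, by simp [h7]⟩
          · exact ⟨v, ⟨h7, h6⟩, by simp [h5]⟩
        · rintro ⟨u, ⟨h5, h6⟩, rfl⟩
          split_ifs with h7
          · exact ⟨hne, hx⟩
          · exact ⟨h7, h6⟩
      · intro u hu v hv
        simp only [Finset.mem_erase] at hu hv
        unfold rename
        split_ifs with h5 h6 h6
        · simp [h5, h6]
        · rw [hadj v hv.2, h5]
        · rw [G.adj_comm, hadj u hu.2, h6, G.adj_comm]
        · rfl
      · intro u hu v hv e
        simp only [Finset.coe_erase, Set.mem_sdiff, Finset.mem_coe, Set.mem_singleton_iff] at hu hv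
        unfold rename at e
        split_ifs at e with h5 h6 h6
        · rw [h5, h6]
        · exact absurd e.symm hv.2
        · exact absurd e hu.2
        · exact e
    · have h' := ih (Finset.mem_erase.2 ⟨Ne.symm h1, hy⟩) hl
      rw [Finset.erase_right_comm] at h'
      refine ⟨⟨Finset.mem_erase.2 ⟨h1, hx⟩, ?_⟩, h'⟩
      rw [nbhd_erase, nbhd_erase]
      rcases hw with ⟨hz, hn⟩ | ⟨hz, hy, hne, hn⟩ | ⟨hz, hn⟩
      · refine .inl ⟨hz, ?_⟩
        rw [hn]
        ext v
        simp only [Set.mem_sdiff, Set.mem_singleton_iff]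
        constructor
        · exact fun h => h.1
        · rintro rfl
          exact ⟨rfl, h3⟩
      · exact .inr (.inl ⟨hz, Finset.mem_erase.2 ⟨h3, hy⟩, hne, by rw [hn]⟩)
      · exact absurd hz h2

/-- The vertices outside of `U` are deleted one by one. -/
theorem Eliminates.exists_of_univ [Fintype V] {l : List (ElimWord V)}
    (h : Eliminates G Finset.univ l) (U : Finset V) : ∃ l, Eliminates G U l := by
  have key : ∀ T : Finset V, ∃ l, Eliminates G (Finset.univ \ T) l := by
    intro T
    induction T using Finset.induction_on with
    | empty => exact ⟨l, by simpa using h⟩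
    | insert a T ha ih =>
      obtain ⟨l, hl⟩ := ih
      have := hl.deleteVertex (y := a) (by simpa using ha)
      rw [← Finset.sdiff_insert] at this
      exact ⟨_, this⟩
  simpa using key Uᶜ

/-! ### From elimination lists to pruning sequences -/

/-- The words that prune a list of isolated vertices down to its last entry. -/
def isolatedWords (J : List V) : List (PruneWord V) :=
  match J.getLast? with
  | none => []
  | some r => J.dropLast.map fun x => ⟨x, .falseTwin, r⟩

/-- The isolated vertices of an elimination list. -/
def isolatedVertices (l : List (ElimWord V)) : List V :=
  (l.filter fun w => w.z = 2).map ElimWord.x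

/-- The words of the pruning sequence in which the isolated vertices, and those in `J`, come
last. -/
def pruneWords (l : List (ElimWord V)) (J : List V) : List (PruneWord V) :=
  (l.filter fun w => w.z ≠ 2).map ElimWord.toPrune ++ isolatedWords (J ++ isolatedVertices l)

/-- The vertices in the order of `pruneWords`. -/
def pruneOrder (l : List (ElimWord V)) (J : List V) : List V :=
  (l.filter fun w => w.z ≠ 2).map ElimWord.x ++ (J ++ isolatedVertices l)

theorem IsPruningSequence.cons {σ : List V} {Q : List (PruneWord V)} {w : PruneWord V}
    (hw : w.Valid G U) (h : IsPruningSequence G (U.erase w.x) σ Q) :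
    IsPruningSequence G U (w.x :: σ) (w :: Q) := by
  have hx : w.x ∉ σ := fun hx => by
    rw [← List.mem_toFinset, h.vertices] at hx
    simp at hx
  -- The vertex `w.y` is still present, so `w.x` is not the last vertex of the ordering, the only
  -- one without a word.
  have hne : σ ≠ [] := by
    rintro rfl
    have : w.y ∈ U.erase w.x := Finset.mem_erase.2 ⟨hw.2.2.1.symm, hw.2.1⟩
    rw [← h.vertices] at this
    simp at this
  refine ⟨List.nodup_cons.2 ⟨hx, h.nodup⟩, ?_, ?_, ?_⟩
  · rw [List.toFinset_cons, h.vertices, Finset.insert_erase hw.1]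
  · rw [List.map_cons, h.words, List.dropLast_cons_of_ne_nil hne]
  · intro i q hq
    cases i with
    | zero =>
      obtain rfl : w = q := by simpa using hq
      simpa using hw
    | succ i =>
      have := h.valid i q (by simpa using hq)
      rwa [List.take_succ_cons, List.toFinset_cons, Finset.sdiff_insert, ← Finset.erase_sdiff_comm]

/-- Without edges all neighbourhoods are empty, so every vertex is a false twin of the last one. -/
theorem isPruningSequence_isolated (J : List V) (r : V) (hJ : (J ++ [r]).Nodup)
    (he : Edgeless G (J ++ [r]).toFinset) :
    IsPruningSequence G (J ++ [r]).toFinset (J ++ [r]) (J.map fun x => ⟨x, .falseTwin, r⟩) := by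
  induction J with
  | nil => exact ⟨by simp, rfl, by simp, by simp⟩
  | cons x J ih =>
    rw [List.cons_append, List.nodup_cons] at hJ
    have hn : ∀ v ∈ (x :: J ++ [r]).toFinset, nbhd G (x :: J ++ [r]).toFinset v = ∅ := by
      intro v hv
      ext u
      simp only [mem_nbhd, Set.mem_empty_iff_false, iff_false, not_and]
      exact fun hu => he _ hv _ hu
    refine IsPruningSequence.cons (w := ⟨x, .falseTwin, r⟩) ⟨by simp, by simp, ?_, ?_⟩ ?_
    · exact fun e => hJ.1 (by simp [show x = r from e])
    · change nbhd G _ x = nbhd G _ r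
      rw [hn _ (by simp), hn _ (by simp)]
    · have : (x :: J ++ [r]).toFinset.erase x = (J ++ [r]).toFinset := by
        rw [List.cons_append, List.toFinset_cons, Finset.erase_insert (by rw [List.mem_toFinset]; exact hJ.1)]
      simp only [this]
      refine ih hJ.2 fun u hu v hv => he u ?_ v ?_
      · rw [← this] at hu
        exact Finset.mem_of_mem_erase hu
      · rw [← this] at hv
        exact Finset.mem_of_mem_erase hv

/-- The list `J` collects the isolated vertices that have been passed; they remain in the graph
until the end. Keeping them does no harm, because they lie in no neighbourhood. -/
theorem Eliminates.isPruningSequence_aux {l : List (ElimWord V)} (h : Eliminates G U l)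
    {J : List V} (hJ : J.Nodup) (hd : ∀ j ∈ J, j ∉ U)
    (hi : ∀ j ∈ J, ∀ v ∈ U ∪ J.toFinset, ¬ G.Adj j v) :
    IsPruningSequence G (U ∪ J.toFinset) (pruneOrder l J) (pruneWords l J) := by
  induction l generalizing U J with
  | nil =>
    obtain rfl : U = ∅ := h
    rcases List.eq_nil_or_concat' J with rfl | ⟨J, r, rfl⟩
    · exact ⟨by simp [pruneOrder, isolatedVertices], by simp [pruneOrder, isolatedVertices],
        by simp [pruneOrder, pruneWords, isolatedVertices, isolatedWords],
        by simp [pruneWords, isolatedVertices, isolatedWords]⟩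
    · have := isPruningSequence_isolated (G := G) J r hJ fun u hu v hv =>
        hi u (List.mem_toFinset.1 hu) v (Finset.mem_union_right _ hv)
      simpa [pruneOrder, pruneWords, isolatedVertices, isolatedWords] using this
  | cons w l ih =>
    obtain ⟨⟨hx, hw⟩, hl⟩ := h
    by_cases hz : w.z = 2
    · have hn : nbhd G U w.x = ∅ := by
        simp [hz] at hw
        exact hw
      have hn' : ∀ v ∈ U, ¬ G.Adj w.x v := fun v hv ha => by
        have : v ∈ nbhd G U w.x := ⟨hv, ha⟩
        simp [hn] at this
      have e : U ∪ J.toFinset = U.erase w.x ∪ (J ++ [w.x]).toFinset := by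
        ext v
        by_cases hv : v = w.x <;> simp [hv, hx]
      have := ih (J := J ++ [w.x]) hl ?_ ?_ ?_
      · rw [e]
        simpa [pruneOrder, pruneWords, isolatedVertices, hz] using this
      · rw [List.nodup_append]
        refine ⟨hJ, by simp, ?_⟩
        intro a ha b hb
        rw [List.mem_singleton.1 hb]
        rintro rfl
        exact hd _ ha hx
      · intro j hj
        rcases List.mem_append.1 hj with hj | hj
        · exact fun hj' => hd _ hj (Finset.mem_of_mem_erase hj')
        · rw [List.mem_singleton.1 hj]
          simp
      · rw [← e]
        intro j hj v hv
        rcases List.mem_append.1 hj with hj | hj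
        · exact hi _ hj _ hv
        · rw [List.mem_singleton.1 hj]
          rcases Finset.mem_union.1 hv with hv | hv
          · exact hn' v hv
          · exact fun ha => hi v (by simpa using hv) _ (by simp [hx]) ha.symm
    · have hnb : ∀ v ∈ U, nbhd G (U ∪ J.toFinset) v = nbhd G U v := by
        intro v hv
        ext u
        simp only [mem_nbhd, Finset.mem_union]
        refine ⟨fun ⟨h1, h2⟩ => ⟨h1.resolve_right fun hu => ?_, h2⟩, fun ⟨h1, h2⟩ => ⟨.inl h1, h2⟩⟩
        exact hi u (by simpa using hu) v (by simp [hv]) h2.symm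
      have e : (U ∪ J.toFinset).erase w.x = U.erase w.x ∪ J.toFinset := by
        rw [Finset.erase_union_distrib, Finset.erase_eq_of_notMem (s := J.toFinset)]
        intro hj
        exact hd _ (by simpa using hj) hx
      have := ih (J := J) hl hJ (fun j hj hj' => hd _ hj (Finset.mem_of_mem_erase hj'))
        (fun j hj v hv => hi j hj v (by rw [← e] at hv; exact Finset.mem_of_mem_erase hv))
      rw [← e] at this
      have := IsPruningSequence.cons (w := w.toPrune) ?_ this
      · simpa [pruneOrder, pruneWords, isolatedVertices, hz, ElimWord.toPrune] using this
      · rcases hw with ⟨hz, hn⟩ | ⟨hz, hy, hne, hn⟩ | ⟨hz', hn⟩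
        · have hy : w.y ∈ nbhd G U w.x := by rw [hn]; rfl
          refine ⟨by simp [ElimWord.toPrune, hx], by simp [ElimWord.toPrune, hy.1], hy.2.ne, ?_⟩
          simp only [ElimWord.toPrune, hz, if_true]
          rw [hnb _ hx, hn]
        · refine ⟨by simp [ElimWord.toPrune, hx], by simp [ElimWord.toPrune, hy], hne, ?_⟩
          simp only [ElimWord.toPrune, hz, one_ne_zero, if_false]
          rw [hnb _ hx, hnb _ hy, hn]
        · exact absurd hz' hz

theorem Eliminates.isPruningSequence {l : List (ElimWord V)} (h : Eliminates G U l) :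
    IsPruningSequence G U (pruneOrder l []) (pruneWords l []) := by
  simpa using h.isPruningSequence_aux (J := []) (by simp) (by simp) (by simp)

theorem alwaysReturns_of_eliminates [Fintype V] {l : List (ElimWord V)}
    (h : Eliminates G Finset.univ l) (U : Finset V) : AlwaysReturns G U :=
  alwaysReturns_of_exists (fun U => by
    obtain ⟨l, hl⟩ := h.exists_of_univ U
    exact ⟨_, _, hl.isPruningSequence⟩) U

/-! ### One call of the algorithm on elimination lists -/

/-- The elimination list of the graph of the recursive call. -/
def nextCall : List (ElimWord V) → List (ElimWord V)
  | [] => []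
  | w :: l =>
    if w.z = 0 then deleteVertex w.y l
    else if w.z = 1 then nextCall l
    else w :: nextCall l

/-- This is the stopping condition of the program. By induction the graph without `w.x` has no
edges, and then a false twin of one of its vertices has no neighbours either. -/
theorem Eliminates.edgeless {l : List (ElimWord V)} (h : Eliminates G U l)
    (hl : ∀ w ∈ l, w.z ≠ 0) : Edgeless G U := by
  induction l generalizing U with
  | nil =>
    obtain rfl : U = ∅ := h
    simp [Edgeless]
  | cons w l ih =>
    obtain ⟨⟨hx, hw⟩, hl'⟩ := h
    have ih := ih hl' fun w' hw' => hl w' (by simp [hw'])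
    have hiso : ∀ v ∈ U, ¬ G.Adj w.x v := by
      intro v hv ha
      rcases hw with ⟨hz, -⟩ | ⟨hz, hy, hne, hn⟩ | ⟨hz, hn⟩
      · exact hl w (by simp) hz
      · have h1 : v ∈ nbhd G U w.y := by
          rw [← hn]
          exact ⟨hv, ha⟩
        exact ih _ (Finset.mem_erase.2 ⟨hne.symm, hy⟩) _ (Finset.mem_erase.2 ⟨ha.ne', hv⟩) h1.2
      · have : v ∈ nbhd G U w.x := ⟨hv, ha⟩
        simp [hn] at this
    intro u hu v hv ha
    by_cases h1 : u = w.x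
    · exact hiso v hv (h1 ▸ ha)
    · by_cases h2 : v = w.x
      · exact hiso u hu (h2 ▸ ha.symm)
      · exact ih _ (Finset.mem_erase.2 ⟨h1, hu⟩) _ (Finset.mem_erase.2 ⟨h2, hv⟩) ha

/-- False twins before the first leaf disappear in the call. Isolated vertices before it are
postponed by `pruneOrder`, so they survive in the recursive graph, and `nextCall` keeps their words.
The inclusion in `U` is part of the statement so that the induction can exclude postponed vertices
from the deleted part. -/
theorem Eliminates.exists_call_aux {l : List (ElimWord V)} (h : Eliminates G U l) {w : ElimWord V}
    (hw : l.find? (fun w => w.z = 0) = some w) (J : List V) :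
    ∃ i, IsFirstNonFalseTwin (pruneWords l J) i w.toPrune ∧
      ((pruneOrder l J).take (i + 1)).toFinset ⊆ U ∧
      w.x ∈ ((pruneOrder l J).take (i + 1)).toFinset ∧ w.y ∈ U ∧ G.Adj w.x w.y ∧
      Eliminates G (callSet U (pruneOrder l J) i w.y) (nextCall l) := by
  induction l generalizing U J with
  | nil => simp at hw
  | cons w' l ih =>
    obtain ⟨⟨hx, hc⟩, hl⟩ := h
    rcases hc with ⟨hz, hn⟩ | ⟨hz, hy, hne, hn⟩ | ⟨hz, hn⟩
    · obtain rfl : w' = w := by simpa [hz] using hw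
      have hy : w'.y ∈ nbhd G U w'.x := by rw [hn]; rfl
      have hy' : w'.y ∈ U.erase w'.x := Finset.mem_erase.2 ⟨hy.2.ne', hy.1⟩
      refine ⟨0, ⟨?_, by simp [ElimWord.toPrune, hz], by simp⟩, ?_, ?_, hy.1, hy.2, ?_⟩
      · simp [pruneWords, hz]
      · simp [pruneOrder, hz, hx]
      · simp [pruneOrder, hz]
      · have e : callSet U (pruneOrder (w' :: l) J) 0 w'.y = (U.erase w'.x).erase w'.y := by
          ext v
          simp [pruneOrder, hz, callSet]
          tauto
        rw [e, nextCall, if_pos hz]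
        exact hl.deleteVertex hy'
    · have e : pruneOrder (w' :: l) J = w'.x :: pruneOrder l J := by
        simp [pruneOrder, isolatedVertices, hz]
      have e' : pruneWords (w' :: l) J = w'.toPrune :: pruneWords l J := by
        simp [pruneWords, isolatedVertices, hz]
      obtain ⟨i, hi, h1, h2, h3, h4, h5⟩ := ih hl (by simpa [hz] using hw) J
      refine ⟨i + 1, ⟨by simpa [e'] using hi.1, hi.2.1, ?_⟩, ?_, ?_,
        Finset.mem_of_mem_erase h3, h4, ?_⟩
      · intro j hj q hq
        rw [e'] at hq
        cases j with
        | zero =>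
          obtain rfl : w'.toPrune = q := by simpa using hq
          simp [ElimWord.toPrune, hz]
        | succ j => exact hi.2.2 j (by omega) q (by simpa using hq)
      · intro v hv
        rw [e, List.take_succ_cons, List.toFinset_cons, Finset.mem_insert] at hv
        rcases hv with rfl | hv
        · exact hx
        · exact Finset.mem_of_mem_erase (h1 hv)
      · rw [e, List.take_succ_cons, List.toFinset_cons, Finset.mem_insert]
        exact .inr h2
      · rw [nextCall, if_neg (by omega), if_pos hz]
        convert h5 using 1
        ext v
        simp only [callSet, e, List.take_succ_cons, List.toFinset_cons, Finset.mem_sdiff,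
          Finset.mem_insert, Finset.mem_erase]
        tauto
    · have e : pruneOrder (w' :: l) J = pruneOrder l (J ++ [w'.x]) := by
        simp [pruneOrder, hz, isolatedVertices]
      have e' : pruneWords (w' :: l) J = pruneWords l (J ++ [w'.x]) := by
        simp [pruneWords, hz, isolatedVertices]
      rw [e, e']
      obtain ⟨i, hi, h1, h2, h3, h4, h5⟩ := ih hl (by simpa [hz] using hw) (J ++ [w'.x])
      refine ⟨i, hi, h1.trans (Finset.erase_subset _ _), h2, Finset.mem_of_mem_erase h3, h4, ?_⟩
      rw [nextCall, if_neg (by omega), if_neg (by omega)]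
      have hx1 : w'.x ∉ ((pruneOrder l (J ++ [w'.x])).take (i + 1)).toFinset := fun hm => by
        simpa using h1 hm
      have hx2 : w'.x ≠ w.y := by
        intro hm
        rw [← hm] at h3
        simp at h3
      refine ⟨⟨?_, .inr (.inr ⟨hz, ?_⟩)⟩, ?_⟩
      · simp only [callSet, Finset.mem_sdiff, Finset.mem_insert, not_or]
        exact ⟨hx, hx2, hx1⟩
      · rw [Set.eq_empty_iff_forall_notMem] at hn ⊢
        exact fun v hv => hn v ⟨(Finset.mem_sdiff.1 hv.1).1, hv.2⟩
      · rw [callSet, ← Finset.erase_sdiff_comm]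
        exact h5

/-- The interface to the program: `nextCall` realizes one recursive call, and any run on the smaller
graph extends to a run on the present one. The length drops by at least two because `w.x` and `w.y`
are both deleted, which bounds the number of calls. -/
theorem Eliminates.exists_call {l : List (ElimWord V)} (h : Eliminates G U l) {w : ElimWord V}
    (hw : l.find? (fun w => w.z = 0) = some w) :
    ∃ U', Eliminates G U' (nextCall l) ∧ (nextCall l).length + 2 ≤ l.length ∧
      ∀ L S, GrundyBDH G U' L S →
        GrundyBDH G U (pruneWords l [] :: L) ([w.x] ++ S ++ [w.y]) := by
  obtain ⟨i, hi, h1, h2, h3, h4, h5⟩ := h.exists_call_aux hw []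
  refine ⟨_, h5, ?_, fun L S hS => GrundyBDH.call ?_ h.isPruningSequence hi hS⟩
  · rw [h.length_eq, h5.length_eq]
    have : callSet U (pruneOrder l []) i w.y ⊆ (U.erase w.x).erase w.y := by
      intro v hv
      simp only [callSet, Finset.mem_sdiff, Finset.mem_insert, not_or] at hv
      refine Finset.mem_erase.2 ⟨hv.2.1, Finset.mem_erase.2 ⟨?_, hv.1⟩⟩
      rintro rfl
      exact hv.2.2 h2
    have := Finset.card_le_card this
    rw [Finset.card_erase_of_mem (Finset.mem_erase.2 ⟨h4.ne', h3⟩),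
      Finset.card_erase_of_mem (h1 h2)] at this
    have hc : 1 < U.card := Finset.one_lt_card.2 ⟨_, h1 h2, _, h3, h4.ne⟩
    omega
  · exact fun he => he _ (h1 h2) _ h3 h4

end

end GrundyTD

namespace GrundyTD

/-! ### Distance layers of bipartite distance-hereditary graphs -/

/-- `ρ` picks a root in every connected component of the bipartite distance-hereditary graph
`G`. -/
structure IsRooting {V : Type*} (G : SimpleGraph V) (ρ : V → V) : Prop where
  bipartite : G.IsBipartite
  distanceHereditary : IsDistanceHereditary G
  reachable : ∀ v, G.Reachable (ρ v) v
  eq_of_adj : ∀ {u v}, G.Adj u v → ρ u = ρ v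

/-- The distance from the root. -/
noncomputable def level {V : Type*} (G : SimpleGraph V) (ρ : V → V) (v : V) : ℕ := G.dist (ρ v) v

section

variable {V : Type*} {G : SimpleGraph V} {ρ : V → V}

theorem connected_of_root {T : Set V} (r : T) (h : ∀ v : T, (G.induce T).Reachable r v) :
    (G.induce T).Connected :=
  { preconnected := fun u v => (h u).symm.trans (h v)
    nonempty := ⟨r⟩ }

theorem walk_cases {W : Type*} {H : SimpleGraph W} {u v : W} (p : H.Walk u v) :
    (u = v ∧ p.length = 0) ∨ ∃ w, H.Adj u w ∧ ∃ q : H.Walk w v, p.length = q.length + 1 := by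
  cases p with
  | nil => exact .inl ⟨rfl, rfl⟩
  | cons ha q => exact .inr ⟨_, ha, q, rfl⟩

theorem reachable_induce {T : Set V} {u v : V} (hu : u ∈ T) (hv : v ∈ T) (h : G.Adj u v) :
    (G.induce T).Reachable ⟨u, hu⟩ ⟨v, hv⟩ :=
  SimpleGraph.Adj.reachable (by simpa using h)

/-- In a distance-hereditary graph, the ends of an induced path with five vertices have no common
neighbour. -/
theorem IsDistanceHereditary.no_short_path (hG : IsDistanceHereditary G) {a b c d e m : V}
    (hab : G.Adj a b) (hbc : G.Adj b c) (hcd : G.Adj c d) (hde : G.Adj d e)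
    (hac : ¬ G.Adj a c) (had : ¬ G.Adj a d) (hae : ¬ G.Adj a e) (hbe : ¬ G.Adj b e)
    (hce : ¬ G.Adj c e) (ham : G.Adj a m) (hme : G.Adj m e) : False := by
  set T : Set V := {a, b, c, d, e} with hT
  have ha : a ∈ T := by simp [hT]
  have hb : b ∈ T := by simp [hT]
  have hc : c ∈ T := by simp [hT]
  have hd : d ∈ T := by simp [hT]
  have he : e ∈ T := by simp [hT]
  have rb := reachable_induce ha hb hab
  have rc := rb.trans (reachable_induce hb hc hbc)
  have rd := rc.trans (reachable_induce hc hd hcd)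
  have re := rd.trans (reachable_induce hd he hde)
  have hconn : (G.induce T).Connected := by
    refine connected_of_root ⟨a, ha⟩ ?_
    rintro ⟨v, hv⟩
    have hv' : v = a ∨ v = b ∨ v = c ∨ v = d ∨ v = e := by simpa [hT] using hv
    rcases hv' with rfl | rfl | rfl | rfl | rfl
    · exact .refl _
    · exact rb
    · exact rc
    · exact rd
    · exact re
  obtain ⟨p, hp⟩ := re.exists_walk_length_eq_dist
  have h2 : G.dist a e ≤ 2 := SimpleGraph.dist_le (.cons ham (.cons hme .nil))
  rw [hG T hconn] at hp
  rw [← hp] at h2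
  have hv : ∀ v : T, (v : V) = a ∨ (v : V) = b ∨ (v : V) = c ∨ (v : V) = d ∨ (v : V) = e :=
    fun v => v.2
  -- The walk `p` stays in `T` and has length at most two. Neither an edge from `a` to `e` nor a
  -- common neighbour of `a` and `e` is available among the five vertices.
  rcases walk_cases p with ⟨h, -⟩ | ⟨v, h, q, hq⟩
  · rw [Subtype.mk.injEq] at h
    exact hbe (h ▸ hab.symm)
  rcases walk_cases q with ⟨rfl, -⟩ | ⟨w, h', r, hr⟩
  · exact hae (by simpa using h)
  rcases walk_cases r with ⟨rfl, -⟩ | ⟨_, _, _, _⟩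
  · have h : G.Adj a v := by simpa using h
    have h' : G.Adj v e := by simpa using h'
    rcases hv v with hv | hv | hv | hv | hv <;> rw [hv] at h h'
    · exact h.ne rfl
    · exact hbe h'
    · exact hac h
    · exact had h
    · exact h'.ne rfl
  · omega

namespace IsRooting

variable (h : IsRooting G ρ)
include h

theorem eq_of_reachable {u v : V} (huv : G.Reachable u v) : ρ u = ρ v := by
  obtain ⟨p⟩ := huv
  induction p with
  | nil => rfl
  | cons ha _ ih => exact (h.eq_of_adj ha).trans ih

theorem level_le {u v : V} (huv : G.Adj u v) : level G ρ v ≤ level G ρ u + 1 := by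
  obtain ⟨p, hp⟩ := (h.reachable u).exists_walk_length_eq_dist
  rw [level, ← h.eq_of_adj huv, level, ← hp]
  have := SimpleGraph.dist_le (p.concat huv)
  simpa using this

/-- Both levels are lengths of walks from the same root, and the parity of such a length determines
the colour of the endpoint. -/
theorem level_ne {u v : V} (huv : G.Adj u v) : level G ρ u ≠ level G ρ v := by
  obtain ⟨c⟩ := h.bipartite
  intro e
  obtain ⟨p, hp⟩ := (h.reachable u).exists_walk_length_eq_dist
  obtain ⟨q, hq⟩ := (h.reachable v).exists_walk_length_eq_dist
  have key : ∀ {a b : V} (w : G.Walk a b),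
      (c b).val % 2 = ((c a).val + w.length) % 2 := by
    intro a b w
    induction w with
    | nil => simp
    | cons hadj w ih =>
      have := c.valid hadj
      rw [ih, SimpleGraph.Walk.length_cons]
      rename_i a' b' c'
      have h1 := (c a').isLt
      have h2 := (c b').isLt
      have h3 : (c a').val ≠ (c b').val := fun e => this (Fin.ext e)
      omega
  have h1 := key p
  have h2 := key q
  have h3 : (c u).val ≠ (c v).val := fun e => c.valid huv (Fin.ext e)
  have h4 := (c u).isLt
  have h5 := (c v).isLt
  rw [hp, h.eq_of_adj huv] at h1
  unfold level at e
  rw [h.eq_of_adj huv] at e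
  rw [hq, ← e] at h2
  omega

theorem level_adj {u v : V} (huv : G.Adj u v) :
    level G ρ v = level G ρ u + 1 ∨ level G ρ u = level G ρ v + 1 := by
  have h1 := h.level_le huv
  have h2 := h.level_le huv.symm
  have h3 := h.level_ne huv
  omega

theorem not_adj {u v : V} (huv : level G ρ u = level G ρ v) : ¬ G.Adj u v :=
  fun ha => h.level_ne ha huv

theorem exists_lower {v : V} (hv : level G ρ v ≠ 0) :
    ∃ u, G.Adj u v ∧ level G ρ v = level G ρ u + 1 := by
  obtain ⟨p, hp⟩ := (h.reachable v).symm.exists_walk_length_eq_dist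
  rw [SimpleGraph.dist_comm] at hp
  change _ = level G ρ v at hp
  rcases walk_cases p with ⟨-, h0⟩ | ⟨u, ha, q, hq⟩
  · omega
  · refine ⟨u, ha.symm, ?_⟩
    have h1 : level G ρ u ≤ q.length := by
      rw [level, h.eq_of_adj ha.symm, SimpleGraph.dist_comm]
      exact SimpleGraph.dist_le q
    have h2 := h.level_le ha.symm
    omega

theorem eq_root {v : V} (hv : level G ρ v = 0) : v = ρ v :=
  ((h.reachable v).dist_eq_zero_iff.1 hv).symm

/-- Vertices with a common neighbour in the next layer have the same neighbours in the layer
below. -/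
theorem lower_adj {a b c x : V} (hca : G.Adj c a) (hc : level G ρ a = level G ρ c + 1)
    (hax : G.Adj a x) (hx : level G ρ x = level G ρ a + 1) (hbx : G.Adj b x)
    (hb : level G ρ b = level G ρ a) : G.Adj c b := by
  by_contra hcb
  have hρb : ρ b = ρ a := (h.eq_of_adj hbx).trans (h.eq_of_adj hax).symm
  have hρc : ρ c = ρ a := h.eq_of_adj hca
  -- The layers below `a` in its component together with `b`. Descending to the root shows that `T`
  -- is connected, so distances in it agree with those in `G`.
  set T : Set V := {v | (ρ v = ρ a ∧ level G ρ v < level G ρ a) ∨ v = b} with hT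
  have hr : ρ a ∈ T := by
    refine .inl ⟨h.eq_of_reachable (h.reachable a), ?_⟩
    rw [level, h.eq_of_reachable (h.reachable a), SimpleGraph.dist_self]
    omega
  have hreach : ∀ k v (hv : v ∈ T), level G ρ v = k → (G.induce T).Reachable ⟨ρ a, hr⟩ ⟨v, hv⟩ := by
    intro k
    induction k with
    | zero =>
      intro v hv hk
      have h1 := h.eq_root hk
      have h2 : ρ v = ρ a := by
        rcases hv with hv | rfl
        · exact hv.1
        · exact hρb
      have h3 : ρ a = v := by rw [← h2, ← h1]
      subst h3
      exact .refl _
    | succ k ih =>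
      intro v hv hk
      obtain ⟨u, huv, hu⟩ := h.exists_lower (v := v) (by omega)
      have hu' : u ∈ T := by
        refine .inl ⟨(h.eq_of_adj huv).trans ?_, ?_⟩
        · rcases hv with hv | rfl
          · exact hv.1
          · exact hρb
        · rcases hv with hv | rfl
          · omega
          · omega
      exact (ih u hu' (by omega)).trans (reachable_induce hu' hv huv)
  have hconn : (G.induce T).Connected :=
    connected_of_root ⟨ρ a, hr⟩ fun v => hreach _ v.1 v.2 rfl
  have hcT : c ∈ T := .inl ⟨hρc, by omega⟩
  have hbT : b ∈ T := .inr rfl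
  -- The walk through `a` and `x` leaves `T`; a walk in `T` that is no longer must exist too. Its
  -- length cannot be `0` or `2` because of the layers, nor `1` by assumption.
  have h3 : G.dist c b ≤ 3 := SimpleGraph.dist_le (.cons hca (.cons hax (.cons hbx.symm .nil)))
  obtain ⟨p, hp⟩ := (hconn.preconnected ⟨c, hcT⟩ ⟨b, hbT⟩).exists_walk_length_eq_dist
  rw [h.distanceHereditary T hconn] at hp
  rw [← hp] at h3
  have hlow : ∀ v : T, G.Adj c v → level G ρ c = level G ρ v + 1 := by
    intro v hv
    rcases v.2 with h1 | h1
    · have := h.level_adj hv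
      omega
    · rw [h1] at hv
      exact absurd hv hcb
  rcases walk_cases p with ⟨h', -⟩ | ⟨v, h', p, hp'⟩
  · rw [Subtype.mk.injEq] at h'
    rw [h'] at hc
    omega
  rcases walk_cases p with ⟨rfl, -⟩ | ⟨w, h'', p, hp''⟩
  · exact hcb (by simpa using h')
  have h' : G.Adj c v := by simpa using h'
  have h'' : G.Adj v w := by simpa using h''
  have h1 := hlow v h'
  have h2 := h.level_adj h''
  rcases walk_cases p with ⟨h4, -⟩ | ⟨w', h''', p, hp'''⟩
  · rw [h4] at h2
    simp only at h2
    omega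
  rcases walk_cases p with ⟨rfl, -⟩ | ⟨_, _, _, _⟩
  · have h''' : G.Adj w b := by simpa using h'''
    -- Length three: the path `v, c, a, x, b` climbs from two layers below `a`, while `w` is a
    -- common neighbour of its ends.
    refine h.distanceHereditary.no_short_path h'.symm hca hax hbx.symm ?_ ?_ ?_ hcb ?_ h'' h'''
    · intro ha
      have := h.level_adj ha
      omega
    · intro ha
      have := h.level_adj ha
      omega
    · intro ha
      have := h.level_adj ha
      omega
    · exact h.not_adj hb.symm
  · omega

/-- Two vertices of one layer with a common neighbour in the layer below have comparable
neighbourhoods there. -/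
theorem comparable {x x' a b e : V} (hx : level G ρ x = level G ρ x')
    (hxa : G.Adj x a) (ha : level G ρ x = level G ρ a + 1) (hxa' : G.Adj x' a)
    (hxb : G.Adj x b) (hb : level G ρ x = level G ρ b + 1) (hxb' : ¬ G.Adj x' b)
    (hxe : G.Adj x' e) (he : level G ρ x = level G ρ e + 1) (hxe' : ¬ G.Adj x e) : False := by
  -- If `a` is the root, then so is `b`, and `a = b`.
  by_cases h0 : level G ρ a = 0
  · have h1 := h.eq_root h0
    have h2 := h.eq_root (v := b) (by omega)
    have h3 : ρ a = ρ b := (h.eq_of_adj hxa).symm.trans (h.eq_of_adj hxb)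
    rw [← h1, ← h2] at h3
    exact hxb' (h3 ▸ hxa')
  -- A vertex `c` below `a` is adjacent to `b` and `e` by `lower_adj`, so it joins the ends of the
  -- path `b, x, a, x', e`.
  · obtain ⟨c, hca, hc⟩ := h.exists_lower h0
    have hcb : G.Adj c b := h.lower_adj hca hc hxa.symm ha hxb.symm (by omega)
    have hce : G.Adj c e := h.lower_adj hca hc hxa'.symm (by omega) hxe.symm (by omega)
    exact h.distanceHereditary.no_short_path hxb.symm hxa hxa'.symm hxe
      (h.not_adj (by omega)) (fun ha => hxb' ha.symm) (h.not_adj (by omega)) hxe'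
      (h.not_adj (by omega)) hcb.symm hce

end IsRooting

/-! ### Extremal vertices and the existence of elimination lists. -/

/-- The number of neighbours in `G[U]`. -/
noncomputable def degIn (G : SimpleGraph V) (U : Finset V) (v : V) : ℕ := (nbhd G U v).ncard

/-- Every vertex of `U` that is not a root has a neighbour in `U` in the layer below. -/
def LowerClosed (G : SimpleGraph V) (ρ : V → V) (U : Finset V) : Prop :=
  ∀ v ∈ U, level G ρ v ≠ 0 → ∃ u ∈ U, G.Adj u v ∧ level G ρ v = level G ρ u + 1

/-- The layers, where the components are shifted against each other. -/
noncomputable def height (G : SimpleGraph V) (ρ : V → V) (g : V → ℕ) (v : V) : ℕ :=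
  g (ρ v) + level G ρ v

/-- `x` has maximum height in `U`, and minimum degree among the vertices of maximum height. -/
structure IsExtremal (G : SimpleGraph V) (ρ : V → V) (g : V → ℕ) (U : Finset V) (x : V) :
    Prop where
  mem : x ∈ U
  max : ∀ v ∈ U, height G ρ g v ≤ height G ρ g x
  min : ∀ v ∈ U, height G ρ g v = height G ρ g x → degIn G U x ≤ degIn G U v

theorem nbhd_finite (U : Finset V) (v : V) : (nbhd G U v).Finite :=
  U.finite_toSet.subset fun _ hw => hw.1

namespace IsExtremal

variable {g : V → ℕ} {U : Finset V} {x : V} (hx : IsExtremal G ρ g U x) (h : IsRooting G ρ)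
include hx h

theorem lower {v : V} (hv : v ∈ U) (hxv : G.Adj x v) : level G ρ x = level G ρ v + 1 := by
  have h1 := hx.max v hv
  have h2 := h.level_adj hxv
  rw [height, height, h.eq_of_adj hxv] at h1
  omega

/-- A neighbour `v` of `a` in the layer below `a` is adjacent to `b` by `lower_adj`. If `v` lies in
the layer of `x` and is not adjacent to `b`, then minimality of the degree of `x` gives `v` a
neighbour that `x` lacks. So `x` and `v`, which share `a`, would have incomparable neighbourhoods.
-/
theorem nbhd_subset {a b : V} (ha : a ∈ nbhd G U x) (hb : b ∈ nbhd G U x) :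
    nbhd G U a ⊆ nbhd G U b := by
  rintro v ⟨hv, hav⟩
  refine ⟨hv, ?_⟩
  have h1 := hx.lower h ha.1 ha.2
  have h2 := hx.lower h hb.1 hb.2
  rcases h.level_adj hav with h3 | h3
  · by_contra hbv
    have hρ : ρ v = ρ x := (h.eq_of_adj hav).symm.trans (h.eq_of_adj ha.2).symm
    have hdeg := hx.min v hv (by rw [height, height, hρ]; omega)
    obtain ⟨e, he, hxe⟩ : ∃ e, e ∈ nbhd G U v ∧ e ∉ nbhd G U x := by
      -- Inclusion together with the degree condition would make the two neighbourhoods equal, but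
      -- `b` lies only in that of `x`.
      by_contra! hsub
      have := Set.eq_of_subset_of_ncard_le hsub hdeg (nbhd_finite _ _)
      rw [← this] at hb
      exact hbv hb.2.symm
    have hxe' : ¬ G.Adj x e := fun hxe' => hxe ⟨he.1, hxe'⟩
    have hle : level G ρ x = level G ρ e + 1 := by
      have h4 := hx.max e he.1
      have h5 := h.level_adj he.2
      rw [height, height, ← h.eq_of_adj he.2, hρ] at h4
      omega
    exact h.comparable (by omega) ha.2 h1 hav.symm hb.2 h2 (fun h' => hbv h'.symm) he.2 hle hxe'
  · exact (h.lower_adj hav.symm h3 ha.2.symm h1 hb.2.symm (by omega)).symm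

variable [DecidableEq V] (hU : LowerClosed G ρ U)
include hU

/-- All neighbours of `x` lie below it, so `x` is not the lower neighbour of any vertex. -/
theorem lowerClosed_erase : LowerClosed G ρ (U.erase x) := by
  intro v hv h0
  obtain ⟨u, hu, huv, hl⟩ := hU v (Finset.mem_of_mem_erase hv) h0
  refine ⟨u, Finset.mem_erase.2 ⟨?_, hu⟩, huv, hl⟩
  rintro rfl
  have := hx.lower h (Finset.mem_of_mem_erase hv) huv
  omega

/-- An extremal vertex without neighbours. -/
theorem isolated (hdeg : degIn G U x = 0) (y : V) :
    ElimWord.Correct G U ⟨x, 2, y⟩ ∧ LowerClosed G ρ (U.erase x) :=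
  ⟨⟨hx.mem, .inr (.inr ⟨rfl, (Set.ncard_eq_zero (nbhd_finite _ _)).1 hdeg⟩)⟩,
    hx.lowerClosed_erase h hU⟩

/-- An extremal vertex with one neighbour. -/
theorem leaf (hdeg : degIn G U x = 1) {a : V} (ha : a ∈ nbhd G U x) :
    ElimWord.Correct G U ⟨x, 0, a⟩ ∧ LowerClosed G ρ (U.erase x) := by
  refine ⟨⟨hx.mem, .inl ⟨rfl, ?_⟩⟩, hx.lowerClosed_erase h hU⟩
  obtain ⟨b, hb⟩ := Set.ncard_eq_one.1 hdeg
  change nbhd G U x = {a}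
  rw [hb] at ha ⊢
  rw [ha]

/-- Any two neighbours of an extremal vertex are false twins. -/
theorem twins {a b : V} (ha : a ∈ nbhd G U x) (hb : b ∈ nbhd G U x) (hab : a ≠ b) :
    ElimWord.Correct G U ⟨a, 1, b⟩ ∧ LowerClosed G ρ (U.erase a) := by
  have e := (hx.nbhd_subset h ha hb).antisymm (hx.nbhd_subset h hb ha)
  refine ⟨⟨ha.1, .inr (.inl ⟨rfl, hb.1, hab, e⟩)⟩, ?_⟩
  intro v hv h0
  obtain ⟨u, hu, huv, hl⟩ := hU v (Finset.mem_of_mem_erase hv) h0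
  by_cases hua : u = a
  · subst hua
    have hv' : v ∈ nbhd G U b := e ▸ ⟨Finset.mem_of_mem_erase hv, huv⟩
    -- The twin `b` lies in the same layer as `a` and replaces it as a lower neighbour.
    refine ⟨b, Finset.mem_erase.2 ⟨hab.symm, hb.1⟩, hv'.2, ?_⟩
    have h1 := hx.lower h ha.1 ha.2
    have h2 := hx.lower h hb.1 hb.2
    omega
  · exact ⟨u, Finset.mem_erase.2 ⟨hua, hu⟩, huv, hl⟩

end IsExtremal

theorem exists_isExtremal (g : V → ℕ) {U : Finset V} (hU : U.Nonempty) :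
    ∃ x, IsExtremal G ρ g U x := by
  classical
  obtain ⟨y, hy, hmax⟩ := U.exists_max_image (height G ρ g) hU
  obtain ⟨x, hx, hmin⟩ := (U.filter fun v => height G ρ g v = height G ρ g y).exists_min_image
    (degIn G U) ⟨y, by simp [hy]⟩
  rw [Finset.mem_filter] at hx
  exact ⟨x, hx.1, fun v hv => hx.2 ▸ hmax v hv,
    fun v hv e => hmin v (Finset.mem_filter.2 ⟨hv, e.trans hx.2⟩)⟩

/-- Remove an extremal vertex of degree zero or one; if its degree is larger, remove one of two
neighbours, which are false twins. -/
theorem IsRooting.exists_eliminates [DecidableEq V] (h : IsRooting G ρ) (U : Finset V)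
    (hU : LowerClosed G ρ U) : ∃ l, Eliminates G U l := by
  induction hn : U.card generalizing U with
  | zero => exact ⟨[], Finset.card_eq_zero.1 hn⟩
  | succ n ih =>
    obtain ⟨x, hx⟩ := exists_isExtremal (G := G) (ρ := ρ) (fun _ => 0)
      (Finset.card_pos.1 (by omega : 0 < U.card))
    obtain ⟨w, hw, hc⟩ : ∃ w : ElimWord V, w.Correct G U ∧ LowerClosed G ρ (U.erase w.x) := by
      rcases lt_trichotomy (degIn G U x) 1 with hd | hd | hd
      · exact ⟨_, hx.isolated h hU (by omega) x⟩
      · obtain ⟨a, ha⟩ := Set.nonempty_of_ncard_ne_zero (s := nbhd G U x) (by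
          rw [← degIn, hd]; simp)
        exact ⟨_, hx.leaf h hU hd ha⟩
      · obtain ⟨a, ha, b, hb, hab⟩ := (Set.one_lt_ncard (nbhd_finite _ _)).1 hd
        exact ⟨_, hx.twins h hU ha hb hab⟩
    obtain ⟨l, hl⟩ := ih _ hc (by rw [Finset.card_erase_of_mem hw.1, hn]; rfl)
    exact ⟨w :: l, hw, hl⟩

theorem IsRooting.lowerClosed_univ [Fintype V] (h : IsRooting G ρ) :
    LowerClosed G ρ Finset.univ := fun v _ hv => by
  obtain ⟨u, hu⟩ := h.exists_lower hv
  exact ⟨u, Finset.mem_univ u, hu⟩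

/-- The algorithm always returns. -/
theorem alwaysReturns [Fintype V] [DecidableEq V] (hb : G.IsBipartite)
    (hd : IsDistanceHereditary G) : AlwaysReturns G Finset.univ := by
  have h : IsRooting G fun v => (G.connectedComponentMk v).out :=
    ⟨hb, hd, fun v => SimpleGraph.ConnectedComponent.exact (Quot.out_eq _), fun ha => by
      rw [SimpleGraph.ConnectedComponent.sound ha.reachable]⟩
  obtain ⟨l, hl⟩ := h.exists_eliminates _ h.lowerClosed_univ
  exact alwaysReturns_of_eliminates hl _

end

end GrundyTD

namespace GrundyTD

/-! ### A language with variables, arrays and bounded loops -/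

/-- The variables of the program. -/
inductive Var where
  | acc | j | vtx | e | p | q | found | x | a | b | has | last | len | cnt | cnt2 | k | ph | y | rep
  | wx | wz | wy | wr
  deriving DecidableEq

/-- The arrays of the program. -/
inductive Arr where
  | key | dead | deg | wx | wz | wy | xs | ys
  deriving DecidableEq

/-- The range of a loop: the vertices or the edges. -/
inductive Range where
  | verts | edges

/-- Input can be read only through `inp`, which gives `k = 0, 1` for the two ends of an edge and
zero beyond the last edge. The test keeps the address in the cells below `base`, the only ones where
`low` agrees with the machine memory. -/
inductive Exp where
  | var (v : Var)
  | lit (c : ℕ)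
  | size
  | arr (k : Arr) (i : Exp)
  | inp (k : Fin 2) (i : Exp)
  | inc (e : Exp) (c : ℕ)
  | sub (e f : Exp)

/-- All loops are bounded by `n` or `m`, so the cost of a program is a static expression. Writing by
`out` is restricted to the cells `0, …, n`, which lie below the arrays. -/
inductive Com where
  | skip
  | set (v : Var) (e : Exp)
  | put (k : Arr) (i e : Exp)
  | emit (e : Exp)
  | out (i e : Exp)
  | seq (P Q : Com)
  | ite (e f : Exp) (P Q : Com)
  | loop (R : Range) (v : Var) (P : Com)

/-- Stores of the language; `low` is the part of the memory that holds the input and the result. -/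
structure Store where
  r : Var → ℕ
  a : Arr → ℕ → ℕ
  low : ℕ → ℕ
  out : List ℕ

section Semantics

variable (n m : ℕ)

def Range.bound : Range → ℕ
  | .verts => n
  | .edges => m

def Store.setVar (s : Store) (v : Var) (c : ℕ) : Store :=
  { s with r := Function.update s.r v c }

def Store.setArr (s : Store) (k : Arr) (i c : ℕ) : Store :=
  { s with a := Function.update s.a k (Function.update (s.a k) i c) }

def Exp.eval (s : Store) : Exp → ℕ
  | .var v => s.r v
  | .lit c => c
  | .size => n
  | .arr k i => s.a k (i.eval s)
  | .inp k i => if i.eval s < m then s.low (2 * i.eval s + (2 + k)) else 0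
  | .inc e c => e.eval s + c
  | .sub e f => e.eval s - f.eval s

/-- Execute `f 0, …, f (k - 1)`. -/
def iterate (f : ℕ → Store → Store) : ℕ → Store → Store
  | 0, s => s
  | k + 1, s => f k (iterate f k s)

def Com.run : Com → Store → Store
  | .skip, s => s
  | .set v e, s => s.setVar v (e.eval n m s)
  | .put k i e, s => s.setArr k (i.eval n m s) (e.eval n m s)
  | .emit e, s => { s with out := s.out ++ [e.eval n m s] }
  | .out i e, s =>
    if i.eval n m s < n + 1 then
      { s with low := Function.update s.low (i.eval n m s) (e.eval n m s) }
    else s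
  | .seq P Q, s => Q.run (P.run s)
  | .ite e f P Q, s => if e.eval n m s < f.eval n m s then P.run s else Q.run s
  | .loop R v P, s => iterate (fun i s => P.run (s.setVar v i)) (R.bound n m) s

end Semantics

section

variable {n m : ℕ} (σ : Store)

theorem Store.setVar_r (v : Var) (c : ℕ) (w : Var) :
    (σ.setVar v c).r w = if w = v then c else σ.r w := by
  simp [setVar, Function.update_apply]

theorem Store.setVar_a (v : Var) (c : ℕ) : (σ.setVar v c).a = σ.a := (rfl)

theorem Store.setVar_low (v : Var) (c : ℕ) : (σ.setVar v c).low = σ.low := (rfl)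

theorem Store.setVar_out (v : Var) (c : ℕ) : (σ.setVar v c).out = σ.out := (rfl)

theorem Store.setArr_r (k : Arr) (i c : ℕ) : (σ.setArr k i c).r = σ.r := (rfl)

theorem Store.setArr_a (k : Arr) (i c : ℕ) (l : Arr) (j : ℕ) :
    (σ.setArr k i c).a l j = if l = k ∧ j = i then c else σ.a l j := by
  simp only [setArr, Function.update_apply]
  by_cases h : l = k
  · subst h
    simp [Function.update_apply]
  · simp [h]

theorem Exp.eval_var (v : Var) : (Exp.var v).eval n m σ = σ.r v := (rfl)

theorem Exp.eval_lit (c : ℕ) : (Exp.lit c).eval n m σ = c := (rfl)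

theorem Exp.eval_size : Exp.size.eval n m σ = n := (rfl)

theorem Exp.eval_arr (k : Arr) (i : Exp) :
    (Exp.arr k i).eval n m σ = σ.a k (i.eval n m σ) := (rfl)

theorem Exp.eval_inp (k : Fin 2) {i : Exp} (h : i.eval n m σ < m) :
    (Exp.inp k i).eval n m σ = σ.low (2 * i.eval n m σ + (2 + k)) := if_pos h

theorem Exp.eval_inc (e : Exp) (c : ℕ) : (Exp.inc e c).eval n m σ = e.eval n m σ + c := (rfl)

theorem Exp.eval_sub (e f : Exp) :
    (Exp.sub e f).eval n m σ = e.eval n m σ - f.eval n m σ := (rfl)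

namespace Com

theorem run_skip : skip.run n m σ = σ := (rfl)

theorem run_set (v : Var) (e : Exp) : (set v e).run n m σ = σ.setVar v (e.eval n m σ) := (rfl)

theorem run_put (k : Arr) (i e : Exp) :
    (put k i e).run n m σ = σ.setArr k (i.eval n m σ) (e.eval n m σ) := (rfl)

theorem run_emit (e : Exp) :
    (emit e).run n m σ = { σ with out := σ.out ++ [e.eval n m σ] } := (rfl)

theorem run_out {i e : Exp} (h : i.eval n m σ < n + 1) :
    (out i e).run n m σ =
      { σ with low := Function.update σ.low (i.eval n m σ) (e.eval n m σ) } := if_pos h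

theorem run_seq (P Q : Com) : (seq P Q).run n m σ = Q.run n m (P.run n m σ) := (rfl)

theorem run_ite_of_lt {e f : Exp} (P Q : Com) (h : e.eval n m σ < f.eval n m σ) :
    (ite e f P Q).run n m σ = P.run n m σ := if_pos h

theorem run_ite_of_not_lt {e f : Exp} (P Q : Com) (h : ¬ e.eval n m σ < f.eval n m σ) :
    (ite e f P Q).run n m σ = Q.run n m σ := if_neg h

/-- Run `P` if the values are equal, and `Q` otherwise. -/
def ifEq (e f : Exp) (P Q : Com) : Com := .ite e f Q (.ite f e Q P)

theorem run_ifEq_of_eq {e f : Exp} (P Q : Com) (h : e.eval n m σ = f.eval n m σ) :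
    (ifEq e f P Q).run n m σ = P.run n m σ := by
  rw [ifEq, run_ite_of_not_lt _ _ _ (by omega), run_ite_of_not_lt _ _ _ (by omega)]

theorem run_ifEq_of_ne {e f : Exp} (P Q : Com) (h : e.eval n m σ ≠ f.eval n m σ) :
    (ifEq e f P Q).run n m σ = Q.run n m σ := by
  rcases lt_or_gt_of_ne h with h | h
  · rw [ifEq, run_ite_of_lt _ _ _ h]
  · rw [ifEq, run_ite_of_not_lt _ _ _ (by omega), run_ite_of_lt _ _ _ h]

attribute [simp] Store.setVar_r Store.setVar_a Store.setVar_low Store.setVar_out Store.setArr_r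
  Store.setArr_a Exp.eval_var Exp.eval_lit
  Exp.eval_size Exp.eval_arr Exp.eval_inp Exp.eval_inc Exp.eval_sub run_skip run_set run_put
  run_emit run_out run_seq run_ite_of_lt run_ite_of_not_lt run_ifEq_of_eq run_ifEq_of_ne

end Com

end

section Cost

variable (n m : ℕ)

/-- Constants are charged by their value although loading one takes a single step: in this way the
cost also bounds how far a value can exceed the numbers in the store. -/
def Exp.cost : Exp → ℕ
  | .var _ => 1
  | .lit c => c + 1
  | .size => 1
  | .arr _ i => i.cost + 8
  | .inp _ i => i.cost + 8
  | .inc e c => e.cost + c + 2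
  | .sub e f => e.cost + f.cost + 1

def Com.cost : Com → ℕ
  | .skip => 1
  | .set _ e => e.cost + 1
  | .put _ i e => i.cost + e.cost + 8
  | .emit e => e.cost + 1
  | .out i e => i.cost + e.cost + 5
  | .seq P Q => P.cost + Q.cost
  | .ite e f P Q => e.cost + f.cost + P.cost + Q.cost + 1
  | .loop R _ P => R.bound n m * (P.cost + 4) + 2

end Cost

/-! ### Compilation to the random access machine -/

/-- Registers are split by residues modulo three: `3 * v.code` holds the variable `v`, the registers
`3 * j + 1` are temporary, and `2`, `5`, `8`, `11` hold `n`, `m`, the base address and zero.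
Subtracting register `11` serves as a copy. The eight arrays are interleaved, so no bound on their
lengths is needed. -/
def Var.code : Var → ℕ := Var.ctorIdx

def Arr.code : Arr → ℕ := Arr.ctorIdx

theorem Var.code_inj {v w : Var} (h : v.code = w.code) : v = w := by
  cases v <;> cases w <;> first | rfl | cases h

theorem Arr.code_inj {k l : Arr} (h : k.code = l.code) : k = l := by
  cases k <;> cases l <;> first | rfl | cases h

theorem Arr.code_lt (k : Arr) : k.code < 8 := by
  cases k <;> decide

def Range.code : Range → ℕ
  | .verts => 2
  | .edges => 5

/-- Multiply register `d` by eight, add the number of the array and the base address; register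
`t` is overwritten. -/
def address (k : Arr) (d t : ℕ) : Cmd :=
  .seq (.const t 8) (.seq (.mul d d t) (.seq (.const t k.code) (.seq (.add d d t) (.add d d 8))))

/-- Evaluate an expression into the register `3 * d + 1`. -/
def Exp.compile : Exp → ℕ → Cmd
  | .var v, d => .sub (3 * d + 1) (3 * v.code) 11
  | .lit c, d => .const (3 * d + 1) c
  | .size, d => .sub (3 * d + 1) 2 11
  | .arr k i, d =>
    .seq (i.compile d) (.seq (address k (3 * d + 1) (3 * (d + 1) + 1))
      (.load (3 * d + 1) (3 * d + 1)))
  | .inp k i, d =>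
    .seq (i.compile d) (.ifLt (3 * d + 1) 5
      (.seq (.const (3 * (d + 1) + 1) 2) (.seq (.mul (3 * d + 1) (3 * (d + 1) + 1) (3 * d + 1))
        (.seq (.const (3 * (d + 1) + 1) (2 + k)) (.seq
          (.add (3 * d + 1) (3 * d + 1) (3 * (d + 1) + 1)) (.load (3 * d + 1) (3 * d + 1))))))
      (.const (3 * d + 1) 0))
  | .inc e c, d =>
    .seq (e.compile d) (.seq (.const (3 * (d + 1) + 1) c)
      (.add (3 * d + 1) (3 * d + 1) (3 * (d + 1) + 1)))
  | .sub e f, d =>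
    .seq (e.compile d) (.seq (f.compile (d + 1))
      (.sub (3 * d + 1) (3 * d + 1) (3 * (d + 1) + 1)))

def Com.compile : Com → ℕ → Cmd
  | .skip, _ => .skip
  | .set v e, d => .seq (e.compile d) (.sub (3 * v.code) (3 * d + 1) 11)
  | .put k i e, d =>
    .seq (i.compile d) (.seq (e.compile (d + 1))
      (.seq (address k (3 * d + 1) (3 * (d + 2) + 1)) (.store (3 * d + 1) (3 * (d + 1) + 1))))
  | .emit e, d => .seq (e.compile d) (.emit (3 * d + 1))
  | .out i e, d =>
    .seq (i.compile d) (.seq (e.compile (d + 1)) (.seq (.const (3 * (d + 2) + 1) 1)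
      (.seq (.add (3 * (d + 2) + 1) 2 (3 * (d + 2) + 1))
        (.ifLt (3 * d + 1) (3 * (d + 2) + 1) (.store (3 * d + 1) (3 * (d + 1) + 1)) .skip))))
  | .seq P Q, d => .seq (P.compile d) (Q.compile d)
  | .ite e f P Q, d =>
    .seq (e.compile d) (.seq (f.compile (d + 1))
      (.ifLt (3 * d + 1) (3 * (d + 1) + 1) (P.compile d) (Q.compile d)))
  | .loop R v P, d =>
    .seq (.const (3 * d + 1) 0) (.whileLt (3 * d + 1) R.code
      (.seq (.sub (3 * v.code) (3 * d + 1) 11) (.seq (P.compile (d + 1))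
        (.seq (.const (3 * (d + 1) + 1) 1) (.add (3 * d + 1) (3 * d + 1) (3 * (d + 1) + 1))))))

/-- The address of the first array cell. -/
def base (n m : ℕ) : ℕ := 2 * m + n + 4

/-- The state of the machine represents the store. -/
structure Represents (n m : ℕ) (s : State) (σ : Store) : Prop where
  var : ∀ v : Var, s.reg (3 * v.code) = σ.r v
  verts : s.reg 2 = n
  edges : s.reg 5 = m
  base : s.reg 8 = base n m
  zero : s.reg 11 = 0
  arr : ∀ (k : Arr) (i : ℕ), s.mem (GrundyTD.base n m + 8 * i + k.code) = σ.a k i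
  low : ∀ i < GrundyTD.base n m, s.mem i = σ.low i
  out : s.out = σ.out

/-- All numbers of the store are at most `B`. -/
structure Store.Bounded (σ : Store) (B : ℕ) : Prop where
  var : ∀ v, σ.r v ≤ B
  arr : ∀ k i, σ.a k i ≤ B
  low : ∀ i, σ.low i ≤ B

theorem Store.Bounded.mono {σ : Store} {A B : ℕ} (h : σ.Bounded A) (hAB : A ≤ B) : σ.Bounded B :=
  ⟨fun v => (h.var v).trans hAB, fun k i => (h.arr k i).trans hAB, fun i => (h.low i).trans hAB⟩

/-- The two states differ at most in the registers `3 * j + 1` with `d ≤ j`. -/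
structure SameUpTo (d : ℕ) (s s' : State) : Prop where
  mem : s'.mem = s.mem
  out : s'.out = s.out
  reg : ∀ i, (∀ j, d ≤ j → i ≠ 3 * j + 1) → s'.reg i = s.reg i

theorem SameUpTo.refl (d : ℕ) (s : State) : SameUpTo d s s := ⟨rfl, rfl, fun _ _ => rfl⟩

theorem SameUpTo.trans {d d' : ℕ} {s s' s'' : State} (h : SameUpTo d s s') (hd : d ≤ d')
    (h' : SameUpTo d' s' s'') : SameUpTo d s s'' :=
  ⟨h'.mem.trans h.mem, h'.out.trans h.out,
    fun i hi => (h'.reg i fun j hj => hi j (hd.trans hj)).trans (h.reg i hi)⟩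

theorem SameUpTo.setReg {d d' : ℕ} {s s' : State} (h : SameUpTo d s s') (hd : d ≤ d') (c : ℕ) :
    SameUpTo d s (s'.setReg (3 * d' + 1) c) :=
  h.trans hd ⟨rfl, rfl, fun i hi => by simp [State.setReg, hi d' le_rfl]⟩

theorem SameUpTo.represents {n m d : ℕ} {s s' : State} {σ : Store} (h : SameUpTo d s s')
    (hs : Represents n m s σ) : Represents n m s' σ where
  var v := by rw [h.reg _ (by omega), hs.var]
  verts := by rw [h.reg _ (by omega), hs.verts]
  edges := by rw [h.reg _ (by omega), hs.edges]
  base := by rw [h.reg _ (by omega), hs.base]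
  zero := by rw [h.reg _ (by omega), hs.zero]
  arr k i := by rw [h.mem, hs.arr]
  low i hi := by rw [h.mem, hs.low i hi]
  out := by rw [h.out, hs.out]

theorem State.reg_setReg (s : State) (d c i : ℕ) :
    (s.setReg d c).reg i = if i = d then c else s.reg i := by
  simp [State.setReg, Function.update_apply]

theorem State.reg_setReg_self (s : State) (d c : ℕ) : (s.setReg d c).reg d = c := by
  simp [State.setReg]

theorem State.reg_setReg_ne (s : State) {d c i : ℕ} (h : i ≠ d) :
    (s.setReg d c).reg i = s.reg i := by
  simp [State.setReg, h]

theorem Exp.eval_le {n m B : ℕ} {σ : Store} (hσ : σ.Bounded B) (hn : n ≤ B) (e : Exp) :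
    e.eval n m σ ≤ B + e.cost := by
  induction e with
  | var v => exact (hσ.var v).trans (by simp)
  | lit c => simp [eval, cost]; omega
  | size => simp [eval, cost]; omega
  | arr k i ih => exact (hσ.arr k _).trans (by simp)
  | inp k i ih =>
    simp only [eval]
    split_ifs
    · exact (hσ.low _).trans (by simp)
    · simp
  | inc e c ih => simp only [eval, cost]; omega
  | sub e f ih ih' => simp only [eval, cost]; omega

/-- The bound on `W` covers the final address and all intermediate values, as `k.code` is at most
seven. -/
theorem exec_address {n m W : ℕ} {s : State} (k : Arr) {d t : ℕ} (hb : s.reg 8 = base n m)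
    (hd : d ≠ t) (hd8 : d ≠ 8) (ht8 : t ≠ 8) (hW : 8 * s.reg d + base n m + 16 ≤ W) :
    Exec W (address k d t) s 5 ((((((s.setReg t 8).setReg d (s.reg d * 8))).setReg t k.code).setReg d
      (s.reg d * 8 + k.code)).setReg d (base n m + 8 * s.reg d + k.code)) := by
  have hk := k.code_lt
  have h1 : Exec W (.const t 8) s 1 (s.setReg t 8) := .const _ _ _ (by omega)
  have h2 := Exec.mul (W := W) (s.setReg t 8) d d t (by
    rw [State.reg_setReg_self, State.reg_setReg_ne _ hd]
    omega)
  rw [State.reg_setReg_self, State.reg_setReg_ne _ hd] at h2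
  set s2 := (s.setReg t 8).setReg d (s.reg d * 8) with hs2
  have h3 : Exec W (.const t k.code) s2 1 (s2.setReg t k.code) := .const _ _ _ (by omega)
  have e3 : (s2.setReg t k.code).reg d = s.reg d * 8 := by
    rw [State.reg_setReg_ne _ hd, hs2, State.reg_setReg_self]
  have h4 := Exec.add (W := W) (s2.setReg t k.code) d d t (by
    rw [State.reg_setReg_self, e3]
    omega)
  rw [State.reg_setReg_self, e3] at h4
  set s4 := (s2.setReg t k.code).setReg d (s.reg d * 8 + k.code) with hs4
  have e4 : s4.reg d = s.reg d * 8 + k.code := by rw [hs4, State.reg_setReg_self]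
  have e4' : s4.reg 8 = base n m := by
    rw [hs4, State.reg_setReg_ne _ hd8.symm, State.reg_setReg_ne _ ht8.symm, hs2,
      State.reg_setReg_ne _ hd8.symm, State.reg_setReg_ne _ ht8.symm, hb]
  have h5 := Exec.add (W := W) s4 d d 8 (by rw [e4, e4']; omega)
  rw [e4, e4', show s.reg d * 8 + k.code + base n m = base n m + 8 * s.reg d + k.code by ring] at h5
  exact .seq h1 (.seq h2 (.seq h3 (.seq h4 h5)))

/-- The temporary registers form a stack: evaluation at depth `d` leaves those of smaller index
untouched, so operands and loop counters of enclosing constructs survive. -/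
theorem Exp.exec_compile {n m W B : ℕ} {s : State} {σ : Store} (hs : Represents n m s σ)
    (hσ : σ.Bounded B) (hn : n ≤ B) (e : Exp)
    (hW : 8 * (B + e.cost) + base n m + 16 ≤ W) (d : ℕ) :
    ∃ t s', Exec W (e.compile d) s t s' ∧ t ≤ e.cost ∧ s'.reg (3 * d + 1) = e.eval n m σ ∧
      SameUpTo d s s' := by
  induction e generalizing d s with
  | var v =>
    refine ⟨_, _, .sub _ _ _ _, le_rfl, ?_, (SameUpTo.refl d s).setReg le_rfl _⟩
    rw [State.reg_setReg_self, hs.var, hs.zero]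
    rfl
  | lit c =>
    refine ⟨_, _, .const _ _ _ ?_, ?_, ?_, (SameUpTo.refl d s).setReg le_rfl _⟩
    · simp only [cost] at hW
      omega
    · simp [cost]
    · rw [State.reg_setReg_self]
      rfl
  | size =>
    refine ⟨_, _, .sub _ _ _ _, le_rfl, ?_, (SameUpTo.refl d s).setReg le_rfl _⟩
    rw [State.reg_setReg_self, hs.verts, hs.zero]
    rfl
  | arr k i ih =>
    simp only [cost] at hW
    obtain ⟨t, s1, h1, ht, hv, hd⟩ := ih hs (by omega) d
    have hs1 := hd.represents hs
    have hle := i.eval_le (m := m) hσ hn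
    have h2 := exec_address (n := n) (m := m) (W := W) (s := s1) k (d := 3 * d + 1)
      (t := 3 * (d + 1) + 1) hs1.base (by omega) (by omega) (by omega) (by rw [hv]; omega)
    refine ⟨_, _, .seq h1 (.seq h2 (.load _ _ _)), ?_, ?_, ?_⟩
    · simp only [cost]
      omega
    · rw [State.reg_setReg_self, State.reg_setReg_self, hv]
      exact hs1.arr k _
    · refine SameUpTo.setReg ?_ le_rfl _
      exact ((((hd.setReg (by omega) _).setReg le_rfl _).setReg (by omega) _).setReg le_rfl
        _).setReg le_rfl _
  | inp k i ih =>
    simp only [cost] at hW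
    obtain ⟨t, s1, h1, ht, hv, hd⟩ := ih hs (by omega) d
    have hs1 := hd.represents hs
    have hle := i.eval_le (m := m) hσ hn
    have hk := k.isLt
    by_cases hlt : i.eval n m σ < m
    · have hc : Exec W (.const (3 * (d + 1) + 1) 2) s1 1 (s1.setReg (3 * (d + 1) + 1) 2) :=
        .const _ _ _ (by omega)
      set s2 := s1.setReg (3 * (d + 1) + 1) 2 with hs2
      have e2 : s2.reg (3 * (d + 1) + 1) = 2 := State.reg_setReg_self _ _ _
      have e2' : s2.reg (3 * d + 1) = i.eval n m σ := by
        rw [hs2, State.reg_setReg_ne _ (by omega), hv]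
      have hmul := Exec.mul (W := W) s2 (3 * d + 1) (3 * (d + 1) + 1) (3 * d + 1) (by
        rw [e2, e2']
        omega)
      rw [e2, e2'] at hmul
      set s3 := s2.setReg (3 * d + 1) (2 * i.eval n m σ) with hs3
      have hc' : Exec W (.const (3 * (d + 1) + 1) (2 + k)) s3 1
          (s3.setReg (3 * (d + 1) + 1) (2 + k)) := .const _ _ _ (by omega)
      set s4 := s3.setReg (3 * (d + 1) + 1) (2 + k) with hs4
      have e4 : s4.reg (3 * (d + 1) + 1) = 2 + k := State.reg_setReg_self _ _ _
      have e4' : s4.reg (3 * d + 1) = 2 * i.eval n m σ := by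
        rw [hs4, State.reg_setReg_ne _ (by omega), hs3, State.reg_setReg_self]
      have hadd := Exec.add (W := W) s4 (3 * d + 1) (3 * d + 1) (3 * (d + 1) + 1) (by
        rw [e4, e4']
        omega)
      rw [e4, e4'] at hadd
      have hd4 : SameUpTo d s s4 :=
        ((hd.setReg (by omega) _).setReg le_rfl _).setReg (by omega) _
      refine ⟨_, _, .seq h1 (.ifTrue ?_ (.seq hc (.seq hmul (.seq hc' (.seq hadd
        (.load _ _ _)))))), ?_, ?_, (hd4.setReg le_rfl _).setReg le_rfl _⟩
      · rw [hv, hs1.edges]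
        exact hlt
      · simp only [cost]
        omega
      · rw [State.reg_setReg_self, State.reg_setReg_self]
        simp only [eval, if_pos hlt]
        have := (hd4.represents hs).low (2 * i.eval n m σ + (2 + k)) (by
          simp only [GrundyTD.base]
          omega)
        exact this
    · refine ⟨_, _, .seq h1 (.ifFalse ?_ (.const _ _ _ (by omega))), ?_, ?_,
        hd.setReg le_rfl _⟩
      · rw [hv, hs1.edges]
        exact hlt
      · simp only [cost]
        omega
      · rw [State.reg_setReg_self]
        simp only [eval, if_neg hlt]
  | inc e c ih =>
    simp only [cost] at hW
    obtain ⟨t, s1, h1, ht, hv, hd⟩ := ih hs (by omega) d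
    have hle := e.eval_le (m := m) hσ hn
    refine ⟨_, _, .seq h1 (.seq (.const _ _ _ (by omega)) (.add _ _ _ _ ?_)), ?_, ?_,
      (hd.setReg (by omega) _).setReg le_rfl _⟩
    · rw [State.reg_setReg_self, State.reg_setReg_ne _ (by omega), hv]
      omega
    · simp only [cost]
      omega
    · rw [State.reg_setReg_self, State.reg_setReg_self, State.reg_setReg_ne _ (by omega), hv]
      rfl
  | sub e f ih ih' =>
    simp only [cost] at hW
    obtain ⟨t, s1, h1, ht, hv, hd⟩ := ih hs (by omega) d
    obtain ⟨t', s2, h2, ht', hv', hd'⟩ := ih' (hd.represents hs) (by omega) (d + 1)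
    refine ⟨_, _, .seq h1 (.seq h2 (.sub _ _ _ _)), ?_, ?_,
      (hd.trans (by omega) hd').setReg le_rfl _⟩
    · simp only [cost]
      omega
    · rw [State.reg_setReg_self, hv', hd'.reg _ (by omega), hv]
      rfl

/-- The conclusion of the compilation theorem. -/
def Simulates (n m W : ℕ) (P : Cmd) (s : State) (d T : ℕ) (σ' : Store) : Prop :=
  ∃ t s', Exec W P s t s' ∧ t ≤ T ∧ Represents n m s' σ' ∧
    ∀ j < d, s'.reg (3 * j + 1) = s.reg (3 * j + 1)

theorem Store.Bounded.setVar {σ : Store} {B : ℕ} (h : σ.Bounded B) (v : Var) {c : ℕ}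
    (hc : c ≤ B) : (σ.setVar v c).Bounded B := by
  refine ⟨fun w => ?_, h.arr, h.low⟩
  simp only [Store.setVar, Function.update_apply]
  split_ifs
  · exact hc
  · exact h.var w

theorem Store.Bounded.iterate {B C k : ℕ} {σ : Store} {f : ℕ → Store → Store} (h : σ.Bounded B)
    (hf : ∀ i < k, ∀ A σ, B ≤ A → σ.Bounded A → (f i σ).Bounded (A + C)) :
    (iterate f k σ).Bounded (B + k * C) := by
  induction k with
  | zero => simpa [GrundyTD.iterate] using h
  | succ k ih =>
    have := hf k (by omega) _ _ (by omega) (ih fun i hi => hf i (by omega))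
    exact this.mono (by rw [Nat.succ_mul]; omega)

/-- Each assignment writes the value of an expression, which exceeds `B` by at most its cost; over
the iterations of a loop these excesses add up just like the costs. -/
theorem Com.run_bounded {n m B : ℕ} {σ : Store} (hσ : σ.Bounded B) (hn : n ≤ B) (hm : m ≤ B)
    (P : Com) : (P.run n m σ).Bounded (B + P.cost n m) := by
  induction P generalizing σ B with
  | skip => exact hσ.mono (by omega)
  | set v e =>
    have := e.eval_le (m := m) hσ hn
    exact (hσ.mono (by omega)).setVar v (by simp only [cost]; omega)
  | put k i e =>
    have := e.eval_le (m := m) hσ hn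
    refine ⟨(hσ.mono (by omega)).var, fun l j => ?_, (hσ.mono (by omega)).low⟩
    simp only [run, Store.setArr, Function.update_apply]
    have h2 := hσ.arr
    simp only [cost]
    split_ifs with h3
    · subst h3
      simp only [Function.update_apply]
      split_ifs
      · omega
      · exact (h2 _ _).trans (by omega)
    · exact (h2 _ _).trans (by omega)
  | emit e =>
    have := hσ.mono (show B ≤ B + (Com.emit e).cost n m by omega)
    exact ⟨this.var, this.arr, this.low⟩
  | out i e =>
    have := e.eval_le (m := m) hσ hn
    simp only [run]
    split_ifs
    · refine ⟨(hσ.mono (by omega)).var, (hσ.mono (by omega)).arr, fun j => ?_⟩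
      simp only [Function.update_apply, cost]
      split_ifs
      · omega
      · exact (hσ.low _).trans (by omega)
    · exact hσ.mono (by omega)
  | seq P Q ih ih' =>
    exact (ih' (ih hσ hn hm) (by omega) (by omega)).mono (by simp only [cost]; omega)
  | ite e f P Q ih ih' =>
    simp only [run]
    split_ifs
    · exact (ih hσ hn hm).mono (by simp only [cost]; omega)
    · exact (ih' hσ hn hm).mono (by simp only [cost]; omega)
  | loop R v P ih =>
    have hR : R.bound n m ≤ B := by cases R <;> assumption
    refine (hσ.iterate (C := P.cost n m) fun i hi A τ hA hτ =>
      ih (hτ.setVar v (by omega)) (by omega) (by omega)).mono ?_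
    simp only [cost]
    have : R.bound n m * P.cost n m ≤ R.bound n m * (P.cost n m + 4) :=
      Nat.mul_le_mul le_rfl (by omega)
    omega

theorem Represents.setVar {n m : ℕ} {s : State} {σ : Store} (h : Represents n m s σ) (v : Var)
    (c : ℕ) : Represents n m (s.setReg (3 * v.code) c) (σ.setVar v c) where
  var w := by
    rw [State.reg_setReg]
    simp only [Store.setVar, Function.update_apply]
    by_cases hw : w = v
    · simp [hw]
    · rw [if_neg, if_neg hw, h.var]
      intro e
      exact hw (Var.code_inj (by omega))
  verts := by rw [State.reg_setReg_ne _ (by omega), h.verts]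
  edges := by rw [State.reg_setReg_ne _ (by omega), h.edges]
  base := by rw [State.reg_setReg_ne _ (by omega), h.base]
  zero := by rw [State.reg_setReg_ne _ (by omega), h.zero]
  arr := h.arr
  low := h.low
  out := h.out

theorem Represents.setArr {n m : ℕ} {s : State} {σ : Store} (h : Represents n m s σ) (k : Arr)
    (i c : ℕ) :
    Represents n m { s with mem := Function.update s.mem (GrundyTD.base n m + 8 * i + k.code) c }
      (σ.setArr k i c) where
  var := h.var
  verts := h.verts
  edges := h.edges
  base := h.base
  zero := h.zero
  arr l j := by
    have hk := k.code_lt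
    have hl := l.code_lt
    simp only [Store.setArr, Function.update_apply]
    by_cases hkl : l = k
    · subst hkl
      simp only [if_true, Function.update_apply]
      by_cases hij : j = i
      · simp [hij]
      · rw [if_neg (by omega), if_neg hij, h.arr]
    · rw [if_neg, if_neg hkl, h.arr]
      intro e
      exact hkl (Arr.code_inj (by omega))
  low j hj := by
    simp only [Function.update_apply]
    rw [if_neg (by omega), h.low j hj]
    rfl
  out := h.out

theorem Range.reg_code {n m : ℕ} {s : State} {σ : Store} (hs : Represents n m s σ) (R : Range) :
    s.reg R.code = R.bound n m := by
  cases R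
  · exact hs.verts
  · exact hs.edges

/-- Induction on the number `k` of remaining iterations. Each contributes one step for the test, and
the last, failing test contributes one more. -/
theorem exec_while {n m W d K T : ℕ} {P : Cmd} {f : ℕ → Store → Store} {R : Range} {σ : Store}
    (hK : K = R.bound n m)
    (hP : ∀ i < K, ∀ s, Represents n m s (iterate f i σ) → s.reg (3 * d + 1) = i →
      ∃ t s', Exec W P s t s' ∧ t ≤ T ∧ Represents n m s' (iterate f (i + 1) σ) ∧
        s'.reg (3 * d + 1) = i + 1 ∧ ∀ j < d, s'.reg (3 * j + 1) = s.reg (3 * j + 1))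
    (k : ℕ) : ∀ i, i + k = K → ∀ s, Represents n m s (iterate f i σ) → s.reg (3 * d + 1) = i →
      Simulates n m W (.whileLt (3 * d + 1) R.code P) s d (k * (T + 1) + 1) (iterate f K σ) := by
  induction k with
  | zero =>
    intro i hi s hs hr
    have hi : i = K := by omega
    subst hi
    refine ⟨_, _, .whileFalse ?_, by omega, hs, fun _ _ => rfl⟩
    rw [hr, R.reg_code hs]
    omega
  | succ k ih =>
    intro i hi s hs hr
    obtain ⟨t, s1, h1, ht, hs1, hr1, hj⟩ := hP i (by omega) s hs hr
    obtain ⟨t', s2, h2, ht', hs2, hj'⟩ := ih (i + 1) (by omega) s1 hs1 hr1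
    refine ⟨_, _, .whileTrue ?_ h1 h2, ?_, hs2, fun j h => (hj' j h).trans (hj j h)⟩
    · rw [hr, R.reg_code hs]
      omega
    · rw [Nat.succ_mul]
      omega

/-- Compiled programs simulate the programs of the language, in time and with numbers bounded by
the cost. -/
theorem Com.simulates {n m W B : ℕ} {s : State} {σ : Store} (hs : Represents n m s σ)
    (hσ : σ.Bounded B) (hn : n ≤ B) (hm : m ≤ B) (P : Com)
    (hW : 8 * (B + P.cost n m) + base n m + 16 ≤ W) (d : ℕ) :
    Simulates n m W (P.compile d) s d (P.cost n m) (P.run n m σ) := by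
  induction P generalizing s σ B d with
  | skip => exact ⟨_, _, .skip _, le_rfl, hs, fun _ _ => rfl⟩
  | set v e =>
    simp only [cost] at hW
    obtain ⟨t, s1, h1, ht, hv, hd⟩ := e.exec_compile (W := W) hs hσ hn (by omega) d
    have hs1 := hd.represents hs
    refine ⟨_, _, .seq h1 (.sub _ _ _ _), ?_, ?_, fun j hj => ?_⟩
    · simp only [cost]
      omega
    · rw [hv, hs1.zero]
      exact hs1.setVar v _
    · rw [State.reg_setReg_ne _ (by omega), hd.reg _ (by omega)]
  | put k i e =>
    simp only [cost] at hW
    obtain ⟨t, s1, h1, ht, hv, hd⟩ := i.exec_compile (W := W) hs hσ hn (by omega) d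
    obtain ⟨t', s2, h2, ht', hv', hd'⟩ :=
      e.exec_compile (W := W) (hd.represents hs) hσ hn (by omega) (d + 1)
    have hle := i.eval_le (m := m) hσ hn
    have hd2 := hd.trans (by omega) hd'
    have hs2 := hd2.represents hs
    have hr : s2.reg (3 * d + 1) = i.eval n m σ := by rw [hd'.reg _ (by omega), hv]
    have h3 := exec_address (n := n) (m := m) (W := W) (s := s2) k (d := 3 * d + 1)
      (t := 3 * (d + 2) + 1) hs2.base (by omega) (by omega) (by omega) (by rw [hr]; omega)
    have hd3 := ((((hd2.setReg (d' := d + 2) (by omega) 8).setReg le_rfl (s2.reg (3 * d + 1) * 8)).setReg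
      (d' := d + 2) (by omega) k.code).setReg le_rfl (s2.reg (3 * d + 1) * 8 + k.code)).setReg
      le_rfl (base n m + 8 * s2.reg (3 * d + 1) + k.code)
    refine ⟨_, _, .seq h1 (.seq h2 (.seq h3 (.store _ _ _))), ?_, ?_,
      fun j hj => ?_⟩
    · simp only [cost]
      omega
    · have := (hd3.represents hs).setArr k (i.eval n m σ) (e.eval n m σ)
      change Represents n m _ (σ.setArr k (i.eval n m σ) (e.eval n m σ))
      convert this using 3
      · rw [State.reg_setReg_self, hr]
      · rw [State.reg_setReg_ne _ (by omega), State.reg_setReg_ne _ (by omega),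
          State.reg_setReg_ne _ (by omega), State.reg_setReg_ne _ (by omega),
          State.reg_setReg_ne _ (by omega), hv']
    · exact hd3.reg _ (by omega)
  | emit e =>
    simp only [cost] at hW
    obtain ⟨t, s1, h1, ht, hv, hd⟩ := e.exec_compile (W := W) hs hσ hn (by omega) d
    have hs1 := hd.represents hs
    refine ⟨_, _, .seq h1 (.emit _ _), ?_, ?_, fun j hj => ?_⟩
    · simp only [cost]
      omega
    · exact ⟨hs1.var, hs1.verts, hs1.edges, hs1.base, hs1.zero, hs1.arr, hs1.low, by
        simp only [hs1.out, hv]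
        rfl⟩
    · exact hd.reg _ (by omega)
  | out i e =>
    simp only [cost] at hW
    obtain ⟨t, s1, h1, ht, hv, hd⟩ := i.exec_compile (W := W) hs hσ hn (by omega) d
    obtain ⟨t', s2, h2, ht', hv', hd'⟩ :=
      e.exec_compile (W := W) (hd.represents hs) hσ hn (by omega) (d + 1)
    have hd2 := hd.trans (by omega) hd'
    have hs2 := hd2.represents hs
    have h3 : Exec W (.const (3 * (d + 2) + 1) 1) s2 1 (s2.setReg (3 * (d + 2) + 1) 1) :=
      .const _ _ _ (by omega)
    have hd3 := hd2.setReg (d' := d + 2) (by omega) 1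
    set s3 := s2.setReg (3 * (d + 2) + 1) 1 with hs3
    have e3 : s3.reg (3 * (d + 2) + 1) = 1 := State.reg_setReg_self _ _ _
    have h4 := Exec.add (W := W) s3 (3 * (d + 2) + 1) 2 (3 * (d + 2) + 1) (by
      rw [e3, (hd3.represents hs).verts]
      omega)
    rw [e3, (hd3.represents hs).verts] at h4
    have hd4 := hd3.setReg (d' := d + 2) (by omega) (n + 1)
    set s4 := s3.setReg (3 * (d + 2) + 1) (n + 1) with hs4
    have hs4' := hd4.represents hs
    have e4 : s4.reg (3 * (d + 2) + 1) = n + 1 := State.reg_setReg_self _ _ _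
    have e4' : s4.reg (3 * d + 1) = i.eval n m σ := by
      rw [hs4, State.reg_setReg_ne _ (by omega), hs3, State.reg_setReg_ne _ (by omega),
        hd'.reg _ (by omega), hv]
    have e4'' : s4.reg (3 * (d + 1) + 1) = e.eval n m σ := by
      rw [hs4, State.reg_setReg_ne _ (by omega), hs3, State.reg_setReg_ne _ (by omega), hv']
    by_cases hlt : i.eval n m σ < n + 1
    · refine ⟨_, _, .seq h1 (.seq h2 (.seq h3 (.seq h4 (.ifTrue ?_ (.store _ _ _))))),
        ?_, ?_, fun j hj => ?_⟩
      · rw [e4, e4']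
        exact hlt
      · simp only [cost]
        omega
      · simp only [run, if_pos hlt, e4', e4'']
        refine ⟨hs4'.var, hs4'.verts, hs4'.edges, hs4'.base, hs4'.zero, fun k j => ?_,
          fun j hj => ?_, hs4'.out⟩
        · simp only [Function.update_apply]
          rw [if_neg, hs4'.arr]
          simp only [GrundyTD.base]
          omega
        · simp only [Function.update_apply, hs4'.low j hj]
      · exact hd4.reg _ (by omega)
    · refine ⟨_, _, .seq h1 (.seq h2 (.seq h3 (.seq h4 (.ifFalse ?_ (.skip _))))),
        ?_, ?_, fun j hj => ?_⟩
      · rw [e4, e4']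
        exact hlt
      · simp only [cost]
        omega
      · simp only [run, if_neg hlt]
        exact hs4'
      · exact hd4.reg _ (by omega)
  | seq P Q ih ih' =>
    simp only [cost] at hW
    obtain ⟨t, s1, h1, ht, hs1, hj⟩ := ih hs hσ hn hm (by omega) d
    obtain ⟨t', s2, h2, ht', hs2, hj'⟩ :=
      ih' hs1 (P.run_bounded hσ hn hm) (by omega) (by omega) (by omega) d
    exact ⟨_, _, .seq h1 h2, by simp only [cost]; omega, hs2,
      fun j h => (hj' j h).trans (hj j h)⟩
  | ite e f P Q ih ih' =>
    simp only [cost] at hW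
    obtain ⟨t, s1, h1, ht, hv, hd⟩ := e.exec_compile (W := W) hs hσ hn (by omega) d
    obtain ⟨t', s2, h2, ht', hv', hd'⟩ :=
      f.exec_compile (W := W) (hd.represents hs) hσ hn (by omega) (d + 1)
    have hd2 := hd.trans (by omega) hd'
    have hr : s2.reg (3 * d + 1) = e.eval n m σ := by rw [hd'.reg _ (by omega), hv]
    by_cases hlt : e.eval n m σ < f.eval n m σ
    · obtain ⟨t'', s3, h3, ht'', hs3, hj⟩ := ih (hd2.represents hs) hσ hn hm (by omega) d
      refine ⟨_, _, .seq h1 (.seq h2 (.ifTrue ?_ h3)), ?_,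
        by simpa only [run, if_pos hlt] using hs3, fun j h => ?_⟩
      · rw [hr, hv']
        exact hlt
      · simp only [cost]
        omega
      · rw [hj j h, hd2.reg _ (by omega)]
    · obtain ⟨t'', s3, h3, ht'', hs3, hj⟩ := ih' (hd2.represents hs) hσ hn hm (by omega) d
      refine ⟨_, _, .seq h1 (.seq h2 (.ifFalse ?_ h3)), ?_,
        by simpa only [run, if_neg hlt] using hs3, fun j h => ?_⟩
      · rw [hr, hv']
        exact hlt
      · simp only [cost]
        omega
      · rw [hj j h, hd2.reg _ (by omega)]
  | loop R v P ih =>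
    simp only [cost] at hW
    have hR : R.bound n m ≤ B := by cases R <;> assumption
    have h0 := (SameUpTo.refl d s).setReg (d' := d) le_rfl 0
    -- By iteration `i` the numbers may have grown by `i` times the cost of the body. With one
    -- further execution this still stays within the cost of the whole loop, for which `W` has room.
    have hmul : ∀ i < R.bound n m,
        i * P.cost n m + P.cost n m + 4 * R.bound n m ≤ R.bound n m * (P.cost n m + 4) := by
      intro i hi
      have : (i + 1) * P.cost n m ≤ R.bound n m * P.cost n m := Nat.mul_le_mul hi le_rfl
      rw [Nat.succ_mul] at this
      rw [Nat.mul_add]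
      omega
    obtain ⟨t, s', h1, ht, hs', hj⟩ := exec_while (n := n) (m := m) (W := W) (d := d)
      (T := P.cost n m + 3) (R := R) (σ := σ)
      (P := .seq (.sub (3 * v.code) (3 * d + 1) 11) (.seq (P.compile (d + 1))
        (.seq (.const (3 * (d + 1) + 1) 1) (.add (3 * d + 1) (3 * d + 1) (3 * (d + 1) + 1)))))
      (f := fun i s => P.run n m (s.setVar v i)) rfl (by
        intro i hi s hs hr
        have hm' := hmul i hi
        have hs1 := hs.setVar v i
        have hb : (iterate (fun i s => P.run n m (s.setVar v i)) i σ).Bounded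
            (B + i * P.cost n m) :=
          hσ.iterate fun i hi A τ hA hτ =>
            P.run_bounded (hτ.setVar v (by omega)) (by omega) (by omega)
        have h1 := Exec.sub (W := W) s (3 * v.code) (3 * d + 1) 11
        rw [hr, hs.zero, Nat.sub_zero] at h1
        obtain ⟨t, s2, h2, ht, hs2, hj⟩ := ih hs1 (hb.setVar v (by omega)) (by omega) (by omega)
          (by omega) (d + 1)
        have h3 : Exec W (.const (3 * (d + 1) + 1) 1) s2 1 (s2.setReg (3 * (d + 1) + 1) 1) :=
          .const _ _ _ (by omega)
        have e3 : (s2.setReg (3 * (d + 1) + 1) 1).reg (3 * d + 1) = i := by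
          rw [State.reg_setReg_ne _ (by omega), hj d (by omega), State.reg_setReg_ne _ (by omega),
            hr]
        have h4 := Exec.add (W := W) (s2.setReg (3 * (d + 1) + 1) 1) (3 * d + 1) (3 * d + 1)
          (3 * (d + 1) + 1) (by
            rw [State.reg_setReg_self, e3]
            omega)
        rw [State.reg_setReg_self, e3] at h4
        have hd : SameUpTo d s2 ((s2.setReg (3 * (d + 1) + 1) 1).setReg (3 * d + 1) (i + 1)) :=
          ((SameUpTo.refl d s2).setReg (by omega) _).setReg le_rfl _
        refine ⟨_, _, .seq h1 (.seq h2 (.seq h3 h4)), by omega, hd.represents hs2,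
          State.reg_setReg_self _ _ _, fun j hj' => ?_⟩
        rw [hd.reg _ (by omega), hj j (by omega), State.reg_setReg_ne _ (by omega)])
      (R.bound n m) 0 (by omega) _ (h0.represents hs) (State.reg_setReg_self _ _ _)
    refine ⟨_, _, .seq (.const _ _ _ (by omega)) h1, ?_, hs', fun j h => ?_⟩
    · simp only [cost]
      rw [show P.cost n m + 3 + 1 = P.cost n m + 4 by omega] at ht
      omega
    · rw [hj j h, h0.reg _ (by omega)]

/-! ### Reasoning about runs -/

/-- Together with the next three definitions, a syntactic overestimate of what a program writes;
that a component of the store is unchanged can then be checked by `decide`. -/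
def Com.vars : Com → List Var
  | .set v _ => [v]
  | .seq P Q => P.vars ++ Q.vars
  | .ite _ _ P Q => P.vars ++ Q.vars
  | .loop _ v P => v :: P.vars
  | _ => []

def Com.arrs : Com → List Arr
  | .put k _ _ => [k]
  | .seq P Q => P.arrs ++ Q.arrs
  | .ite _ _ P Q => P.arrs ++ Q.arrs
  | .loop _ _ P => P.arrs
  | _ => []

def Com.emits : Com → Bool
  | .emit _ => true
  | .seq P Q => P.emits || Q.emits
  | .ite _ _ P Q => P.emits || Q.emits
  | .loop _ _ P => P.emits
  | _ => false

def Com.outs : Com → Bool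
  | .out _ _ => true
  | .seq P Q => P.outs || Q.outs
  | .ite _ _ P Q => P.outs || Q.outs
  | .loop _ _ P => P.outs
  | _ => false

/-- The stores agree except for what `P` writes. -/
structure Frame (P : Com) (σ τ : Store) : Prop where
  var : ∀ v, v ∉ P.vars → τ.r v = σ.r v
  arr : ∀ k, k ∉ P.arrs → τ.a k = σ.a k
  low : P.outs = false → τ.low = σ.low
  out : P.emits = false → τ.out = σ.out

theorem Frame.refl (P : Com) (σ : Store) : Frame P σ σ :=
  ⟨fun _ _ => rfl, fun _ _ => rfl, fun _ => rfl, fun _ => rfl⟩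

theorem Frame.trans {P : Com} {σ τ ρ : Store} (h : Frame P σ τ) (h' : Frame P τ ρ) :
    Frame P σ ρ :=
  ⟨fun v hv => (h'.var v hv).trans (h.var v hv), fun k hk => (h'.arr k hk).trans (h.arr k hk),
    fun hl => (h'.low hl).trans (h.low hl), fun ho => (h'.out ho).trans (h.out ho)⟩

theorem Com.frame (n m : ℕ) (P : Com) (σ : Store) : Frame P σ (P.run n m σ) := by
  induction P generalizing σ with
  | skip => exact .refl _ _
  | set v e =>
    refine ⟨fun w hw => ?_, fun _ _ => rfl, fun _ => rfl, fun _ => rfl⟩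
    have : w ≠ v := by simpa [vars] using hw
    simp [run, Store.setVar, this]
  | put k i e =>
    refine ⟨fun _ _ => rfl, fun l hl => ?_, fun _ => rfl, fun _ => rfl⟩
    have : l ≠ k := by simpa [arrs] using hl
    simp [run, Store.setArr, this]
  | emit e => exact ⟨fun _ _ => rfl, fun _ _ => rfl, fun _ => rfl, fun h => by cases h⟩
  | out i e =>
    simp only [run]
    split_ifs
    · exact ⟨fun _ _ => rfl, fun _ _ => rfl, fun h => by simp [outs] at h, fun _ => rfl⟩
    · exact .refl _ _
  | seq P Q ih ih' =>
    have h1 := ih σ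
    have h2 := ih' (P.run n m σ)
    refine ⟨fun v hv => ?_, fun k hk => ?_, fun hl => ?_, fun ho => ?_⟩
    · simp only [vars, List.mem_append, not_or] at hv
      exact (h2.var v hv.2).trans (h1.var v hv.1)
    · simp only [arrs, List.mem_append, not_or] at hk
      exact (h2.arr k hk.2).trans (h1.arr k hk.1)
    · simp only [outs, Bool.or_eq_false_iff] at hl
      exact (h2.low hl.2).trans (h1.low hl.1)
    · simp only [emits, Bool.or_eq_false_iff] at ho
      exact (h2.out ho.2).trans (h1.out ho.1)
  | ite e f P Q ih ih' =>
    have h1 := ih σ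
    have h2 := ih' σ
    simp only [run]
    refine ⟨fun v hv => ?_, fun k hk => ?_, fun hl => ?_, fun ho => ?_⟩
    · simp only [vars, List.mem_append, not_or] at hv
      split_ifs
      exacts [h1.var v hv.1, h2.var v hv.2]
    · simp only [arrs, List.mem_append, not_or] at hk
      split_ifs
      exacts [h1.arr k hk.1, h2.arr k hk.2]
    · simp only [outs, Bool.or_eq_false_iff] at hl
      split_ifs
      exacts [h1.low hl.1, h2.low hl.2]
    · simp only [emits, Bool.or_eq_false_iff] at ho
      split_ifs
      exacts [h1.out ho.1, h2.out ho.2]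
  | loop R v P ih =>
    simp only [run]
    induction R.bound n m with
    | zero => exact .refl _ _
    | succ k ih' =>
      refine ih'.trans ?_
      rw [iterate]
      set τ := iterate (fun i s => P.run n m (s.setVar v i)) k σ
      have h1 := ih (τ.setVar v k)
      refine ⟨fun w hw => ?_, h1.arr, h1.low, h1.out⟩
      simp only [vars, List.mem_cons, not_or] at hw
      rw [h1.var w hw.2]
      simp [Store.setVar, hw.1]

/-- The invariant rule for loops; the bodies only have to be considered in stores that differ from
the first one in what the loop writes. -/
theorem Com.run_loop {n m : ℕ} {R : Range} {v : Var} {P : Com} {σ : Store} (I : ℕ → Store → Prop)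
    (h0 : I 0 σ)
    (hstep : ∀ i < R.bound n m, ∀ τ, Frame (.loop R v P) σ τ → I i τ →
      I (i + 1) (P.run n m (τ.setVar v i))) :
    I (R.bound n m) ((Com.loop R v P).run n m σ) := by
  have key : ∀ k ≤ R.bound n m,
      I k (iterate (fun i s => P.run n m (s.setVar v i)) k σ) ∧
        Frame (.loop R v P) σ (iterate (fun i s => P.run n m (s.setVar v i)) k σ) := by
    intro k hk
    induction k with
    | zero => exact ⟨h0, .refl _ _⟩
    | succ k ih =>
      obtain ⟨h1, h2⟩ := ih (by omega)
      refine ⟨hstep k (by omega) _ h2 h1, h2.trans ?_⟩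
      rw [iterate]
      set τ := iterate (fun i s => P.run n m (s.setVar v i)) k σ
      have h3 := P.frame n m (τ.setVar v k)
      refine ⟨fun w hw => ?_, h3.arr, h3.low, h3.out⟩
      simp only [vars, List.mem_cons, not_or] at hw
      rw [h3.var w hw.2]
      simp [Store.setVar, hw.1]
  exact (key _ le_rfl).1

end GrundyTD

namespace GrundyTD

-- Loops over the edges and over the words of a list.

infixr:60 " ;; " => Com.seq

namespace Com

/-- Run `P` for every edge, with its ends in the variables `p` and `q`. -/
def forEdges (P : Com) : Com :=
  .loop .edges .e (.set .p (.inp 0 (.var .e)) ;; .set .q (.inp 1 (.var .e)) ;; P)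

/-- Run `P` for every index `j` less than `len`. -/
def forWords (P : Com) : Com :=
  .loop .verts .j (.ite (.var .j) (.var .len) P .skip)

end Com

/-- The store holds the list of edges. -/
def HasInput {n : ℕ} (es : List (Fin n × Fin n)) (σ : Store) : Prop :=
  ∀ i e, es[i]? = some e → σ.low (2 * i + 2) = (e.1 : ℕ) ∧ σ.low (2 * i + 3) = (e.2 : ℕ)

/-- The invariant speaks of the list of edges already treated instead of a counter; the body must
not write to the memory that holds the input. -/
theorem run_forEdges {n : ℕ} {es : List (Fin n × Fin n)} {P : Com} {σ : Store}
    (hin : HasInput es σ) (hP : P.outs = false) (I : List (Fin n × Fin n) → Store → Prop)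
    (h0 : I [] σ)
    (hstep : ∀ p e s, es = p ++ e :: s → ∀ τ, Frame P.forEdges σ τ → I p τ →
      I (p ++ [e]) (P.run n es.length
        (((τ.setVar .e p.length).setVar .p e.1).setVar .q e.2))) :
    I es (P.forEdges.run n es.length σ) := by
  have := Com.run_loop (n := n) (m := es.length) (R := .edges) (v := .e)
    (P := .set .p (.inp 0 (.var .e)) ;; .set .q (.inp 1 (.var .e)) ;; P) (σ := σ)
    (fun i τ => I (es.take i) τ) (by simpa using h0) (by
      intro i hi τ hτ hI
      change i < es.length at hi
      have hes : es = es.take i ++ es[i] :: es.drop (i + 1) := by simp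
      have hlow : τ.low = σ.low := hτ.low (by simpa [Com.outs] using hP)
      have h1 := hstep _ _ _ hes τ hτ hI
      have h2 := hin i es[i] (by simp)
      simp only [List.length_take, Nat.min_eq_left hi.le] at h1
      rw [List.take_succ_eq_append_getElem hi]
      simpa [hi, hlow, h2] using h1)
  simpa [Com.forEdges, Range.bound] using this

/-- The loop always makes `n` rounds and is idle once `j` has reached the length of the list. The
idle rounds still set `j`, hence the last condition on the invariant. -/
theorem run_forWords {α : Type*} {n m : ℕ} {l : List α} {P : Com} {σ : Store}
    (hlen : σ.r .len = l.length) (hn : l.length ≤ n) (hP : Var.len ∉ P.vars)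
    (I : List α → Store → Prop) (h0 : I [] σ)
    (hstep : ∀ p w s, l = p ++ w :: s → ∀ τ, Frame P.forWords σ τ → I p τ →
      I (p ++ [w]) (P.run n m (τ.setVar .j p.length)))
    (hj : ∀ p τ i, I p τ → I p (τ.setVar .j i)) :
    I l (P.forWords.run n m σ) := by
  have := Com.run_loop (n := n) (m := m) (R := .verts) (v := .j)
    (P := .ite (.var .j) (.var .len) P .skip) (σ := σ)
    (fun i τ => I (l.take i) τ) (by simpa using h0) (by
      intro i hi τ hτ hI
      have hl : τ.r .len = l.length := by
        rw [hτ.var .len (by simpa [Com.vars] using hP), hlen]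
      by_cases hil : i < l.length
      · have hes : l = l.take i ++ l[i] :: l.drop (i + 1) := by simp
        have h1 := hstep _ _ _ hes τ hτ hI
        simp only [List.length_take, Nat.min_eq_left hil.le] at h1
        rw [List.take_succ_eq_append_getElem hil]
        simpa [hil, hl] using h1
      · have h1 := hj _ _ i hI
        rw [List.take_of_length_le (by omega)] at h1 ⊢
        simpa [hil, hl] using h1)
  simpa [Com.forWords, Range.bound, List.take_of_length_le hn] using this

/-! ### Computing the heights -/

/-- Set the key of every vertex `v` to `v * n`. -/
def initKeys : Com :=
  .loop .verts .vtx (.put .key (.var .vtx) (.var .acc) ;;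
    .loop .verts .e (.set .acc (.inc (.var .acc) 1)))

theorem run_initKeys {n m : ℕ} {σ : Store} (h0 : σ.r .acc = 0) :
    ∀ v < n, (initKeys.run n m σ).a .key v = v * n := by
  have := Com.run_loop (n := n) (m := m) (R := .verts) (v := .vtx)
    (P := .put .key (.var .vtx) (.var .acc) ;;
      .loop .verts .e (.set .acc (.inc (.var .acc) 1))) (σ := σ)
    -- The language has no multiplication: `acc` passes through the multiples of `n` by counting.
    (fun i τ => τ.r .acc = i * n ∧ ∀ v < i, τ.a .key v = v * n) (by simp [h0]) (by
      rintro i hi τ - ⟨h1, h2⟩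
      set τ' := (Com.put .key (.var .vtx) (.var .acc)).run n m (τ.setVar .vtx i) with hτ'
      have h3 := Com.run_loop (n := n) (m := m) (R := .verts) (v := .e)
        (P := .set .acc (.inc (.var .acc) 1)) (σ := τ') (fun k ρ => ρ.r .acc = i * n + k)
        (by simp [hτ', h1])
        (by
          intro k hk ρ _ h
          simp [Com.run, Exp.eval, Store.setVar, h]
          omega)
      have h4 := (Com.loop .verts .e (.set .acc (.inc (.var .acc) 1))).frame n m τ'
      refine ⟨?_, fun v hv => ?_⟩
      · rw [Nat.succ_mul]
        exact h3
      · rw [Com.run, ← hτ', h4.arr _ (by decide)]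
        by_cases hvi : v = i
        · simp [hτ', hvi, h1]
        · simp [hτ', hvi, h2 v (by omega)])
  exact this.2

/-- Relax the edge between `p` and `q`. -/
def relax : Com :=
  .ite (.inc (.arr .key (.var .p)) 1) (.arr .key (.var .q))
    (.put .key (.var .q) (.inc (.arr .key (.var .p)) 1)) .skip ;;
  .ite (.inc (.arr .key (.var .q)) 1) (.arr .key (.var .p))
    (.put .key (.var .p) (.inc (.arr .key (.var .q)) 1)) .skip

/-- The effect of relaxing an edge in one direction. -/
def relaxed (K : ℕ → ℕ) (p q : ℕ) : ℕ → ℕ := Function.update K q (min (K q) (K p + 1))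

theorem run_relax {n m : ℕ} (σ : Store) :
    (relax.run n m σ).a .key =
      relaxed (relaxed (σ.a .key) (σ.r .p) (σ.r .q)) (σ.r .q) (σ.r .p) := by
  have key : ∀ (u v : Var) (σ : Store), ((Com.ite (.inc (.arr .key (.var u)) 1) (.arr .key (.var v))
      (.put .key (.var v) (.inc (.arr .key (.var u)) 1)) .skip).run n m σ).a .key =
        relaxed (σ.a .key) (σ.r u) (σ.r v) ∧ ((Com.ite (.inc (.arr .key (.var u)) 1)
          (.arr .key (.var v)) (.put .key (.var v) (.inc (.arr .key (.var u)) 1)) .skip).run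
            n m σ).r = σ.r := by
    intro u v σ
    by_cases h : σ.a .key (σ.r u) + 1 < σ.a .key (σ.r v)
    · simp [h, relaxed, min_eq_right h.le, Store.setArr]
    · simp [h, relaxed, min_eq_left (not_lt.1 h)]
  rw [relax, Com.run, (key .q .p _).1, (key .p .q _).1, (key .p .q _).2]

/-- Compute the heights of the vertices. -/
def computeKeys : Com := initKeys ;; .loop .verts .j relax.forEdges

section

variable {n : ℕ} {G : SimpleGraph (Fin n)}

theorem IsEdgeList.adj {es : List (Fin n × Fin n)} (h : IsEdgeList G es)
    {e : Fin n × Fin n} (he : e ∈ es) : G.Adj e.1 e.2 :=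
  (h.2 _ _).2 (List.mem_map.2 ⟨e, he, rfl⟩)

/-- The smallest vertex of the component. -/
noncomputable def minRoot (G : SimpleGraph (Fin n)) (v : Fin n) : Fin n :=
  open Classical in
  (Finset.univ.filter fun u => G.Reachable u v).min' ⟨v, by simp⟩

theorem minRoot_reachable (v : Fin n) : G.Reachable (minRoot G v) v := by
  classical
  have := Finset.min'_mem (Finset.univ.filter fun u => G.Reachable u v) ⟨v, by simp⟩
  rw [Finset.mem_filter] at this
  unfold minRoot
  convert this.2

theorem minRoot_le (v : Fin n) : minRoot G v ≤ v := by
  classical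
  exact Finset.min'_le _ _ (by simp)

theorem isRooting_minRoot (hb : G.IsBipartite) (hd : IsDistanceHereditary G) :
    IsRooting G (minRoot G) where
  bipartite := hb
  distanceHereditary := hd
  reachable := minRoot_reachable
  eq_of_adj {u v} ha := by
    classical
    unfold minRoot
    congr 1
    ext w
    simp only [Finset.mem_filter, Finset.mem_univ, true_and]
    exact ⟨fun h => h.trans ha.reachable, fun h => h.trans ha.symm.reachable⟩

/-- The height of a vertex that the program computes. -/
noncomputable def keyHeight (G : SimpleGraph (Fin n)) : Fin n → ℕ :=
  height G (minRoot G) fun v => v * n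

theorem exists_walk_minRoot (v : Fin n) :
    ∃ p : G.Walk (minRoot G v) v, p.length = level G (minRoot G) v ∧ p.length < n := by
  obtain ⟨p, hp, hl⟩ := (minRoot_reachable (G := G) v).exists_path_of_dist
  exact ⟨p, hl, by simpa using hp.length_lt⟩

/-- After `n` rounds of relaxation, the key of `v` is the minimum of `u * n` plus the distance from
`u`, over the component. Distances are less than `n`, so the smallest vertex wins. Keys never drop
below `keyHeight`, which changes by at most one along an edge; after `i` rounds they are at most the
value given by any walk of length `i` or less. -/
theorem run_computeKeys (hb : G.IsBipartite) (hd : IsDistanceHereditary G)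
    {es : List (Fin n × Fin n)} (hes : IsEdgeList G es) {σ : Store} (hin : HasInput es σ)
    (h0 : σ.r .acc = 0) (v : Fin n) :
    (computeKeys.run n es.length σ).a .key v = keyHeight G v := by
  have hroot := isRooting_minRoot hb hd
  have hlip : ∀ {u v : Fin n}, G.Adj u v → keyHeight G v ≤ keyHeight G u + 1 := by
    intro u v ha
    have := hroot.level_le ha
    simp only [keyHeight, height, hroot.eq_of_adj ha]
    omega
  set σ1 := initKeys.run n es.length σ with hσ1
  have hin1 : HasInput es σ1 := by
    have := (initKeys.frame n es.length σ).low (by decide)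
    rw [HasInput, hσ1, this]
    exact hin
  have hrel : ∀ {K : ℕ → ℕ} {u v : Fin n}, G.Adj u v → (∀ w : Fin n, keyHeight G w ≤ K w) →
      ∀ w : Fin n, keyHeight G w ≤ relaxed K u v w := by
    intro K u v ha hK w
    simp only [relaxed, Function.update_apply]
    split_ifs with hw
    · rw [Fin.val_inj] at hw
      subst hw
      exact le_min (hK _) ((hlip ha).trans (by have := hK u; omega))
    · exact hK w
  have hle : ∀ (K : ℕ → ℕ) (u v w : ℕ), relaxed K u v w ≤ K w := by
    intro K u v w
    simp only [relaxed, Function.update_apply]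
    split_ifs with hw
    · rw [hw]
      exact min_le_left _ _
    · exact le_rfl
  have hupd : ∀ (K : ℕ → ℕ) (u v : ℕ), relaxed K u v v ≤ K u + 1 := by
    intro K u v
    simp [relaxed]
  have := Com.run_loop (n := n) (m := es.length) (R := .verts) (v := .j) (P := relax.forEdges)
    (σ := σ1) (fun i τ => (∀ v : Fin n, keyHeight G v ≤ τ.a .key v) ∧
      ∀ u v : Fin n, ∀ p : G.Walk u v, p.length ≤ i → τ.a .key v ≤ u * n + p.length) (by
      have hk := run_initKeys (n := n) (m := es.length) h0
      refine ⟨fun v => ?_, fun u v p hp => ?_⟩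
      · rw [hσ1, hk v v.2]
        obtain ⟨p, hp, hp'⟩ := exists_walk_minRoot (G := G) v
        rcases (minRoot_le (G := G) v).lt_or_eq with hlt | heq
        · have : ((minRoot G v : ℕ) + 1) * n ≤ v * n := Nat.mul_le_mul hlt le_rfl
          rw [Nat.succ_mul] at this
          simp only [keyHeight, height]
          omega
        · simp [keyHeight, height, level, heq]
      · rw [hσ1, hk v v.2]
        cases p with
        | nil => simp
        | cons _ _ => simp at hp) (by
      rintro i - τ hτ ⟨h1, h2⟩
      have hinτ : HasInput es (τ.setVar .j i) := by
        rw [HasInput, show (τ.setVar .j i).low = σ1.low from hτ.low (by decide)]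
        exact hin1
      have h3 := run_forEdges (P := relax) hinτ (by decide)
        (fun p ρ => (∀ v : Fin n, keyHeight G v ≤ ρ.a .key v) ∧ (∀ v, ρ.a .key v ≤ τ.a .key v) ∧
          ∀ e ∈ p, ρ.a .key (e.1 : ℕ) ≤ τ.a .key (e.2 : ℕ) + 1 ∧
            ρ.a .key (e.2 : ℕ) ≤ τ.a .key (e.1 : ℕ) + 1)
        ⟨h1, fun _ => le_rfl, by simp⟩ (by
          rintro p e s hps ρ - ⟨g1, g2, g3⟩
          have ha : G.Adj e.1 e.2 := hes.adj (by rw [hps]; simp)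
          rw [run_relax]
          simp only [Store.setVar_r, Store.setVar_a, reduceCtorEq, if_true, if_false]
          set K := ρ.a .key
          set K1 := relaxed K e.1 e.2
          refine ⟨hrel ha.symm (hrel ha g1), fun v => ((hle _ _ _ v).trans (hle _ _ _ v)).trans
            (g2 v), fun e' he' => ?_⟩
          rcases List.mem_append.1 he' with he' | he'
          · exact ⟨((hle _ _ _ _).trans (hle _ _ _ _)).trans (g3 e' he').1,
              ((hle _ _ _ _).trans (hle _ _ _ _)).trans (g3 e' he').2⟩
          · rw [List.mem_singleton.1 he']
            refine ⟨(hupd _ _ _).trans ?_, (hle _ _ _ _).trans ((hupd _ _ _).trans ?_)⟩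
            · exact Nat.add_le_add_right ((hle K e.1 e.2 e.2).trans (g2 e.2)) 1
            · have := g2 e.1
              omega)
      refine ⟨h3.1, fun u v p hp => ?_⟩
      by_cases hlen : p.length ≤ i
      · exact (h3.2.1 _).trans (h2 u v p hlen)
      -- Split off the last edge of the walk: the bound for the shorter walk held before this round,
      -- and the round has relaxed that edge.
      · rcases walk_cases p.reverse with ⟨-, h⟩ | ⟨w, ha, q, hq⟩
        · rw [SimpleGraph.Walk.length_reverse] at h
          omega
        · rw [SimpleGraph.Walk.length_reverse] at hq
          have h4 := h2 u w q.reverse (by rw [SimpleGraph.Walk.length_reverse]; omega)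
          rw [SimpleGraph.Walk.length_reverse] at h4
          have h5 : ((relax.forEdges.run n es.length (τ.setVar .j i)).a .key v) ≤
              τ.a .key w + 1 := by
            obtain ⟨e, he, hs⟩ := List.mem_map.1 ((hes.2 v w).1 ha)
            rcases Sym2.eq_iff.1 hs with ⟨e1, e2⟩ | ⟨e1, e2⟩
            · rw [← e1, ← e2]
              exact (h3.2.2 e he).1
            · rw [← e1, ← e2]
              exact (h3.2.2 e he).2
          omega)
  obtain ⟨p, hp, hp'⟩ := exists_walk_minRoot (G := G) v
  refine le_antisymm ?_ (this.1 v)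
  have := this.2 _ _ p hp'.le
  rw [hp] at this
  exact this

end

end GrundyTD

namespace GrundyTD

/-! ### Computing an elimination list -/

namespace Com

/-- Run `P` if the vertices in `p` and `q` have not been eliminated. -/
def ifAlive (P : Com) : Com :=
  .ite (.arr .dead (.var .p)) (.lit 1) (.ite (.arr .dead (.var .q)) (.lit 1) P .skip) .skip

end Com

def resetDegrees : Com := .loop .verts .vtx (.put .deg (.var .vtx) (.lit 0))

def countDegrees : Com :=
  (Com.ifAlive (.put .deg (.var .p) (.inc (.arr .deg (.var .p)) 1) ;;
    .put .deg (.var .q) (.inc (.arr .deg (.var .q)) 1))).forEdges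

/-- Store an extremal vertex in `x`. -/
def select : Com :=
  .set .found (.lit 0) ;;
  .loop .verts .vtx (.ite (.arr .dead (.var .vtx)) (.lit 1)
    (.ite (.var .found) (.lit 1) (.set .x (.var .vtx) ;; .set .found (.lit 1))
      (.ite (.arr .key (.var .x)) (.arr .key (.var .vtx)) (.set .x (.var .vtx))
        (.ite (.arr .key (.var .vtx)) (.arr .key (.var .x)) .skip
          (.ite (.arr .deg (.var .vtx)) (.arr .deg (.var .x)) (.set .x (.var .vtx)) .skip))))
    .skip)

/-- Store two neighbours of `x` in `a` and `b`, if there are so many. -/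
def findNeighbors : Com :=
  (Com.ifAlive (.ifEq (.var .p) (.var .x) (.set .b (.var .a) ;; .set .a (.var .q))
    (.ifEq (.var .q) (.var .x) (.set .b (.var .a) ;; .set .a (.var .p)) .skip))).forEdges

def recordWord : Com :=
  .ite (.arr .deg (.var .x)) (.lit 1)
    (.set .wx (.var .x) ;; .set .wz (.lit 2) ;; .set .wy (.var .x))
    (.ite (.arr .deg (.var .x)) (.lit 2)
      (.set .wx (.var .x) ;; .set .wz (.lit 0) ;; .set .wy (.var .a))
      (.set .wx (.var .a) ;; .set .wz (.lit 1) ;; .set .wy (.var .b))) ;;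
  .put .wx (.var .j) (.var .wx) ;; .put .wz (.var .j) (.var .wz) ;;
  .put .wy (.var .j) (.var .wy) ;; .put .dead (.var .wx) (.lit 1)

def eliminateOne : Com :=
  resetDegrees ;; countDegrees ;; select ;; findNeighbors ;; recordWord

def eliminateAll : Com := .loop .verts .j eliminateOne

section

variable {n : ℕ} {G : SimpleGraph (Fin n)} {es : List (Fin n × Fin n)}

/-- The number of listed edges of `G[U]` at `v`. -/
def edgeCount (p : List (Fin n × Fin n)) (U : Finset (Fin n)) (v : Fin n) : ℕ :=
  (U.filter fun w => v ∈ U ∧ s(v, w) ∈ p.map fun e => s(e.1, e.2)).card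

/-- Here `o` is the other end of `e`. It was not counted before, since no edge is listed twice. -/
theorem edgeCount_aux {p : List (Fin n × Fin n)} {U : Finset (Fin n)} {e : Fin n × Fin n}
    {v o : Fin n} (ho : ∀ w, s(v, w) = s(e.1, e.2) ↔ w = o)
    (hp : s(v, o) ∉ p.map fun e => s(e.1, e.2)) :
    edgeCount (p ++ [e]) U v = edgeCount p U v + if v ∈ U ∧ o ∈ U then 1 else 0 := by
  unfold edgeCount
  split_ifs with h
  · rw [← Finset.card_insert_of_notMem (a := o) (by simp only [Finset.mem_filter]; tauto)]
    congr 1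
    ext w
    have := ho w
    simp only [List.map_append, List.map_cons, List.map_nil, List.mem_append, List.mem_singleton,
      Finset.mem_filter, Finset.mem_insert]
    constructor
    · tauto
    · rintro (rfl | h') <;> tauto
  · congr 1
    ext w
    have := ho w
    simp only [List.map_append, List.map_cons, List.map_nil, List.mem_append, List.mem_singleton,
      Finset.mem_filter]
    constructor
    · rintro ⟨h1, h2, h3 | h3⟩
      · tauto
      · rw [this] at h3
        subst h3
        tauto
    · tauto

theorem IsEdgeList.notMem (hes : IsEdgeList G es) {p s : List (Fin n × Fin n)}
    {e : Fin n × Fin n} (hp : es = p ++ e :: s) :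
    s(e.1, e.2) ∉ p.map fun e => s(e.1, e.2) := by
  have := hes.1
  rw [hp, List.map_append, List.map_cons, List.nodup_append] at this
  exact fun h => this.2.2 _ h _ (by simp) rfl

theorem IsEdgeList.edgeCount_fst (hes : IsEdgeList G es) {p s : List (Fin n × Fin n)}
    {e : Fin n × Fin n} (hp : es = p ++ e :: s) (U : Finset (Fin n)) :
    edgeCount (p ++ [e]) U e.1 = edgeCount p U e.1 + if e.1 ∈ U ∧ e.2 ∈ U then 1 else 0 :=
  edgeCount_aux (fun _ => Sym2.congr_right) (hes.notMem hp)

theorem IsEdgeList.edgeCount_snd (hes : IsEdgeList G es) {p s : List (Fin n × Fin n)}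
    {e : Fin n × Fin n} (hp : es = p ++ e :: s) (U : Finset (Fin n)) :
    edgeCount (p ++ [e]) U e.2 = edgeCount p U e.2 + if e.2 ∈ U ∧ e.1 ∈ U then 1 else 0 := by
  refine edgeCount_aux (fun w => ?_) (by rw [Sym2.eq_swap]; exact hes.notMem hp)
  rw [Sym2.eq_swap]
  exact Sym2.congr_left

theorem edgeCount_of_ne {p : List (Fin n × Fin n)} {U : Finset (Fin n)} {e : Fin n × Fin n}
    {v : Fin n} (h1 : v ≠ e.1) (h2 : v ≠ e.2) :
    edgeCount (p ++ [e]) U v = edgeCount p U v := by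
  unfold edgeCount
  congr 1
  ext w
  have : s(v, w) ≠ s(e.1, e.2) := by
    intro h
    rcases Sym2.eq_iff.1 h with ⟨h, -⟩ | ⟨h, -⟩
    · exact h1 h
    · exact h2 h
  simp only [List.map_append, List.map_cons, List.map_nil, List.mem_append, List.mem_singleton,
    Finset.mem_filter, this, or_false]

theorem IsEdgeList.edgeCount_eq (hes : IsEdgeList G es) {U : Finset (Fin n)} {v : Fin n}
    (hv : v ∈ U) : edgeCount es U v = degIn G U v := by
  rw [edgeCount, degIn, ← Set.ncard_coe_finset]
  congr 1
  ext w
  simp [mem_nbhd, hv, hes.2]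

/-- The array `dead` marks the vertices outside of `U`. -/
def Alive (U : Finset (Fin n)) (σ : Store) : Prop :=
  ∀ v : Fin n, σ.a .dead v = if v ∈ U then 0 else 1

theorem Alive.of_mem {U : Finset (Fin n)} {σ : Store} (h : Alive U σ) {v : Fin n} (hv : v ∈ U) :
    σ.a .dead v = 0 := (h v).trans (if_pos hv)

theorem Alive.of_notMem {U : Finset (Fin n)} {σ : Store} (h : Alive U σ) {v : Fin n}
    (hv : v ∉ U) : σ.a .dead v = 1 := (h v).trans (if_neg hv)

theorem Alive.congr {U : Finset (Fin n)} {σ τ : Store} (h : Alive U σ)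
    (hτ : τ.a .dead = σ.a .dead) : Alive U τ := fun v => by rw [hτ, h v]

theorem Alive.run_ifAlive {U : Finset (Fin n)} {σ : Store} (h : Alive U σ) {u v : Fin n}
    (hu : σ.r .p = u) (hv : σ.r .q = v) (m : ℕ) (P : Com) :
    P.ifAlive.run n m σ = if u ∈ U ∧ v ∈ U then P.run n m σ else σ := by
  by_cases h1 : u ∈ U
  · by_cases h2 : v ∈ U
    · simp [Com.ifAlive, hu, hv, h1, h2, h.of_mem]
    · simp [Com.ifAlive, hu, hv, h1, h2, h.of_mem, h.of_notMem]
  · simp [Com.ifAlive, hu, h1, h.of_notMem]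

theorem run_resetDegrees {m : ℕ} (σ : Store) (v : Fin n) :
    (resetDegrees.run n m σ).a .deg v = 0 := by
  have := Com.run_loop (n := n) (m := m) (R := .verts) (v := .vtx)
    (P := .put .deg (.var .vtx) (.lit 0)) (σ := σ) (fun i τ => ∀ v < i, τ.a .deg v = 0)
    (by simp) (by
      intro i hi τ _ h v hv
      by_cases hvi : v = i
      · simp [hvi]
      · simp [h v (by omega)])
  exact this v v.2

theorem run_countDegrees (hes : IsEdgeList G es) {σ : Store} (hin : HasInput es σ)
    {U : Finset (Fin n)} (hU : Alive U σ) (h0 : ∀ v : Fin n, σ.a .deg v = 0) :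
    ∀ v : Fin n, (countDegrees.run n es.length σ).a .deg v = edgeCount es U v := by
  refine run_forEdges hin (by decide) (fun p τ => ∀ v : Fin n, τ.a .deg v = edgeCount p U v)
    (by simpa [edgeCount] using h0) ?_
  intro p e s hp τ hτ h v
  have hne : (e.1 : ℕ) ≠ e.2 := fun h => (hes.adj (by rw [hp]; simp : e ∈ es)).ne (Fin.ext h)
  have hA : Alive U (((τ.setVar .e p.length).setVar .p e.1).setVar .q e.2) :=
    hU.congr (hτ.arr .dead (by decide))
  rw [hA.run_ifAlive (u := e.1) (v := e.2) (by simp) (by simp)]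
  by_cases h1 : v = e.1
  · subst h1
    rw [hes.edgeCount_fst hp]
    split_ifs with hc
    · simp [h, hne]
    · simp [h]
  · by_cases h2 : v = e.2
    · subst h2
      rw [hes.edgeCount_snd hp]
      by_cases hc : e.1 ∈ U ∧ e.2 ∈ U
      · rw [if_pos hc, if_pos hc.symm]
        simp [h, hne.symm]
      · rw [if_neg hc, if_neg fun hc' => hc hc'.symm]
        simp [h]
    · rw [edgeCount_of_ne h1 h2]
      have h1' : (v : ℕ) ≠ e.1 := fun h => h1 (Fin.ext h)
      have h2' : (v : ℕ) ≠ e.2 := fun h => h2 (Fin.ext h)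
      split_ifs with hc
      · simp [h, h1', h2']
      · simp [h]

/-- The scan keeps the best living vertex so far, comparing first by larger key and then by smaller
degree; this is the condition that `IsExtremal` needs. -/
theorem run_select {m : ℕ} {σ : Store} {U : Finset (Fin n)} (hU : Alive U σ) (hne : U.Nonempty) :
    ∃ x ∈ U, (select.run n m σ).r .x = (x : ℕ) ∧ ∀ v ∈ U, σ.a .key v < σ.a .key x ∨
      (σ.a .key v = σ.a .key x ∧ σ.a .deg x ≤ σ.a .deg v) := by
  have := Com.run_loop (n := n) (m := m) (R := .verts) (v := .vtx)
    (P := (.ite (.arr .dead (.var .vtx)) (.lit 1)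
    (.ite (.var .found) (.lit 1) (.set .x (.var .vtx) ;; .set .found (.lit 1))
      (.ite (.arr .key (.var .x)) (.arr .key (.var .vtx)) (.set .x (.var .vtx))
        (.ite (.arr .key (.var .vtx)) (.arr .key (.var .x)) .skip
          (.ite (.arr .deg (.var .vtx)) (.arr .deg (.var .x)) (.set .x (.var .vtx)) .skip))))
    .skip)) (σ := (Com.set .found (.lit 0)).run n m σ)
    (fun i τ => (τ.r .found = 0 ∧ ∀ v ∈ U, i ≤ v.1) ∨ (τ.r .found = 1 ∧ ∃ x ∈ U,
      τ.r .x = (x : ℕ) ∧ ∀ v ∈ U, v.1 < i → σ.a .key v < σ.a .key x ∨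
        (σ.a .key v = σ.a .key x ∧ σ.a .deg x ≤ σ.a .deg v)))
    (by simp) (by
      intro i hi τ hτ h
      have hkey : τ.a .key = σ.a .key := hτ.arr .key (by decide)
      have hdeg : τ.a .deg = σ.a .deg := hτ.arr .deg (by decide)
      have hdead : τ.a .dead = σ.a .dead := hτ.arr .dead (by decide)
      have hi : i < n := hi
      have hcase : ∀ v ∈ U, v.1 < i + 1 → v.1 < i ∨ v = ⟨i, hi⟩ := fun v _ hv => by
        rcases Nat.lt_succ_iff_lt_or_eq.1 hv with h | h
        · exact .inl h
        · exact .inr (Fin.ext h)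
      by_cases hiU : (⟨i, hi⟩ : Fin n) ∈ U
      · have hd : σ.a .dead i = 0 := hU.of_mem hiU
        right
        rcases h with ⟨hf, h⟩ | ⟨hf, x, hx, hrx, h⟩
        · refine ⟨by simp [hdead, hd, hf], ⟨i, hi⟩, hiU, by simp [hdead, hd, hf],
            fun v hv hvi => ?_⟩
          rcases hcase v hv hvi with h' | rfl
          · have := h v hv
            omega
          · exact .inr ⟨rfl, le_rfl⟩
        · by_cases h1 : σ.a .key x < σ.a .key i
          · refine ⟨by simp [hdead, hd, hf, hrx, hkey, h1], ⟨i, hi⟩, hiU,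
              by simp [hdead, hd, hf, hrx, hkey, h1], fun v hv hvi => ?_⟩
            rcases hcase v hv hvi with h' | rfl
            · rcases h v hv h' with h2 | h2
              · exact .inl (h2.trans h1)
              · exact .inl (h2.1 ▸ h1)
            · exact .inr ⟨rfl, le_rfl⟩
          · by_cases h2 : σ.a .key i < σ.a .key x
            · refine ⟨by simp [hdead, hd, hf, hrx, hkey, h1, h2], x, hx,
                by simp [hdead, hd, hf, hrx, hkey, h1, h2], fun v hv hvi => ?_⟩
              rcases hcase v hv hvi with h' | rfl
              · exact h v hv h'
              · exact .inl h2
            · by_cases h3 : σ.a .deg i < σ.a .deg x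
              · refine ⟨by simp [hdead, hd, hf, hrx, hkey, hdeg, h1, h2, h3], ⟨i, hi⟩, hiU,
                  by simp [hdead, hd, hf, hrx, hkey, hdeg, h1, h2, h3], fun v hv hvi => ?_⟩
                rcases hcase v hv hvi with h' | rfl
                · have := h v hv h'
                  simp only
                  omega
                · exact .inr ⟨rfl, le_rfl⟩
              · refine ⟨by simp [hdead, hd, hf, hrx, hkey, hdeg, h1, h2, h3], x, hx,
                  by simp [hdead, hd, hf, hrx, hkey, hdeg, h1, h2, h3], fun v hv hvi => ?_⟩
                rcases hcase v hv hvi with h' | rfl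
                · exact h v hv h'
                · simp only
                  omega
      · have hd : σ.a .dead i = 1 := hU.of_notMem hiU
        have hcase' : ∀ v ∈ U, v.1 < i + 1 → v.1 < i := fun v hv hvi => by
          rcases hcase v hv hvi with h' | rfl
          · exact h'
          · exact absurd hv hiU
        rcases h with ⟨hf, h⟩ | ⟨hf, x, hx, hrx, h⟩
        · refine .inl ⟨by simp [hdead, hd, hf], fun v hv => ?_⟩
          by_contra hlt
          have := h v hv
          have := hcase' v hv (by omega)
          omega
        · exact .inr ⟨by simp [hdead, hd, hf], x, hx, by simp [hdead, hd, hrx],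
            fun v hv hvi => h v hv (hcase' v hv hvi)⟩)
  rcases this with ⟨-, h⟩ | ⟨-, x, hx, hrx, h⟩
  · obtain ⟨v, hv⟩ := hne
    have h1 := h v hv
    have h2 := v.2
    simp only [Range.bound] at h1
    omega
  · exact ⟨x, hx, hrx, fun v hv => h v hv v.2⟩

/-- The variables `a` and `b` hold the last two neighbours found, and anything at all before that,
hence the conditions on the count. The invariant records that the edge to `a` has been listed
already, so that the next neighbour differs from `a`. -/
theorem run_findNeighbors (hes : IsEdgeList G es) {σ : Store} (hin : HasInput es σ)
    {U : Finset (Fin n)} (hU : Alive U σ) {x : Fin n} (hx : σ.r .x = (x : ℕ)) :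
    (1 ≤ edgeCount es U x →
      ∃ a ∈ nbhd G U x, (findNeighbors.run n es.length σ).r .a = (a : ℕ)) ∧
    (2 ≤ edgeCount es U x →
      ∃ a ∈ nbhd G U x, ∃ b ∈ nbhd G U x, a ≠ b ∧
        (findNeighbors.run n es.length σ).r .a = (a : ℕ) ∧
        (findNeighbors.run n es.length σ).r .b = (b : ℕ)) := by
  have := run_forEdges (P := Com.ifAlive (.ifEq (.var .p) (.var .x)
      (.set .b (.var .a) ;; .set .a (.var .q))
      (.ifEq (.var .q) (.var .x) (.set .b (.var .a) ;; .set .a (.var .p)) .skip))) hin (by decide)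
    (fun p τ => (1 ≤ edgeCount p U x → ∃ a ∈ nbhd G U x,
        s(x, a) ∈ p.map (fun e => s(e.1, e.2)) ∧ τ.r .a = (a : ℕ)) ∧
      (2 ≤ edgeCount p U x → ∃ a ∈ nbhd G U x, ∃ b ∈ nbhd G U x, a ≠ b ∧
        s(x, a) ∈ p.map (fun e => s(e.1, e.2)) ∧ τ.r .a = (a : ℕ) ∧ τ.r .b = (b : ℕ)))
    (by simp [edgeCount]) (by
      rintro p e s hp τ hτ ⟨h1, h2⟩
      have hadj := hes.adj (by rw [hp]; simp : e ∈ es)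
      have hne : (e.1 : ℕ) ≠ e.2 := fun h => hadj.ne (Fin.ext h)
      have hA : Alive U (((τ.setVar .e p.length).setVar .p e.1).setVar .q e.2) :=
        hU.congr (hτ.arr .dead (by decide))
      have hτx : τ.r .x = x := by rw [hτ.var .x (by decide), hx]
      have hnew := hes.notMem hp
      rw [hA.run_ifAlive (u := e.1) (v := e.2) (by simp) (by simp)]
      have hold : (¬ (e.1 ∈ U ∧ e.2 ∈ U) ∨ (x ≠ e.1 ∧ x ≠ e.2)) →
          edgeCount (p ++ [e]) U x = edgeCount p U x := by
        intro hc
        by_cases hx1 : x = e.1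
        · subst hx1
          rw [hes.edgeCount_fst hp, if_neg (hc.resolve_right (by simp)), add_zero]
        · by_cases hx2 : x = e.2
          · subst hx2
            rw [hes.edgeCount_snd hp,
              if_neg fun h => hc.resolve_right (by simp) h.symm, add_zero]
          · exact edgeCount_of_ne hx1 hx2
      have hkeep : ∀ ρ : Store, ρ.r .a = τ.r .a → ρ.r .b = τ.r .b →
          edgeCount (p ++ [e]) U x = edgeCount p U x →
          (1 ≤ edgeCount (p ++ [e]) U x → ∃ a ∈ nbhd G U x,
            s(x, a) ∈ (p ++ [e]).map (fun e => s(e.1, e.2)) ∧ ρ.r .a = (a : ℕ)) ∧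
          (2 ≤ edgeCount (p ++ [e]) U x → ∃ a ∈ nbhd G U x, ∃ b ∈ nbhd G U x, a ≠ b ∧
            s(x, a) ∈ (p ++ [e]).map (fun e => s(e.1, e.2)) ∧ ρ.r .a = (a : ℕ) ∧
              ρ.r .b = (b : ℕ)) := by
        intro ρ ha hb hc
        rw [hc, ha, hb, List.map_append]
        refine ⟨fun h => ?_, fun h => ?_⟩
        · obtain ⟨a, ha, hs, hr⟩ := h1 h
          exact ⟨a, ha, List.mem_append_left _ hs, hr⟩
        · obtain ⟨a, ha, b, hb, hab, hs, hr, hr'⟩ := h2 h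
          exact ⟨a, ha, b, hb, hab, List.mem_append_left _ hs, hr, hr'⟩
      have hadd : ∀ (o : Fin n) (ρ : Store), o ∈ nbhd G U x → s(x, o) = s(e.1, e.2) →
          ρ.r .a = o → ρ.r .b = τ.r .a →
          edgeCount (p ++ [e]) U x = edgeCount p U x + 1 →
          (1 ≤ edgeCount (p ++ [e]) U x → ∃ a ∈ nbhd G U x,
            s(x, a) ∈ (p ++ [e]).map (fun e => s(e.1, e.2)) ∧ ρ.r .a = (a : ℕ)) ∧
          (2 ≤ edgeCount (p ++ [e]) U x → ∃ a ∈ nbhd G U x, ∃ b ∈ nbhd G U x, a ≠ b ∧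
            s(x, a) ∈ (p ++ [e]).map (fun e => s(e.1, e.2)) ∧ ρ.r .a = (a : ℕ) ∧
              ρ.r .b = (b : ℕ)) := by
        intro o ρ ho hs ha hb hc
        have hm : s(x, o) ∈ (p ++ [e]).map (fun e => s(e.1, e.2)) := by simp [hs]
        refine ⟨fun _ => ⟨o, ho, hm, ha⟩, fun h => ?_⟩
        obtain ⟨b, hbn, hbs, hbr⟩ := h1 (by omega)
        refine ⟨o, ho, b, hbn, ?_, hm, ha, hb.trans hbr⟩
        rintro rfl
        rw [hs] at hbs
        exact hnew hbs
      by_cases hc : e.1 ∈ U ∧ e.2 ∈ U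
      · rw [if_pos hc]
        by_cases hx1 : x = e.1
        · refine hadd e.2 _ (hx1 ▸ ⟨hc.2, hadj⟩) (by rw [hx1]) ?_ ?_ ?_
          · simp [hτx, hx1]
          · simp [hτx, hx1]
          · rw [hx1, hes.edgeCount_fst hp, if_pos hc]
        · have hx1' : (e.1 : ℕ) ≠ x := fun h => hx1 (Fin.ext h.symm)
          by_cases hx2 : x = e.2
          · refine hadd e.1 _ (hx2 ▸ ⟨hc.1, hadj.symm⟩) (by rw [hx2, Sym2.eq_swap]) ?_ ?_ ?_
            · simp [hτx, hx2, hne]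
            · simp [hτx, hx2, hne]
            · rw [hx2, hes.edgeCount_snd hp, if_pos hc.symm]
          · have hx2' : (e.2 : ℕ) ≠ x := fun h => hx2 (Fin.ext h.symm)
            refine hkeep _ ?_ ?_ (hold (.inr ⟨hx1, hx2⟩))
            · simp [hτx, hx1', hx2']
            · simp [hτx, hx1', hx2']
      · rw [if_neg hc]
        exact hkeep _ (by simp) (by simp) (hold (.inl hc)))
  refine ⟨fun h => ?_, fun h => ?_⟩
  · obtain ⟨a, ha, -, hr⟩ := this.1 h
    exact ⟨a, ha, hr⟩
  · obtain ⟨a, ha, b, hb, hab, -, hr⟩ := this.2 h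
    exact ⟨a, ha, b, hb, hab, hr⟩

/-- The arrays hold the words of `l`, from index `i` on. -/
def StoresWords (σ : Store) (i : ℕ) (l : List (ElimWord (Fin n))) : Prop :=
  ∀ j w, l[j]? = some w →
    σ.a .wx (i + j) = (w.x : ℕ) ∧ σ.a .wz (i + j) = w.z ∧ σ.a .wy (i + j) = (w.y : ℕ)

theorem run_recordWord {m : ℕ} {σ : Store} {j : ℕ} (hj : σ.r .j = j)
    {l : List (ElimWord (Fin n))} (hl : StoresWords σ 0 l) (hlen : l.length = j)
    {w : ElimWord (Fin n)} {U : Finset (Fin n)} (hU : Alive U σ)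
    (hw : (σ.a .deg (σ.r .x) = 0 ∧ σ.r .x = w.x ∧ w.z = 2 ∧ σ.r .x = w.y) ∨
      (σ.a .deg (σ.r .x) = 1 ∧ σ.r .x = w.x ∧ w.z = 0 ∧ σ.r .a = w.y) ∨
      (2 ≤ σ.a .deg (σ.r .x) ∧ σ.r .a = w.x ∧ w.z = 1 ∧ σ.r .b = w.y)) :
    StoresWords (recordWord.run n m σ) 0 (l ++ [w]) ∧
      Alive (U.erase w.x) (recordWord.run n m σ) := by
  -- The three branches differ only in the word they select; after that the writing is the same.
  have key : ∃ τ : Store, τ.r .j = j ∧ τ.r .wx = w.x ∧ τ.r .wz = w.z ∧ τ.r .wy = w.y ∧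
      τ.a = σ.a ∧ recordWord.run n m σ = (.put .wx (.var .j) (.var .wx) ;;
        .put .wz (.var .j) (.var .wz) ;; .put .wy (.var .j) (.var .wy) ;;
        .put .dead (.var .wx) (.lit 1) : Com).run n m τ := by
    rcases hw with ⟨h1, h2, h3, h4⟩ | ⟨h1, h2, h3, h4⟩ | ⟨h1, h2, h3, h4⟩
    · refine ⟨((σ.setVar .wx w.x).setVar .wz w.z).setVar .wy w.y, ?_⟩
      simp [recordWord, hj, h1, h3, ← h4, ← h2]
    · refine ⟨((σ.setVar .wx w.x).setVar .wz w.z).setVar .wy w.y, ?_⟩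
      simp [recordWord, hj, h1, h3, ← h4, ← h2]
    · refine ⟨((σ.setVar .wx w.x).setVar .wz w.z).setVar .wy w.y, ?_⟩
      have h5 : ¬ σ.a .deg (σ.r .x) < 1 := by omega
      have h6 : ¬ σ.a .deg (σ.r .x) < 2 := by omega
      simp [recordWord, hj, h3, ← h4, ← h2, h5, h6, -not_lt, -Nat.lt_one_iff]
  obtain ⟨τ, h1, h2, h3, h4, h5, h6⟩ := key
  rw [h6]
  refine ⟨fun i w' hw' => ?_, fun v => ?_⟩
  · rcases lt_trichotomy i j with hij | hij | hij
    · rw [List.getElem?_append_left (by omega)] at hw'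
      have := hl i w' hw'
      rw [zero_add] at this ⊢
      simp [h1, h5, hij.ne, this]
    · rw [← hlen] at hij
      subst hij
      obtain rfl : w = w' := by simpa using hw'
      simp [h1, h2, h3, h4, hlen]
    · rw [List.getElem?_eq_none (by simp; omega)] at hw'
      simp at hw'
  · have := hU v
    by_cases hv : v = w.x
    · simp [h2, hv]
    · have hv' : (v : ℕ) ≠ w.x := fun h => hv (Fin.ext h)
      simp [h2, h5, hv, hv', this]

/-- Invariant: after `j` rounds `j` words are stored, the array `dead` describes the set `U` that is
left, and any elimination list of `U` completes the stored words to one of the whole graph. -/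
theorem run_eliminateAll (hb : G.IsBipartite) (hd : IsDistanceHereditary G)
    (hes : IsEdgeList G es) {σ : Store} (hin : HasInput es σ)
    (hkey : ∀ v : Fin n, σ.a .key v = keyHeight G v) (hdead : ∀ v : Fin n, σ.a .dead v = 0) :
    ∃ l, Eliminates G Finset.univ l ∧
      StoresWords (eliminateAll.run n es.length σ) 0 l := by
  have hroot := isRooting_minRoot hb hd
  have := Com.run_loop (n := n) (m := es.length) (R := .verts) (v := .j) (P := eliminateOne)
    (σ := σ) (fun j τ => ∃ (U : Finset (Fin n)) (l : List (ElimWord (Fin n))),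
      (∀ l', Eliminates G U l' → Eliminates G Finset.univ (l ++ l')) ∧
      LowerClosed G (minRoot G) U ∧ l.length = j ∧ U.card + j = n ∧ Alive U τ ∧
      StoresWords τ 0 l)
    ⟨Finset.univ, [], fun _ h => h, hroot.lowerClosed_univ, rfl, by simp,
      fun v => by simp [hdead v], fun i w h => by simp at h⟩ (by
      rintro j hj τ hτ ⟨U, l, hU, hlow, hlen, hcard, halive, hst⟩
      have hj : j < n := hj
      set τ0 := τ.setVar .j j with hτ0
      set τ1 := resetDegrees.run n es.length τ0 with hτ1
      have f1 : Frame resetDegrees τ0 τ1 := Com.frame _ _ _ _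
      set τ2 := countDegrees.run n es.length τ1 with hτ2
      have f2 : Frame countDegrees τ1 τ2 := Com.frame _ _ _ _
      set τ3 := select.run n es.length τ2 with hτ3
      have f3 : Frame select τ2 τ3 := Com.frame _ _ _ _
      set τ4 := findNeighbors.run n es.length τ3 with hτ4
      have f4 : Frame findNeighbors τ3 τ4 := Com.frame _ _ _ _
      have hrun : eliminateOne.run n es.length τ0 = recordWord.run n es.length τ4 := rfl
      have hlow1 : τ1.low = σ.low := by
        rw [f1.low (by decide), hτ0, Store.setVar_low, hτ.low (by decide)]
      have hlow3 : τ3.low = σ.low := by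
        rw [f3.low (by decide), f2.low (by decide), hlow1]
      have hin1 : HasInput es τ1 := by rwa [HasInput, hlow1]
      have hin3 : HasInput es τ3 := by rwa [HasInput, hlow3]
      have ha1 : Alive U τ1 := halive.congr (f1.arr .dead (by decide))
      have ha2 : Alive U τ2 := ha1.congr (f2.arr .dead (by decide))
      have ha3 : Alive U τ3 := ha2.congr (f3.arr .dead (by decide))
      have ha4 : Alive U τ4 := ha3.congr (f4.arr .dead (by decide))
      have hdeg : ∀ v : Fin n, τ2.a .deg v = edgeCount es U v :=
        run_countDegrees hes hin1 ha1 (run_resetDegrees τ0)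
      have hkey2 : ∀ v : Fin n, τ2.a .key v = keyHeight G v := by
        intro v
        rw [f2.arr .key (by decide), f1.arr .key (by decide), hτ0, Store.setVar_a,
          hτ.arr .key (by decide), hkey]
      obtain ⟨x, hxU, hrx, hx⟩ := run_select (m := es.length) ha2
        (Finset.card_pos.1 (by omega : 0 < U.card))
      have hext : IsExtremal G (minRoot G) (fun v => v * n) U x := by
        refine ⟨hxU, fun v hv => ?_, fun v hv he => ?_⟩
        · have := hx v hv
          rw [hkey2, hkey2] at this
          change keyHeight G v ≤ keyHeight G x
          omega
        · have := hx v hv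
          rw [hkey2, hkey2, hdeg, hdeg, hes.edgeCount_eq hxU, hes.edgeCount_eq hv] at this
          change keyHeight G v = keyHeight G x at he
          omega
      have hnb := run_findNeighbors hes hin3 ha3 hrx
      rw [← hτ4, hes.edgeCount_eq hxU] at hnb
      have hrx4 : τ4.r .x = x := by rw [f4.var .x (by decide), hrx]
      have hj4 : τ4.r .j = j := by
        rw [f4.var .j (by decide), f3.var .j (by decide), f2.var .j (by decide),
          f1.var .j (by decide), hτ0]
        simp
      have hdeg4 : τ4.a .deg (τ4.r .x) = degIn G U x := by
        rw [hrx4, f4.arr .deg (by decide), f3.arr .deg (by decide), hdeg, hes.edgeCount_eq hxU]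
      have hst4 : StoresWords τ4 0 l := by
        intro i w hw
        rw [f4.arr .wx (by decide), f3.arr .wx (by decide), f2.arr .wx (by decide),
          f1.arr .wx (by decide), f4.arr .wz (by decide), f3.arr .wz (by decide),
          f2.arr .wz (by decide), f1.arr .wz (by decide), f4.arr .wy (by decide),
          f3.arr .wy (by decide), f2.arr .wy (by decide), f1.arr .wy (by decide)]
        exact hst i w hw
      obtain ⟨w, hw, hc, hcl⟩ : ∃ w : ElimWord (Fin n),
          ((τ4.a .deg (τ4.r .x) = 0 ∧ τ4.r .x = w.x ∧ w.z = 2 ∧ τ4.r .x = w.y) ∨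
          (τ4.a .deg (τ4.r .x) = 1 ∧ τ4.r .x = w.x ∧ w.z = 0 ∧ τ4.r .a = w.y) ∨
          (2 ≤ τ4.a .deg (τ4.r .x) ∧ τ4.r .a = w.x ∧ w.z = 1 ∧ τ4.r .b = w.y)) ∧
          w.Correct G U ∧ LowerClosed G (minRoot G) (U.erase w.x) := by
        rw [hdeg4, hrx4]
        rcases lt_trichotomy (degIn G U x) 1 with h | h | h
        · exact ⟨⟨x, 2, x⟩, .inl ⟨by omega, rfl, rfl, rfl⟩,
            hext.isolated hroot hlow (by omega) x⟩
        · obtain ⟨a, ha, hra⟩ := hnb.1 (by omega)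
          exact ⟨⟨x, 0, a⟩, .inr (.inl ⟨h, rfl, rfl, hra⟩), hext.leaf hroot hlow h ha⟩
        · obtain ⟨a, ha, b, hb, hab, hra, hrb⟩ := hnb.2 h
          exact ⟨⟨a, 1, b⟩, .inr (.inr ⟨h, hra, rfl, hrb⟩), hext.twins hroot hlow ha hb hab⟩
      have hrec := run_recordWord (m := es.length) hj4 hst4 hlen ha4 hw
      rw [hrun]
      refine ⟨U.erase w.x, l ++ [w], fun l' hl' => ?_, hcl, by simp [hlen], ?_, hrec.2, hrec.1⟩
      · rw [List.append_assoc]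
        exact hU _ ⟨hc, hl'⟩
      · rw [Finset.card_erase_of_mem hc.1]
        have := Finset.card_pos.2 ⟨_, hc.1⟩
        omega)
  obtain ⟨U, l, hU, -, -, hcard, -, hst⟩ := this
  have hU0 : U = ∅ := Finset.card_eq_zero.1 (by simp only [Range.bound] at hcard; omega)
  exact ⟨l, by simpa using hU [] hU0, hst⟩

end

end GrundyTD

namespace GrundyTD

/-! ### Words of elimination lists -/

theorem isolatedVertices_append {V : Type*} (p : List (ElimWord V)) (w : ElimWord V) :
    isolatedVertices (p ++ [w]) = isolatedVertices p ++ if w.z = 2 then [w.x] else [] := by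
  by_cases h : w.z = 2 <;> simp [isolatedVertices, h]

section

variable {V : Type*} [DecidableEq V] {G : SimpleGraph V} {U : Finset V}

theorem Eliminates.z_le {l : List (ElimWord V)} (h : Eliminates G U l) : ∀ w ∈ l, w.z ≤ 2 := by
  induction l generalizing U with
  | nil => simp
  | cons w l ih =>
    intro w' hw'
    rcases List.mem_cons.1 hw' with rfl | hw'
    · rcases h.1.2 with h | h | h <;> omega
    · exact ih h.2 w' hw'

/-- A leaf or false twin leaves its partner behind, so the final word is that of an isolated vertex.
Hence the vertex that ends the pruning sequence exists. -/
theorem Eliminates.isolatedVertices_ne_nil {l : List (ElimWord V)} (h : Eliminates G U l)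
    (hl : l ≠ []) : isolatedVertices l ≠ [] := by
  induction l generalizing U with
  | nil => exact absurd rfl hl
  | cons w l ih =>
    obtain ⟨⟨hx, hw⟩, hl'⟩ := h
    by_cases hz : w.z = 2
    · simp [isolatedVertices, hz]
    · have hy : w.y ∈ U.erase w.x := by
        rcases hw with ⟨_, hn⟩ | ⟨_, hy, hne, -⟩ | ⟨h2, -⟩
        · have : w.y ∈ nbhd G U w.x := by rw [hn]; rfl
          exact Finset.mem_erase.2 ⟨this.2.ne', this.1⟩
        · exact Finset.mem_erase.2 ⟨hne.symm, hy⟩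
        · exact absurd h2 hz
      have hne : l ≠ [] := by
        rintro rfl
        rw [show U.erase w.x = ∅ from hl'] at hy
        simp at hy
      have := ih hl' hne
      simpa [isolatedVertices, hz] using this

/-- The program recognizes the last isolated vertex by comparing names instead of positions; as
there are no repetitions, the result is the same. -/
theorem isolatedWords_eq {J : List V} (hJ : J.Nodup) {r : V} (hr : J.getLast? = some r) :
    isolatedWords J = (J.filter fun x => x ≠ r).map fun x => ⟨x, .falseTwin, r⟩ := by
  rcases List.eq_nil_or_concat' J with rfl | ⟨J, s, rfl⟩
  · simp at hr
  · obtain rfl : s = r := by simpa using hr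
    rw [List.nodup_append] at hJ
    have : J.filter (fun x => decide (x ≠ s)) = J := by
      rw [List.filter_eq_self]
      intro a ha
      simpa using fun h => hJ.2.2 a ha s (by simp) h
    simp only [isolatedWords, List.getLast?_concat,
      List.dropLast_concat, List.filter_append, this]
    simp

theorem Eliminates.nodup_isolatedVertices {l : List (ElimWord V)} (h : Eliminates G U l) :
    (isolatedVertices l).Nodup := by
  have := h.isPruningSequence.nodup
  rw [pruneOrder, List.nodup_append] at this
  simpa using this.2.1

theorem Eliminates.length_pruneWords {l : List (ElimWord V)} (h : Eliminates G U l) :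
    (pruneWords l []).length = l.length - 1 := by
  have h1 := congrArg List.length h.isPruningSequence.words
  have h2 := congrArg Finset.card h.isPruningSequence.vertices
  rw [List.toFinset_card_of_nodup h.isPruningSequence.nodup, ← h.length_eq] at h2
  simpa [h2] using h1

end

/-! ### The calls of the algorithm -/

/-- Find out whether there is a word of kind `P`, and store the last isolated vertex in `last`. -/
def scan : Com :=
  .set .has (.lit 0) ;; .forWords
    (.ite (.arr .wz (.var .j)) (.lit 1) (.set .has (.lit 1))
      (.ite (.lit 1) (.arr .wz (.var .j)) (.set .last (.arr .wx (.var .j))) .skip))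

def emitProper : Com :=
  .forWords (.ite (.arr .wz (.var .j)) (.lit 2)
    (.emit (.arr .wx (.var .j)) ;; .emit (.arr .wz (.var .j)) ;; .emit (.arr .wy (.var .j))) .skip)

def emitIsolated : Com :=
  .forWords (.ite (.lit 1) (.arr .wz (.var .j))
    (.ifEq (.arr .wx (.var .j)) (.var .last) .skip
      (.emit (.arr .wx (.var .j)) ;; .emit (.lit 1) ;; .emit (.var .last))) .skip)

/-- Write out the pruning sequence. -/
def emitSequence : Com := .emit (.sub (.var .len) (.lit 1)) ;; emitProper ;; emitIsolated

/-- Find out what becomes of the word in `wx`, `wz`, `wy` in the next call; `wr` tells whether it is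
kept. -/
def decideWord : Com :=
  .ifEq (.var .ph) (.lit 0)
    (.ite (.var .wz) (.lit 1)
      (.put .xs (.var .cnt) (.var .wx) ;; .put .ys (.var .cnt) (.var .wy) ;;
        .set .y (.var .wy) ;; .set .ph (.lit 1) ;; .set .wr (.lit 0))
      (.ite (.var .wz) (.lit 2) (.set .wr (.lit 0)) .skip))
    (.ifEq (.var .ph) (.lit 1)
      (.ifEq (.var .wx) (.var .y) (.set .rep (.var .y) ;; .set .ph (.lit 2) ;; .set .wr (.lit 0))
        (.ite (.var .wz) (.lit 2)
          (.ifEq (.var .wy) (.var .y)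
            (.ite (.var .wz) (.lit 1) (.set .wz (.lit 2) ;; .set .wy (.var .wx))
              (.set .rep (.var .wx) ;; .set .ph (.lit 2) ;; .set .wr (.lit 0))) .skip) .skip))
      (.ifEq (.var .wx) (.var .y) (.set .wx (.var .rep)) .skip ;;
        .ifEq (.var .wy) (.var .y) (.set .wy (.var .rep)) .skip))

def loadWord : Com :=
  .set .wx (.arr .wx (.var .j)) ;; .set .wz (.arr .wz (.var .j)) ;;
    .set .wy (.arr .wy (.var .j)) ;; .set .wr (.lit 1)

def writeWord : Com :=
  .ite (.lit 0) (.var .wr)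
    (.put .wx (.var .k) (.var .wx) ;; .put .wz (.var .k) (.var .wz) ;;
      .put .wy (.var .k) (.var .wy) ;; .set .k (.inc (.var .k) 1)) .skip

/-- Compute the elimination list of the next call. -/
def transform : Com :=
  .set .ph (.lit 0) ;; .set .k (.lit 0) ;; .forWords (loadWord ;; decideWord ;; writeWord) ;;
    .set .len (.var .k)

def callOnce : Com :=
  scan ;; .ite (.lit 0) (.var .has)
    (emitSequence ;; transform ;; .set .cnt (.inc (.var .cnt) 1) ;;
      .set .cnt2 (.inc (.var .cnt2) 2)) .skip

def callAll : Com := .set .len .size ;; .loop .verts .vtx callOnce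

section

variable {n m : ℕ} {G : SimpleGraph (Fin n)}

theorem StoresWords.congr {σ τ : Store} {i : ℕ} {l : List (ElimWord (Fin n))}
    (h : StoresWords σ i l) (hx : τ.a .wx = σ.a .wx) (hz : τ.a .wz = σ.a .wz)
    (hy : τ.a .wy = σ.a .wy) : StoresWords τ i l := by
  intro j w hw
  rw [hx, hz, hy]
  exact h j w hw

theorem StoresWords.at {σ : Store} {p s : List (ElimWord (Fin n))} {w : ElimWord (Fin n)}
    (h : StoresWords σ 0 (p ++ w :: s)) :
    σ.a .wx p.length = (w.x : ℕ) ∧ σ.a .wz p.length = w.z ∧ σ.a .wy p.length = (w.y : ℕ) := by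
  simpa using h p.length w (by simp)

theorem run_scan {σ : Store} {l : List (ElimWord (Fin n))} (hl : StoresWords σ 0 l)
    (hlen : σ.r .len = l.length) (hn : l.length ≤ n) (hz : ∀ w ∈ l, w.z ≤ 2) :
    (((∀ w ∈ l, w.z ≠ 0) ∧ (scan.run n m σ).r .has = 0) ∨
      ((∃ w ∈ l, w.z = 0) ∧ (scan.run n m σ).r .has = 1)) ∧
    ∀ r, (isolatedVertices l).getLast? = some r → (scan.run n m σ).r .last = (r : ℕ) := by
  refine run_forWords (σ := (Com.set .has (.lit 0)).run n m σ) (by simpa using hlen) hn (by decide)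
    (fun p τ => (((∀ w ∈ p, w.z ≠ 0) ∧ τ.r .has = 0) ∨ ((∃ w ∈ p, w.z = 0) ∧ τ.r .has = 1)) ∧
      ∀ r, (isolatedVertices p).getLast? = some r → τ.r .last = (r : ℕ))
    (by simp [isolatedVertices]) ?_ (fun p τ i h => by simpa using h)
  rintro p w s hp τ hτ ⟨h1, h2⟩
  obtain ⟨hwx, hwz, -⟩ := (hp ▸ hl).at
  have ex : τ.a .wx = σ.a .wx := hτ.arr .wx (by decide)
  have ez : τ.a .wz = σ.a .wz := hτ.arr .wz (by decide)
  have hw := hz w (by rw [hp]; simp)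
  rw [isolatedVertices_append]
  obtain h0 | h0 | h0 : w.z = 0 ∨ w.z = 1 ∨ w.z = 2 := by omega
  · refine ⟨.inr ⟨⟨w, by simp, h0⟩, by simp [ez, hwz, h0]⟩, fun r hr => ?_⟩
    simpa [ez, hwz, h0] using h2 r (by simpa [h0] using hr)
  · refine ⟨?_, fun r hr => ?_⟩
    · rcases h1 with ⟨h1, h3⟩ | ⟨⟨w', h1, h1'⟩, h3⟩
      · refine .inl ⟨fun w' hw' => ?_, by simp [ez, hwz, h0, h3]⟩
        rcases List.mem_append.1 hw' with hw' | hw'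
        · exact h1 w' hw'
        · rw [List.mem_singleton.1 hw', h0]
          simp
      · exact .inr ⟨⟨w', by simp [h1], h1'⟩, by simp [ez, hwz, h0, h3]⟩
    · simpa [ez, hwz, h0] using h2 r (by simpa [h0] using hr)
  · refine ⟨?_, fun r hr => ?_⟩
    · rcases h1 with ⟨h1, h3⟩ | ⟨⟨w', h1, h1'⟩, h3⟩
      · refine .inl ⟨fun w' hw' => ?_, by simp [ez, hwz, h0, h3]⟩
        rcases List.mem_append.1 hw' with hw' | hw'
        · exact h1 w' hw'
        · rw [List.mem_singleton.1 hw', h0]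
          simp
      · exact .inr ⟨⟨w', by simp [h1], h1'⟩, by simp [ez, hwz, h0, h3]⟩
    · obtain rfl : w.x = r := by simpa [h0] using hr
      simp [ez, ex, hwz, hwx, h0]

/-- The code of a word. -/
def encodeWord (q : PruneWord (Fin n)) : List ℕ := [(q.x : ℕ), q.op.code, (q.y : ℕ)]

theorem run_emitProper {σ : Store} {l : List (ElimWord (Fin n))} (hl : StoresWords σ 0 l)
    (hlen : σ.r .len = l.length) (hn : l.length ≤ n) (hz : ∀ w ∈ l, w.z ≤ 2) :
    (emitProper.run n m σ).out =
      σ.out ++ ((l.filter fun w => w.z ≠ 2).map ElimWord.toPrune).flatMap encodeWord := by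
  refine run_forWords hlen hn (by decide) (fun p τ => τ.out =
    σ.out ++ ((p.filter fun w => w.z ≠ 2).map ElimWord.toPrune).flatMap encodeWord)
    (by simp) ?_ (fun p τ i h => by simpa using h)
  intro p w s hp τ hτ h
  obtain ⟨hwx, hwz, hwy⟩ := (hp ▸ hl).at
  have ex : τ.a .wx = σ.a .wx := hτ.arr .wx (by decide)
  have ez : τ.a .wz = σ.a .wz := hτ.arr .wz (by decide)
  have ey : τ.a .wy = σ.a .wy := hτ.arr .wy (by decide)
  have hw := hz w (by rw [hp]; simp)
  obtain h0 | h0 | h0 : w.z = 0 ∨ w.z = 1 ∨ w.z = 2 := by omega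
  · simp [ex, ez, ey, hwx, hwz, hwy, h0, h, encodeWord, ElimWord.toPrune, PruneOp.code]
  · simp [ex, ez, ey, hwx, hwz, hwy, h0, h, encodeWord, ElimWord.toPrune, PruneOp.code]
  · simp [ez, hwz, h0, h]

theorem run_emitIsolated {σ : Store} {l : List (ElimWord (Fin n))} (hl : StoresWords σ 0 l)
    (hlen : σ.r .len = l.length) (hn : l.length ≤ n) (hz : ∀ w ∈ l, w.z ≤ 2) {r : Fin n}
    (hr : σ.r .last = r) :
    (emitIsolated.run n m σ).out = σ.out ++ (((isolatedVertices l).filter fun x => x ≠ r).map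
      fun x => (⟨x, .falseTwin, r⟩ : PruneWord (Fin n))).flatMap encodeWord := by
  refine run_forWords hlen hn (by decide) (fun p τ => τ.out =
    σ.out ++ (((isolatedVertices p).filter fun x => x ≠ r).map
      fun x => (⟨x, .falseTwin, r⟩ : PruneWord (Fin n))).flatMap encodeWord)
    (by simp [isolatedVertices]) ?_ (fun p τ i h => by simpa using h)
  intro p w s hp τ hτ h
  obtain ⟨hwx, hwz, hwy⟩ := (hp ▸ hl).at
  have ex : τ.a .wx = σ.a .wx := hτ.arr .wx (by decide)
  have ez : τ.a .wz = σ.a .wz := hτ.arr .wz (by decide)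
  have er : τ.r .last = r := by rw [hτ.var .last (by decide), hr]
  have hw := hz w (by rw [hp]; simp)
  rw [isolatedVertices_append]
  obtain h0 | h0 : w.z < 2 ∨ w.z = 2 := by omega
  · have h1 : ¬ 1 < w.z := by omega
    simp [ez, hwz, h0.ne, h, h1, -not_lt]
  · by_cases hx : w.x = r
    · simp [ex, ez, hwx, hwz, er, h0, h, hx]
    · have hx' : (w.x : ℕ) ≠ r := fun h => hx (Fin.ext h)
      simp [ex, ez, hwx, hwz, er, h0, h, hx, hx', encodeWord, PruneOp.code]

theorem run_emitSequence {σ : Store} {U : Finset (Fin n)} {l : List (ElimWord (Fin n))}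
    (hU : Eliminates G U l) (hl : StoresWords σ 0 l)
    (hlen : σ.r .len = l.length) (hn : l.length ≤ n)
    (hr : ∀ r, (isolatedVertices l).getLast? = some r → σ.r .last = (r : ℕ)) (hne : l ≠ []) :
    (emitSequence.run n m σ).out = σ.out ++ encodeLog [pruneWords l []] := by
  obtain ⟨r, hlast⟩ : ∃ r, (isolatedVertices l).getLast? = some r := by
    cases h : (isolatedVertices l).getLast? with
    | none => exact absurd (List.getLast?_eq_none_iff.1 h) (hU.isolatedVertices_ne_nil hne)
    | some r => exact ⟨r, rfl⟩
  set σ1 := (Com.emit (.sub (.var .len) (.lit 1))).run n m σ with hσ1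
  set σ2 := emitProper.run n m σ1 with hσ2
  have f2 : Frame emitProper σ1 σ2 := Com.frame _ _ _ _
  have h1 : σ1.out = σ.out ++ [l.length - 1] := by simp [hσ1, hlen]
  have hl1 : StoresWords σ1 0 l := hl
  have h2 := run_emitProper (m := m) hl1 hlen hn hU.z_le
  have h3 := run_emitIsolated (m := m) (σ := σ2) (r := r)
    (hl1.congr (f2.arr .wx (by decide)) (f2.arr .wz (by decide)) (f2.arr .wy (by decide)))
    (by rw [f2.var .len (by decide)]; exact hlen) hn hU.z_le
    (by rw [f2.var .last (by decide)]; exact hr r hlast)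
  have h4 : emitSequence.run n m σ = emitIsolated.run n m σ2 := rfl
  have h5 : encodeLog [pruneWords l []] =
      (l.length - 1) :: (pruneWords l []).flatMap encodeWord := by
    simp [encodeLog, hU.length_pruneWords]
    rfl
  rw [h4, h3, h2, h1, h5, pruneWords, List.nil_append,
    isolatedWords_eq hU.nodup_isolatedVertices hlast]
  simp

/-- The state of the transformation to the list `N` after the words of `p`, when the words in `o`
have been written and those of `s` remain; the result of the call is stored at index `c`. -/
def TransformPhase (N p s o : List (ElimWord (Fin n))) (c : ℕ) (τ : Store) : Prop :=
  (τ.r .ph = 0 ∧ p.find? (fun w => w.z = 0) = none ∧ N = o ++ nextCall s) ∨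
  ∃ w, p.find? (fun w => w.z = 0) = some w ∧ τ.a .xs c = w.x ∧ τ.a .ys c = w.y ∧ τ.r .y = w.y ∧
    ((τ.r .ph = 1 ∧ N = o ++ deleteVertex w.y s) ∨
      (τ.r .ph = 2 ∧ ∃ rep : Fin n, τ.r .rep = rep ∧
        N = o ++ s.map (ElimWord.map (rename w.y rep))))

theorem TransformPhase.congr {N p s o : List (ElimWord (Fin n))} {c : ℕ} {τ ρ : Store}
    (h : TransformPhase N p s o c τ) (h1 : ρ.r .ph = τ.r .ph) (h2 : ρ.r .y = τ.r .y)
    (h3 : ρ.r .rep = τ.r .rep) (h4 : ρ.a .xs c = τ.a .xs c) (h5 : ρ.a .ys c = τ.a .ys c) :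
    TransformPhase N p s o c ρ := by
  unfold TransformPhase
  rw [h1, h2, h3, h4, h5]
  exact h

/-- When the deleted vertex is reached in the list, the remaining words are copied. Treating this as
renaming `y` to itself merges it with the phase for twins. -/
theorem rename_self (y : Fin n) : ElimWord.map (rename y y) = id := by
  funext w
  have : ∀ v, rename y y v = v := fun v => by
    unfold rename
    split_ifs with h
    · exact h.symm
    · rfl
  simp [ElimWord.map, this]

/-- The variable `ph` unfolds the recursion of `nextCall` and `deleteVertex` into a single pass: `0`
while looking for the first leaf, `1` while deleting its support vertex, and `2` while renaming in
the rest. -/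
theorem run_decideWord {N p s o : List (ElimWord (Fin n))} {w : ElimWord (Fin n)} {c : ℕ}
    {τ : Store} (h : TransformPhase N p (w :: s) o c τ) (hc : τ.r .cnt = c) (hz : w.z ≤ 2)
    (hwx : τ.r .wx = w.x) (hwz : τ.r .wz = w.z) (hwy : τ.r .wy = w.y) (hwr : τ.r .wr = 1) :
    (((decideWord.run n m τ).r .wr = 0 ∧
        TransformPhase N (p ++ [w]) s o c (decideWord.run n m τ)) ∨
      ((decideWord.run n m τ).r .wr = 1 ∧ ∃ w', (decideWord.run n m τ).r .wx = w'.x ∧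
        (decideWord.run n m τ).r .wz = w'.z ∧ (decideWord.run n m τ).r .wy = w'.y ∧
        TransformPhase N (p ++ [w]) s (o ++ [w']) c (decideWord.run n m τ))) ∧
    ∀ i, i ≠ c → (decideWord.run n m τ).a .xs i = τ.a .xs i ∧
      (decideWord.run n m τ).a .ys i = τ.a .ys i := by
  rcases h with ⟨hph, hf, hN⟩ | ⟨v, hf, hxs, hys, hy, ⟨hph, hN⟩ | ⟨hph, rep, hrep, hN⟩⟩
  · obtain h0 | h0 | h0 : w.z = 0 ∨ w.z = 1 ∨ w.z = 2 := by omega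
    · refine ⟨.inl ⟨?_, .inr ⟨w, ?_, ?_, ?_, ?_, .inl ⟨?_, ?_⟩⟩⟩, ?_⟩
      · simp [decideWord, hph, hwz, h0]
      · simp [hf, h0]
      · simp [decideWord, hph, hwz, h0, hc, hwx]
      · simp [decideWord, hph, hwz, h0, hc, hwy]
      · simp [decideWord, hph, hwz, h0, hwy]
      · simp [decideWord, hph, hwz, h0]
      · rw [hN, nextCall, if_pos h0]
      · intro i hi
        simp [decideWord, hph, hwz, h0, hc, hi]
    · refine ⟨.inl ⟨?_, .inl ⟨?_, ?_, ?_⟩⟩, ?_⟩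
      · simp [decideWord, hph, hwz, h0]
      · simp [decideWord, hph, hwz, h0]
      · simp [hf, h0]
      · rw [hN, nextCall, if_neg (by omega), if_pos h0]
      · simp [decideWord, hph, hwz, h0]
    · refine ⟨.inr ⟨?_, w, ?_, ?_, ?_, .inl ⟨?_, ?_, ?_⟩⟩, ?_⟩
      · simp [decideWord, hph, hwz, h0, hwr]
      · simp [decideWord, hph, hwz, h0, hwx]
      · simp [decideWord, hph, hwz, h0]
      · simp [decideWord, hph, hwz, h0, hwy]
      · simp [decideWord, hph, hwz, h0]
      · simp [hf, h0]
      · rw [hN, nextCall, if_neg (by omega), if_neg (by omega)]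
        simp
      · simp [decideWord, hph, hwz, h0]
  · have hf' : (p ++ [w]).find? (fun w => w.z = 0) = some v := by simp [hf]
    by_cases hx : w.x = v.y
    · have hx' : (w.x : ℕ) = v.y := by rw [hx]
      refine ⟨.inl ⟨?_, .inr ⟨v, hf', ?_, ?_, ?_, .inr ⟨?_, v.y, ?_, ?_⟩⟩⟩, ?_⟩
      · simp [decideWord, hph, hwx, hy, hx']
      · simp [decideWord, hph, hwx, hy, hx', hxs]
      · simp [decideWord, hph, hwx, hy, hx', hys]
      · simp [decideWord, hph, hwx, hy, hx']
      · simp [decideWord, hph, hwx, hy, hx']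
      · simp [decideWord, hph, hwx, hy, hx']
      · rw [hN, deleteVertex, if_pos hx, rename_self]
        simp
      · simp [decideWord, hph, hwx, hy, hx']
    · have hx' : (w.x : ℕ) ≠ v.y := fun h => hx (Fin.ext h)
      by_cases hz2 : w.z = 2
      · refine ⟨.inr ⟨?_, w, ?_, ?_, ?_, .inr ⟨v, hf', ?_, ?_, ?_, .inl ⟨?_, ?_⟩⟩⟩, ?_⟩
        · simp [decideWord, hph, hwx, hy, hx', hwz, hz2, hwr]
        · simp [decideWord, hph, hwx, hy, hx', hwz, hz2]
        · simp [decideWord, hph, hwx, hy, hx', hwz, hz2]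
        · simp [decideWord, hph, hwx, hy, hx', hwz, hz2, hwy]
        · simp [decideWord, hph, hwx, hy, hx', hwz, hz2, hxs]
        · simp [decideWord, hph, hwx, hy, hx', hwz, hz2, hys]
        · simp [decideWord, hph, hwx, hy, hx', hwz, hz2]
        · simp [decideWord, hph, hwx, hy, hx', hwz, hz2]
        · rw [hN, deleteVertex, if_neg hx, if_pos hz2]
          simp
        · simp [decideWord, hph, hwx, hy, hx', hwz, hz2]
      · have hlt : w.z < 2 := by omega
        by_cases hwv : w.y = v.y
        · have hwv' : (w.y : ℕ) = v.y := by rw [hwv]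
          by_cases h0 : w.z = 0
          · refine ⟨.inr ⟨?_, ⟨w.x, 2, w.x⟩, ?_, ?_, ?_,
              .inr ⟨v, hf', ?_, ?_, ?_, .inl ⟨?_, ?_⟩⟩⟩, ?_⟩
            · simp [decideWord, hph, hwx, hy, hx', hwz, hwy, hwv', h0, hwr]
            · simp [decideWord, hph, hwx, hy, hx', hwz, hwy, hwv', h0]
            · simp [decideWord, hph, hwx, hy, hx', hwz, hwy, hwv', h0]
            · simp [decideWord, hph, hwx, hy, hx', hwz, hwy, hwv', h0]
            · simp [decideWord, hph, hwx, hy, hx', hwz, hwy, hwv', h0, hxs]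
            · simp [decideWord, hph, hwx, hy, hx', hwz, hwy, hwv', h0, hys]
            · simp [decideWord, hph, hwx, hy, hx', hwz, hwy, hwv', h0]
            · simp [decideWord, hph, hwx, hy, hx', hwz, hwy, hwv', h0]
            · rw [hN, deleteVertex, if_neg hx, if_neg hz2, if_pos hwv, if_pos h0]
              simp
            · simp [decideWord, hph, hwx, hy, hx', hwz, hwy, hwv', h0]
          · have h1 : w.z = 1 := by omega
            refine ⟨.inl ⟨?_, .inr ⟨v, hf', ?_, ?_, ?_, .inr ⟨?_, w.x, ?_, ?_⟩⟩⟩, ?_⟩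
            · simp [decideWord, hph, hwx, hy, hx', hwz, hwy, hwv', h1]
            · simp [decideWord, hph, hwx, hy, hx', hwz, hwy, hwv', h1, hxs]
            · simp [decideWord, hph, hwx, hy, hx', hwz, hwy, hwv', h1, hys]
            · simp [decideWord, hph, hwx, hy, hx', hwz, hwy, hwv', h1]
            · simp [decideWord, hph, hwx, hy, hx', hwz, hwy, hwv', h1]
            · simp [decideWord, hph, hwx, hy, hx', hwz, hwy, hwv', h1]
            · rw [hN, deleteVertex, if_neg hx, if_neg hz2, if_pos hwv, if_neg h0]
            · simp [decideWord, hph, hwx, hy, hx', hwz, hwy, hwv', h1]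
        · have hwv' : (w.y : ℕ) ≠ v.y := fun h => hwv (Fin.ext h)
          refine ⟨.inr ⟨?_, w, ?_, ?_, ?_, .inr ⟨v, hf', ?_, ?_, ?_, .inl ⟨?_, ?_⟩⟩⟩, ?_⟩
          · simp [decideWord, hph, hwx, hy, hx', hwz, hlt, hwy, hwv', hwr]
          · simp [decideWord, hph, hwx, hy, hx', hwz, hlt, hwy, hwv']
          · simp [decideWord, hph, hwx, hy, hx', hwz, hlt, hwy, hwv']
          · simp [decideWord, hph, hwx, hy, hx', hwz, hlt, hwy, hwv']
          · simp [decideWord, hph, hwx, hy, hx', hwz, hlt, hwy, hwv', hxs]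
          · simp [decideWord, hph, hwx, hy, hx', hwz, hlt, hwy, hwv', hys]
          · simp [decideWord, hph, hwx, hy, hx', hwz, hlt, hwy, hwv']
          · simp [decideWord, hph, hwx, hy, hx', hwz, hlt, hwy, hwv']
          · rw [hN, deleteVertex, if_neg hx, if_neg hz2, if_neg hwv]
            simp
          · simp [decideWord, hph, hwx, hy, hx', hwz, hlt, hwy, hwv']
  · have hf' : (p ++ [w]).find? (fun w => w.z = 0) = some v := by simp [hf]
    set τ1 := (Com.ifEq (.var .wx) (.var .y) (.set .wx (.var .rep)) .skip).run n m τ with hτ1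
    set τ2 := (Com.ifEq (.var .wy) (.var .y) (.set .wy (.var .rep)) .skip).run n m τ1 with hτ2
    have hrun : decideWord.run n m τ = τ2 := by
      simp [decideWord, hph, hτ2, hτ1]
    have hx1 : τ1.r .wx = ((rename v.y rep w.x : Fin n) : ℕ) := by
      unfold rename
      split_ifs with h
      · have h' : (w.x : ℕ) = v.y := by rw [h]
        simp [hτ1, hwx, hy, h', hrep]
      · have h' : (w.x : ℕ) ≠ v.y := fun h' => h (Fin.ext h')
        simp [hτ1, hwx, hy, h']
    have f1 : Frame _ τ τ1 := Com.frame _ _ _ _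
    have f2 : Frame _ τ1 τ2 := Com.frame _ _ _ _
    have hwy1 : τ1.r .wy = w.y := by rw [f1.var .wy (by decide), hwy]
    have hy1 : τ1.r .y = v.y := by rw [f1.var .y (by decide), hy]
    have hrep1 : τ1.r .rep = rep := by rw [f1.var .rep (by decide), hrep]
    have hy2 : τ2.r .wy = ((rename v.y rep w.y : Fin n) : ℕ) := by
      unfold rename
      split_ifs with h
      · have h' : (w.y : ℕ) = v.y := by rw [h]
        simp [hτ2, hwy1, hy1, h', hrep1]
      · have h' : (w.y : ℕ) ≠ v.y := fun h' => h (Fin.ext h')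
        simp [hτ2, hwy1, hy1, h']
    rw [hrun]
    refine ⟨.inr ⟨?_, w.map (rename v.y rep), ?_, ?_, hy2, .inr ⟨v, hf', ?_, ?_, ?_,
      .inr ⟨?_, rep, ?_, ?_⟩⟩⟩, fun i _ => ⟨?_, ?_⟩⟩
    · rw [f2.var .wr (by decide), f1.var .wr (by decide), hwr]
    · rw [f2.var .wx (by decide), hx1]
      rfl
    · rw [f2.var .wz (by decide), f1.var .wz (by decide), hwz]
      rfl
    · rw [f2.arr .xs (by decide), f1.arr .xs (by decide), hxs]
    · rw [f2.arr .ys (by decide), f1.arr .ys (by decide), hys]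
    · rw [f2.var .y (by decide), hy1]
    · rw [f2.var .ph (by decide), f1.var .ph (by decide), hph]
    · rw [f2.var .rep (by decide), hrep1]
    · rw [hN]
      simp
    · rw [f2.arr .xs (by decide), f1.arr .xs (by decide)]
    · rw [f2.arr .ys (by decide), f1.arr .ys (by decide)]

/-- The list is rewritten in place; writing stays strictly behind the first unread index, so no
unread word is destroyed. -/
theorem run_writeWord {τ : Store} {o s : List (ElimWord (Fin n))} {w : ElimWord (Fin n)} {q : ℕ}
    (ho : StoresWords τ 0 o) (hs : StoresWords τ q s) (hk : τ.r .k = o.length) (hq : o.length < q)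
    (hwr : τ.r .wr = 1) (hwx : τ.r .wx = w.x) (hwz : τ.r .wz = w.z) (hwy : τ.r .wy = w.y) :
    StoresWords (writeWord.run n m τ) 0 (o ++ [w]) ∧ StoresWords (writeWord.run n m τ) q s ∧
      (writeWord.run n m τ).r .k = o.length + 1 := by
  refine ⟨fun i w' hw' => ?_, fun i w' hw' => ?_, by simp [writeWord, hwr, hk]⟩
  · rcases lt_trichotomy i o.length with hij | hij | hij
    · rw [List.getElem?_append_left (by omega)] at hw'
      have := ho i w' hw'
      rw [zero_add] at this ⊢
      simp [writeWord, hwr, hk, hij.ne, this]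
    · subst hij
      obtain rfl : w = w' := by simpa using hw'
      simp [writeWord, hwr, hk, hwx, hwz, hwy]
    · rw [List.getElem?_eq_none (by simp; omega)] at hw'
      simp at hw'
  · have := hs i w' hw'
    have hne : q + i ≠ o.length := by omega
    simp [writeWord, hwr, hk, hne, this]

theorem run_transform {σ : Store} {l : List (ElimWord (Fin n))} (hl : StoresWords σ 0 l)
    (hlen : σ.r .len = l.length) (hn : l.length ≤ n) (hz : ∀ w ∈ l, w.z ≤ 2)
    {w : ElimWord (Fin n)} (hw : l.find? (fun w => w.z = 0) = some w) :
    StoresWords (transform.run n m σ) 0 (nextCall l) ∧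
      (transform.run n m σ).r .len = (nextCall l).length ∧
      (transform.run n m σ).a .xs (σ.r .cnt) = w.x ∧
      (transform.run n m σ).a .ys (σ.r .cnt) = w.y ∧
      ∀ i, i ≠ σ.r .cnt → (transform.run n m σ).a .xs i = σ.a .xs i ∧
        (transform.run n m σ).a .ys i = σ.a .ys i := by
  set σ1 := (Com.set .ph (.lit 0) ;; Com.set .k (.lit 0)).run n m σ with hσ1
  have := run_forWords (P := loadWord ;; decideWord ;; writeWord) (σ := σ1) (m := m)
    (by simpa [hσ1] using hlen) hn (by decide)
    (fun p τ => ∀ s, l = p ++ s → StoresWords τ p.length s ∧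
      (∀ i, i ≠ σ.r .cnt → τ.a .xs i = σ.a .xs i ∧ τ.a .ys i = σ.a .ys i) ∧
      ∃ o, τ.r .k = o.length ∧ o.length ≤ p.length ∧ StoresWords τ 0 o ∧
        TransformPhase (nextCall l) p s o (σ.r .cnt) τ)
    (by
      intro s hs
      refine ⟨?_, fun i _ => ⟨rfl, rfl⟩, [], by simp [hσ1], by simp, fun i w h => by simp at h,
        .inl ⟨by simp [hσ1], by simp, by simp [hs]⟩⟩
      rw [hs] at hl
      exact hl) (by
      intro p w s hp τ hτ h s' hs'
      obtain rfl : s = s' := by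
        rw [hp, List.append_assoc] at hs'
        simpa using hs'
      obtain ⟨hst, hxy, o, hk, hop, ho, hT⟩ := h _ hp
      have hcnt : τ.r .cnt = σ.r .cnt := by
        rw [hτ.var .cnt (by decide)]
        simp [hσ1]
      set τ0 := τ.setVar .j p.length with hτ0
      set τ1 := loadWord.run n m τ0 with hτ1
      set τ2 := decideWord.run n m τ1 with hτ2
      have f2 : Frame decideWord τ1 τ2 := Com.frame _ _ _ _
      have hrun : (loadWord ;; decideWord ;; writeWord).run n m τ0 = writeWord.run n m τ2 := rfl
      have hword := hst 0 w (by simp)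
      simp only [add_zero] at hword
      have ha1 : τ1.a = τ.a := by simp [hτ1, hτ0, loadWord]
      have hT1 : TransformPhase (nextCall l) p (w :: s) o (σ.r .cnt) τ1 :=
        hT.congr (by simp [hτ1, hτ0, loadWord]) (by simp [hτ1, hτ0, loadWord])
          (by simp [hτ1, hτ0, loadWord]) (by rw [ha1]) (by rw [ha1])
      have hst1 : StoresWords τ1 (p.length + 1) s := by
        intro i w' hw'
        have := hst (i + 1) w' (by simpa using hw')
        rw [ha1, add_assoc, add_comm 1 i]
        exact this
      have ho1 : StoresWords τ1 0 o := ho.congr (by rw [ha1]) (by rw [ha1]) (by rw [ha1])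
      have hst2 := hst1.congr (f2.arr .wx (by decide)) (f2.arr .wz (by decide))
        (f2.arr .wy (by decide))
      have ho2 := ho1.congr (f2.arr .wx (by decide)) (f2.arr .wz (by decide))
        (f2.arr .wy (by decide))
      have hk2 : τ2.r .k = o.length := by
        rw [f2.var .k (by decide), ← hk]
        simp [hτ1, hτ0, loadWord]
      obtain ⟨hdec, hxy2⟩ := run_decideWord (m := m) hT1
        (by rw [← hcnt]; simp [hτ1, hτ0, loadWord]) (hz w (by rw [hp]; simp))
        (by simp [hτ1, hτ0, loadWord, hword]) (by simp [hτ1, hτ0, loadWord, hword])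
        (by simp [hτ1, hτ0, loadWord, hword]) (by simp [hτ1, loadWord])
      rw [← hτ2] at hdec hxy2
      have f3 : Frame writeWord τ2 (writeWord.run n m τ2) := Com.frame _ _ _ _
      have hxs3 := f3.arr .xs (by decide)
      have hys3 := f3.arr .ys (by decide)
      have hcongr : ∀ o', TransformPhase (nextCall l) (p ++ [w]) s o' (σ.r .cnt) τ2 →
          TransformPhase (nextCall l) (p ++ [w]) s o' (σ.r .cnt) (writeWord.run n m τ2) :=
        fun o' h => h.congr (f3.var .ph (by decide)) (f3.var .y (by decide))
          (f3.var .rep (by decide)) (by rw [hxs3]) (by rw [hys3])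
      have hxy3 : ∀ i, i ≠ σ.r .cnt → (writeWord.run n m τ2).a .xs i = σ.a .xs i ∧
          (writeWord.run n m τ2).a .ys i = σ.a .ys i := by
        intro i hi
        rw [hxs3, hys3, (hxy2 i hi).1, (hxy2 i hi).2, ha1]
        exact hxy i hi
      rw [hrun, List.length_append, List.length_singleton]
      rcases hdec with ⟨hwr, hT2⟩ | ⟨hwr, w', hx, hz', hy, hT2⟩
      · have e : writeWord.run n m τ2 = τ2 := by simp [writeWord, hwr]
        refine ⟨?_, hxy3, o, ?_, by omega, ?_, hcongr o hT2⟩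
        · rwa [e]
        · rw [e, hk2]
        · rwa [e]
      · obtain ⟨g1, g2, g3⟩ := run_writeWord (m := m) ho2 hst2 hk2 (by omega) hwr hx hz' hy
        exact ⟨g2, hxy3, o ++ [w'], by simpa using g3, by simpa using hop, g1, hcongr _ hT2⟩)
    (by
      intro p τ i h s hs
      obtain ⟨h1, h2, o, h3, h4, h5, h6⟩ := h s hs
      exact ⟨h1, h2, o, by simpa using h3, h4, h5,
        h6.congr (by simp) (by simp) (by simp) rfl rfl⟩)
  obtain ⟨-, hxy, o, hk, -, ho, hT⟩ := this [] (by simp)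
  set τ := (loadWord ;; decideWord ;; writeWord).forWords.run n m σ1 with hτ
  have hrun : transform.run n m σ = (Com.set .len (.var .k)).run n m τ := rfl
  have hN : nextCall l = o ∧ τ.a .xs (σ.r .cnt) = w.x ∧ τ.a .ys (σ.r .cnt) = w.y := by
    rcases hT with ⟨-, hf, -⟩ | ⟨v, hf, hx, hy, -, ⟨-, hN⟩ | ⟨-, rep, -, hN⟩⟩
    · rw [hw] at hf
      simp at hf
    · obtain rfl : w = v := by
        rw [hw] at hf
        simpa using hf
      exact ⟨by simpa [deleteVertex] using hN, hx, hy⟩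
    · obtain rfl : w = v := by
        rw [hw] at hf
        simpa using hf
      exact ⟨by simpa using hN, hx, hy⟩
  rw [hrun, hN.1]
  refine ⟨fun i w' hw' => ?_, by simp [hk], by simpa using hN.2.1, by simpa using hN.2.2,
    fun i hi => ?_⟩
  · simpa using ho i w' hw'
  · simpa using hxy i hi

/-- What holds between the calls: `c` calls have been carried out. -/
structure CallState (G : SimpleGraph (Fin n)) (c : ℕ) (l : List (ElimWord (Fin n)))
    (L : List (List (PruneWord (Fin n)))) (xs ys : List (Fin n)) (τ : Store) : Prop where
  elim : ∃ U, Eliminates G U l ∧ ∀ L' S, GrundyBDH G U L' S →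
    GrundyBDH G Finset.univ (L ++ L') (xs ++ S ++ ys.reverse)
  words : StoresWords τ 0 l
  len : τ.r .len = l.length
  out : τ.out = encodeLog L
  cnt : τ.r .cnt = c
  cnt2 : τ.r .cnt2 = 2 * c
  length_xs : xs.length = c
  length_ys : ys.length = c
  arr_xs : ∀ (i : ℕ) (v : Fin n), xs[i]? = some v → τ.a .xs i = (v : ℕ)
  arr_ys : ∀ (i : ℕ) (v : Fin n), ys[i]? = some v → τ.a .ys i = (v : ℕ)
  le : 2 * c + l.length ≤ n

/-- Without a leaf word the graph has no edges and the call has no effect on the invariant.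
Otherwise one recursive call is carried out and the known part of the run is extended: its leaf is
appended to `xs` and its support vertex to `ys`. -/
theorem run_callOnce {c : ℕ} {l : List (ElimWord (Fin n))}
    {L : List (List (PruneWord (Fin n)))} {xs ys : List (Fin n)} {τ : Store}
    (h : CallState G c l L xs ys τ) :
    ((∀ w ∈ l, w.z ≠ 0) ∧ CallState G c l L xs ys (callOnce.run n m τ)) ∨
      (∃ w ∈ l, w.z = 0) ∧
        ∃ l' L' xs' ys', CallState G (c + 1) l' L' xs' ys' (callOnce.run n m τ) := by
  obtain ⟨U, hU, hctx⟩ := h.elim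
  have hn : l.length ≤ n := by have := h.le; omega
  set τ1 := scan.run n m τ with hτ1
  have f1 : Frame scan τ τ1 := Com.frame _ _ _ _
  obtain ⟨hs, hlast⟩ := run_scan (m := m) h.words h.len hn hU.z_le
  rw [← hτ1] at hs hlast
  have hst1 : StoresWords τ1 0 l := h.words.congr (f1.arr .wx (by decide))
    (f1.arr .wz (by decide)) (f1.arr .wy (by decide))
  have hlen1 : τ1.r .len = l.length := by rw [f1.var .len (by decide), h.len]
  rcases hs with ⟨hno, hhas⟩ | ⟨hex, hhas⟩
  · have hrun : callOnce.run n m τ = τ1 := by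
      simp [callOnce, ← hτ1, hhas]
    rw [hrun]
    refine .inl ⟨hno, h.elim, hst1, hlen1, ?_, ?_, ?_, h.length_xs, h.length_ys, ?_, ?_, h.le⟩
    · rw [f1.out (by decide), h.out]
    · rw [f1.var .cnt (by decide), h.cnt]
    · rw [f1.var .cnt2 (by decide), h.cnt2]
    · rw [f1.arr .xs (by decide)]
      exact h.arr_xs
    · rw [f1.arr .ys (by decide)]
      exact h.arr_ys
  · set τ2 := emitSequence.run n m τ1 with hτ2
    set τ3 := transform.run n m τ2 with hτ3
    have hrun : callOnce.run n m τ =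
        (τ3.setVar .cnt (τ3.r .cnt + 1)).setVar .cnt2 (τ3.r .cnt2 + 2) := by
      simp [callOnce, ← hτ1, hhas, ← hτ2, ← hτ3]
    obtain ⟨w, hw⟩ : ∃ w, l.find? (fun w => w.z = 0) = some w := by
      cases hf : l.find? (fun w => w.z = 0) with
      | none =>
        obtain ⟨w, hw, hz⟩ := hex
        rw [List.find?_eq_none] at hf
        exact absurd (by simpa using hz) (hf w hw)
      | some w => exact ⟨w, rfl⟩
    have hne : l ≠ [] := by
      rintro rfl
      simp at hex
    obtain ⟨U', hU', hle, hstep⟩ := hU.exists_call hw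
    have f2 : Frame emitSequence τ1 τ2 := Com.frame _ _ _ _
    have f3 : Frame transform τ2 τ3 := Com.frame _ _ _ _
    have hout := run_emitSequence (m := m) hU hst1 hlen1 hn hlast hne
    rw [← hτ2] at hout
    have hcnt2 : τ2.r .cnt = c := by
      rw [f2.var .cnt (by decide), f1.var .cnt (by decide), h.cnt]
    obtain ⟨g1, g2, g3, g4, g5⟩ := run_transform (m := m) (σ := τ2) (hst1.congr (f2.arr .wx (by decide))
      (f2.arr .wz (by decide)) (f2.arr .wy (by decide)))
      (by rw [f2.var .len (by decide), hlen1]) hn hU.z_le hw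
    rw [← hτ3] at g1 g2 g3 g4 g5
    rw [hcnt2] at g3 g4 g5
    refine .inr ⟨hex, nextCall l, L ++ [pruneWords l []], xs ++ [w.x], ys ++ [w.y], ?_⟩
    rw [hrun]
    refine ⟨⟨U', hU', fun L' S hS => ?_⟩, ?_, by simpa using g2, ?_, ?_, ?_,
      by simp [h.length_xs], by simp [h.length_ys], fun i v hv => ?_, fun i v hv => ?_,
      by have := h.le; omega⟩
    · have := hctx _ _ (hstep L' S hS)
      simpa using this
    · intro i w' hw'
      simpa using g1 i w' hw'
    · rw [Store.setVar_out, Store.setVar_out, f3.out (by decide), hout, f1.out (by decide), h.out]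
      simp [encodeLog]
    · simp [f3.var .cnt (by decide), hcnt2]
    · simp [f3.var .cnt2 (by decide), f2.var .cnt2 (by decide), f1.var .cnt2 (by decide), h.cnt2]
      ring
    · rw [Store.setVar_a, Store.setVar_a]
      rcases lt_trichotomy i c with hi | hi | hi
      · rw [List.getElem?_append_left (by rw [h.length_xs]; exact hi)] at hv
        rw [(g5 i hi.ne).1, f2.arr .xs (by decide), f1.arr .xs (by decide)]
        exact h.arr_xs i v hv
      · subst hi
        rw [List.getElem?_append_right (by rw [h.length_xs]), h.length_xs] at hv
        obtain rfl : w.x = v := by simpa using hv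
        exact g3
      · rw [List.getElem?_eq_none (by simp [h.length_xs]; omega)] at hv
        simp at hv
    · rw [Store.setVar_a, Store.setVar_a]
      rcases lt_trichotomy i c with hi | hi | hi
      · rw [List.getElem?_append_left (by rw [h.length_ys]; exact hi)] at hv
        rw [(g5 i hi.ne).2, f2.arr .ys (by decide), f1.arr .ys (by decide)]
        exact h.arr_ys i v hv
      · subst hi
        rw [List.getElem?_append_right (by rw [h.length_ys]), h.length_ys] at hv
        obtain rfl : w.y = v := by simpa using hv
        exact g4
      · rw [List.getElem?_eq_none (by simp [h.length_ys]; omega)] at hv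
        simp at hv

/-- The loop makes `n` rounds, more than enough because every proper call removes at least two
vertices; rounds after the end change nothing essential. -/
theorem run_callAll {l : List (ElimWord (Fin n))} {σ : Store}
    (hl : Eliminates G Finset.univ l) (hst : StoresWords σ 0 l) (hout : σ.out = [])
    (hcnt : σ.r .cnt = 0) (hcnt2 : σ.r .cnt2 = 0) :
    ∃ c l' L xs ys, CallState G c l' L xs ys (callAll.run n m σ) ∧ ∀ w ∈ l', w.z ≠ 0 := by
  have hlen : l.length = n := by simpa using hl.length_eq
  have := Com.run_loop (n := n) (m := m) (R := .verts) (v := .vtx) (P := callOnce)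
    (σ := (Com.set .len .size).run n m σ)
    (fun i τ => ∃ c l' L xs ys, CallState G c l' L xs ys τ ∧ ((∀ w ∈ l', w.z ≠ 0) ∨ i ≤ c))
    ⟨0, l, [], [], [], ⟨⟨_, hl, fun L' S hS => by simpa using hS⟩, hst, by simp [hlen],
      by simpa [encodeLog] using hout, by simpa using hcnt, by simpa using hcnt2, rfl, rfl,
      by simp, by simp, by omega⟩, .inr le_rfl⟩ (by
      rintro i hi τ - ⟨c, l', L, xs, ys, h, hor⟩
      have h' : CallState G c l' L xs ys (τ.setVar .vtx i) :=
        ⟨h.elim, h.words, by simpa using h.len, h.out, by simpa using h.cnt, by simpa using h.cnt2,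
          h.length_xs, h.length_ys, h.arr_xs, h.arr_ys, h.le⟩
      rcases hor with hno | hle
      · rcases run_callOnce (m := m) h' with ⟨-, h2⟩ | ⟨⟨w, hw, hz⟩, -⟩
        · exact ⟨_, _, _, _, _, h2, .inl hno⟩
        · exact absurd hz (hno w hw)
      · rcases run_callOnce (m := m) h' with ⟨hno, h2⟩ | ⟨-, l'', L', xs', ys', h2⟩
        · exact ⟨_, _, _, _, _, h2, .inl hno⟩
        · exact ⟨_, _, _, _, _, h2, .inr (by omega)⟩)
  obtain ⟨c, l', L, xs, ys, h, hor⟩ := this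
  refine ⟨c, l', L, xs, ys, h, hor.elim id fun hc => ?_⟩
  -- If every round were a proper call, `2 * c + l'.length ≤ n` would leave an empty list.
  have hc : n ≤ c := hc
  have hle := h.le
  rw [List.eq_nil_of_length_eq_zero (l := l') (by omega)]
  simp

end

end GrundyTD

namespace GrundyTD

/-! ### The program -/

/-- Write the sequence to the first memory cells. -/
def writeResult : Com :=
  .out (.lit 0) (.var .cnt2) ;; .loop .verts .j (.ite (.var .j) (.var .cnt)
    (.out (.inc (.var .j) 1) (.arr .xs (.var .j)) ;;
      .out (.sub (.var .cnt2) (.var .j)) (.arr .ys (.var .j))) .skip)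

def program : Com := computeKeys ;; eliminateAll ;; callAll ;; writeResult

/-- Initialize the registers that hold the parameters. -/
def prelude : Cmd :=
  .seq (.load 2 0) (.seq (.const 1 1) (.seq (.load 5 1) (.seq (.const 8 4)
    (.seq (.add 8 8 2) (.seq (.add 8 8 5) (.add 8 8 5))))))

def machineProgram : Cmd := .seq prelude (program.compile 0)

section

variable {n m : ℕ} {G : SimpleGraph (Fin n)}

/-- Leaves fill the cells `1, …, c` upwards and support vertices fill `2 * c, …, c + 1` downwards,
so the two series never collide and the second one appears reversed, as the recursion demands. The
input may now be overwritten. -/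
theorem run_writeResult_low {σ : Store} {c : ℕ} (hcnt : σ.r .cnt = c)
    (hcnt2 : σ.r .cnt2 = 2 * c) (hc : 2 * c ≤ n) :
    (writeResult.run n m σ).low 0 = 2 * c ∧ ∀ i < c,
      (writeResult.run n m σ).low (i + 1) = σ.a .xs i ∧
      (writeResult.run n m σ).low (2 * c - i) = σ.a .ys i := by
  set σ1 := (Com.out (.lit 0) (.var .cnt2)).run n m σ with hσ1
  have := Com.run_loop (n := n) (m := m) (R := .verts) (v := .j)
    (P := .ite (.var .j) (.var .cnt)
      (.out (.inc (.var .j) 1) (.arr .xs (.var .j)) ;;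
        .out (.sub (.var .cnt2) (.var .j)) (.arr .ys (.var .j))) .skip)
    (σ := σ1)
    (fun k τ => τ.low 0 = 2 * c ∧ ∀ i < c, i < k →
      τ.low (i + 1) = σ.a .xs i ∧ τ.low (2 * c - i) = σ.a .ys i)
    ⟨by simp [hσ1, hcnt2], by simp⟩ (by
      rintro k - τ hτ ⟨h0, h⟩
      have e1 : τ.r .cnt = c := by
        rw [hτ.var .cnt (by decide)]
        simpa [hσ1] using hcnt
      have e2 : τ.r .cnt2 = 2 * c := by
        rw [hτ.var .cnt2 (by decide)]
        simpa [hσ1] using hcnt2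
      have ea : τ.a = σ.a := by
        funext l
        rw [hτ.arr l (by simp [Com.arrs])]
        simp [hσ1]
      by_cases hk : k < c
      · have g1 : k < n := by omega
        have g2 : 2 * c - k < n + 1 := by omega
        have g3 : 2 * c - k ≠ 0 := by omega
        simp only [Com.run_ite_of_lt, Exp.eval_var, Store.setVar_r, reduceCtorEq, if_true, if_false,
          e1, hk, Com.run_seq, Com.run_out, Exp.eval_inc, Exp.eval_sub, Exp.eval_arr, e2, ea, g1, g2,
          Store.setVar_low, Store.setVar_a, add_lt_add_iff_right, Function.update_apply]
        refine ⟨by rw [if_neg (by omega), h0], fun i hi hik => ?_⟩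
        rcases (Nat.lt_succ_iff.1 hik).lt_or_eq with hik | rfl
        · rw [if_neg (by omega), if_neg (by omega), if_neg (by omega), if_neg (by omega)]
          exact h i hi hik
        · rw [if_neg (by omega), if_pos rfl, if_pos rfl]
          exact ⟨rfl, rfl⟩
      · simp only [Com.run_ite_of_not_lt, Exp.eval_var, Store.setVar_r, reduceCtorEq, if_true,
          if_false, e1, hk, Com.run_skip, Store.setVar_low, not_false_eq_true]
        exact ⟨h0, fun i hi _ => h i hi (by omega)⟩)
  exact ⟨this.1, fun i hi => this.2 i hi (by change i < n; omega)⟩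

theorem run_writeResult {l : List (ElimWord (Fin n))} {L : List (List (PruneWord (Fin n)))}
    {xs ys : List (Fin n)} {c : ℕ} {σ : Store} (h : CallState G c l L xs ys σ) :
    (writeResult.run n m σ).low 0 = (xs ++ ys.reverse).length ∧
      ∀ (i : ℕ) (v : Fin n), (xs ++ ys.reverse)[i]? = some v →
        (writeResult.run n m σ).low (i + 1) = (v : ℕ) := by
  have hle := h.le
  have hx := h.length_xs
  have hy := h.length_ys
  obtain ⟨h1, h2⟩ := run_writeResult_low (m := m) h.cnt h.cnt2 (by omega : 2 * c ≤ n)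
  refine ⟨by rw [h1]; simp; omega, fun i v hv => ?_⟩
  by_cases hi : i < c
  · rw [List.getElem?_append_left (by omega : i < xs.length)] at hv
    rw [(h2 i hi).1, h.arr_xs i v hv]
  · have hi' : i < c + c := by
      by_contra hi'
      have : (xs ++ ys.reverse).length ≤ i := by simp; omega
      rw [List.getElem?_eq_none this] at hv
      simp at hv
    rw [List.getElem?_append_right (by omega : xs.length ≤ i),
      List.getElem?_reverse (by omega : i - xs.length < ys.length)] at hv
    have := (h2 (2 * c - (i + 1)) (by omega)).2
    rw [show 2 * c - (2 * c - (i + 1)) = i + 1 by omega] at this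
    rw [this]
    refine h.arr_ys _ v ?_
    rw [← hv]
    congr 1
    omega

theorem run_program (hb : G.IsBipartite) (hd : IsDistanceHereditary G)
    {es : List (Fin n × Fin n)} (hes : IsEdgeList G es) {σ : Store} (hin : HasInput es σ)
    (hr : ∀ v, σ.r v = 0) (ha : ∀ k i, σ.a k i = 0) (hout : σ.out = []) :
    ∃ (L : List (List (PruneWord (Fin n)))) (S : List (Fin n)),
      GrundyBDH G Finset.univ L S ∧ S.length ≤ n ∧
      (program.run n es.length σ).out = encodeLog L ∧
      (program.run n es.length σ).low 0 = S.length ∧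
      ∀ (i : ℕ) (v : Fin n), S[i]? = some v →
        (program.run n es.length σ).low (i + 1) = (v : ℕ) := by
  set σ1 := computeKeys.run n es.length σ with hσ1
  have f1 : Frame computeKeys σ σ1 := Com.frame _ _ _ _
  set σ2 := eliminateAll.run n es.length σ1 with hσ2
  have f2 : Frame eliminateAll σ1 σ2 := Com.frame _ _ _ _
  set σ3 := callAll.run n es.length σ2 with hσ3
  have hrun : program.run n es.length σ = writeResult.run n es.length σ3 := rfl
  have f4 : Frame writeResult σ3 (writeResult.run n es.length σ3) := Com.frame _ _ _ _
  obtain ⟨l, hl, hst⟩ := run_eliminateAll hb hd hes (σ := σ1)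
    (by rw [HasInput, f1.low (by decide)]; exact hin)
    (run_computeKeys hb hd hes hin (hr _)) fun v => by rw [f1.arr .dead (by decide), ha]
  obtain ⟨c, l', L, xs, ys, h, hz⟩ := run_callAll (m := es.length) hl hst
    (by rw [← hσ2, f2.out (by decide), f1.out (by decide), hout])
    (by rw [← hσ2, f2.var .cnt (by decide), f1.var .cnt (by decide), hr])
    (by rw [← hσ2, f2.var .cnt2 (by decide), f1.var .cnt2 (by decide), hr])
  rw [← hσ2, ← hσ3] at h
  obtain ⟨U, hU, hctx⟩ := h.elim
  have hw := run_writeResult (m := es.length) h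
  have hS := hctx [] [] (.done (hU.edgeless hz))
  rw [List.append_nil, List.append_nil] at hS
  have hle := h.le
  refine ⟨L, xs ++ ys.reverse, hS, by simp [h.length_xs, h.length_ys]; omega, ?_⟩
  rw [hrun, f4.out (by decide)]
  exact ⟨h.out, hw⟩

/-- The initial store. -/
def initStore (es : List (Fin n × Fin n)) : Store where
  r := fun _ => 0
  a := fun _ _ => 0
  low := (initState n es).mem
  out := []

theorem hasInput_initStore (es : List (Fin n × Fin n)) : HasInput es (initStore es) := by
  have key : ∀ (es : List (Fin n × Fin n)) (i : ℕ) (e : Fin n × Fin n), es[i]? = some e →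
      (es.flatMap fun e => [(e.1 : ℕ), (e.2 : ℕ)]).getD (2 * i) 0 = (e.1 : ℕ) ∧
      (es.flatMap fun e => [(e.1 : ℕ), (e.2 : ℕ)]).getD (2 * i + 1) 0 = (e.2 : ℕ) := by
    intro es
    induction es with
    | nil => simp
    | cons e' es ih =>
      rintro (- | i) e he
      · obtain rfl : e' = e := by simpa using he
        simp
      · have := ih i e (by simpa using he)
        rw [show 2 * (i + 1) = 2 * i + 1 + 1 by ring]
        simpa using this
  intro i e he
  simpa [initStore, initState] using key es i e he

theorem initState_mem_le (es : List (Fin n × Fin n)) (k : ℕ) :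
    (initState n es).mem k ≤ n + es.length := by
  simp only [initState, List.getD_eq_getElem?_getD]
  cases h : ([n, es.length] ++ es.flatMap fun e => [(e.1 : ℕ), (e.2 : ℕ)])[k]? with
  | none => simp
  | some a =>
    have := List.mem_of_getElem? h
    simp only [List.cons_append, List.nil_append, List.mem_cons, List.mem_flatMap,
      List.not_mem_nil, or_false] at this
    simp only [Option.getD_some]
    rcases this with rfl | rfl | ⟨e, -, rfl | rfl⟩
    · omega
    · omega
    · have := e.1.2
      omega
    · have := e.2.2
      omega

theorem initState_mem_of_le {es : List (Fin n × Fin n)} {k : ℕ} (hk : 2 * es.length + 2 ≤ k) :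
    (initState n es).mem k = 0 := by
  simp only [initState, List.getD_eq_getElem?_getD]
  rw [List.getElem?_eq_none]
  · rfl
  · simp [List.length_flatMap]
    omega

theorem exec_prelude {W : ℕ} (es : List (Fin n × Fin n)) (hW : base n es.length ≤ W) :
    ∃ s, Exec W prelude (initState n es) 7 s ∧ Represents n es.length s (initStore es) := by
  set s0 := initState n es with hs0
  have m0 : s0.mem 0 = n := by simp [hs0, initState]
  have m1 : s0.mem 1 = es.length := by simp [hs0, initState]
  have r0 : ∀ i, s0.reg i = 0 := fun _ => rfl
  have h1 := Exec.load (W := W) s0 2 0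
  rw [r0, m0] at h1
  set s1 := s0.setReg 2 n with hs1
  have h2 : Exec W (.const 1 1) s1 1 (s1.setReg 1 1) := .const _ _ _ (by simp [base] at hW; omega)
  set s2 := s1.setReg 1 1 with hs2
  have h3 := Exec.load (W := W) s2 5 1
  rw [show s2.reg 1 = 1 from rfl, show s2.mem 1 = es.length from m1] at h3
  set s3 := s2.setReg 5 es.length with hs3
  have h4 : Exec W (.const 8 4) s3 1 (s3.setReg 8 4) := .const _ _ _ (by simp [base] at hW; omega)
  set s4 := s3.setReg 8 4 with hs4
  have h5 : Exec W (.add 8 8 2) s4 1 (s4.setReg 8 (4 + n)) :=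
    .add _ _ _ _ (by change 4 + n ≤ W; simp [base] at hW; omega)
  set s5 := s4.setReg 8 (4 + n) with hs5
  have h6 : Exec W (.add 8 8 5) s5 1 (s5.setReg 8 (4 + n + es.length)) :=
    .add _ _ _ _ (by change 4 + n + es.length ≤ W; simp [base] at hW; omega)
  set s6 := s5.setReg 8 (4 + n + es.length) with hs6
  have h7 : Exec W (.add 8 8 5) s6 1 (s6.setReg 8 (4 + n + es.length + es.length)) :=
    .add _ _ _ _ (by change 4 + n + es.length + es.length ≤ W; simp [base] at hW; omega)
  refine ⟨_, .seq h1 (.seq h2 (.seq h3 (.seq h4 (.seq h5 (.seq h6 h7))))), ?_⟩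
  refine ⟨fun v => ?_, rfl, rfl, ?_, rfl, fun k i => ?_, fun i _ => rfl, rfl⟩
  · simp only [hs6, hs5, hs4, hs3, hs2, hs1, State.reg_setReg]
    simp only [show ¬ 3 * v.code = 8 by omega, show ¬ 3 * v.code = 5 by omega,
      show ¬ 3 * v.code = 1 by omega, show ¬ 3 * v.code = 2 by omega, if_false]
    rfl
  · rw [State.reg_setReg_self, base]
    omega
  · exact initState_mem_of_le (by simp only [base]; omega)

/-- Loops are nested at most two deep, and loops over edges occur only inside loops over vertices.
So the cost consists of terms in `n * n`, `n * m`, `n` and a constant, the latter two being absorbed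
because `n` is positive. -/
theorem cost_program_le (n m : ℕ) (hn : 0 < n) :
    program.cost n m ≤ 3000 * (n * (n + m)) := by
  have h1 : n ≤ n * n := Nat.le_mul_self n
  simp only [program, computeKeys, initKeys, Com.forEdges, relax, eliminateAll, eliminateOne,
    resetDegrees, countDegrees, Com.ifAlive, Com.ifEq, select, findNeighbors, recordWord, callAll,
    callOnce, scan, emitSequence, emitProper, emitIsolated, transform, loadWord, decideWord,
    writeWord, writeResult, Com.forWords, Com.cost, Exp.cost, Range.bound]
  ring_nf
  nlinarith [h1]

theorem IsEdgeList.length_eq {es : List (Fin n × Fin n)} (h : IsEdgeList G es) :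
    es.length = G.edgeSet.ncard := by
  have : G.edgeSet = ((es.map fun e => s(e.1, e.2)).toFinset : Set (Sym2 (Fin n))) := by
    ext e
    induction e using Sym2.ind with
    | _ u v => rw [SimpleGraph.mem_edgeSet, h.2, List.coe_toFinset]; rfl
  rw [this, Set.ncard_coe_finset, List.toFinset_card_of_nodup h.1, List.length_map]

end

end GrundyTD
/-- First part: on every finite bipartite distance-hereditary graph the algorithm always returns,
and whatever it returns is a Grundy total dominating sequence.  Second part: the algorithm has an
implementation on the random access machine, with words of `O(log (n + m))` bits, that
takes `O(n (n + m))` steps on the graphs with `n ≥ 1` vertices and `m` edges.  It carries out a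
complete run: it writes out the pruning sequences obtained in all the calls of that run and leaves
the sequence which that run returns in memory. -/
theorem mainTheorem6 :
    (∀ (V : Type*) [Fintype V] [DecidableEq V] (G : SimpleGraph V),
      G.IsBipartite → GrundyTD.IsDistanceHereditary G →
        GrundyTD.AlwaysReturns G Finset.univ ∧
        ∀ (L : List (List (GrundyTD.PruneWord V))) (S : List V),
          GrundyTD.GrundyBDH G Finset.univ L S → GrundyTD.IsGrundyTotalDominatingSeq G S) ∧
    (∃ (P : GrundyTD.Cmd) (C : ℕ),
      ∀ (n : ℕ) (G : SimpleGraph (Fin n)), 0 < n →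
        G.IsBipartite → GrundyTD.IsDistanceHereditary G →
        ∀ es : List (Fin n × Fin n), GrundyTD.IsEdgeList G es →
          ∃ (t : ℕ) (s : GrundyTD.State) (L : List (List (GrundyTD.PruneWord (Fin n))))
            (S : List (Fin n)),
            GrundyTD.Exec ((n + G.edgeSet.ncard + 2) ^ C) P (GrundyTD.initState n es) t s ∧
            t ≤ C * (n * (n + G.edgeSet.ncard)) ∧
            GrundyTD.GrundyBDH G Finset.univ L S ∧
            s.out = GrundyTD.encodeLog L ∧ s.Holds S) := by
  -- The constant consists of `3000` for the program and room for the seven steps of the prelude. It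
  -- stays opaque so that the power with exponent `C` is not evaluated.
  obtain ⟨C, hC⟩ : ∃ C, 3010 ≤ C := ⟨_, le_rfl⟩
  refine ⟨fun V _ _ G hb hd => ⟨GrundyTD.alwaysReturns hb hd, fun L S h => h.isGrundy hb⟩,
    GrundyTD.machineProgram, C, fun n G hn hb hd es hes => ?_⟩
  rw [← hes.length_eq]
  have hcost := GrundyTD.cost_program_le n es.length hn
  set N := n + es.length + 2 with hN
  have hmul : n * (n + es.length) ≤ N ^ 2 := by
    rw [pow_two]
    exact Nat.mul_le_mul (by omega) (by omega)
  have hNN : N ≤ N ^ 2 := Nat.le_self_pow (by norm_num) N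
  -- The simulation needs words up to `8 * (N + 3000 * N ^ 2) + 3 * N + 16`, which is below `2 ^ 15
  -- * N ^ 2`; since `N` is at least two, the constant is absorbed by fifteen further factors `N`.
  have hpow : 32768 * N ^ 2 ≤ N ^ C :=
    calc 32768 * N ^ 2 = 2 ^ 15 * N ^ 2 := by norm_num
      _ ≤ N ^ 15 * N ^ 2 := Nat.mul_le_mul (Nat.pow_le_pow_left (by omega) _) le_rfl
      _ = N ^ 17 := by rw [← pow_add]
      _ ≤ N ^ C := Nat.pow_le_pow_right (by omega) (by omega)
  have hbase : GrundyTD.base n es.length ≤ 3 * N := by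
    rw [GrundyTD.base]
    omega
  obtain ⟨s, hpre, hs⟩ := GrundyTD.exec_prelude (W := N ^ C) es (by omega)
  have hbd : (GrundyTD.initStore es).Bounded (n + es.length) :=
    ⟨fun _ => Nat.zero_le _, fun _ _ => Nat.zero_le _, GrundyTD.initState_mem_le es⟩
  obtain ⟨t, s', hrun, ht, hs', -⟩ := GrundyTD.program.simulates (W := N ^ C) hs hbd
    (by omega) (by omega) (by omega) 0
  obtain ⟨L, S, hLS, hlen, hout, h0, hS⟩ := GrundyTD.run_program hb hd hes
    (GrundyTD.hasInput_initStore es) (fun _ => rfl) (fun _ _ => rfl) rfl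
  have hpos : 0 < n * (n + es.length) := Nat.mul_pos hn (by omega)
  have hle : 3010 * (n * (n + es.length)) ≤ C * (n * (n + es.length)) :=
    Nat.mul_le_mul hC le_rfl
  refine ⟨7 + t, s', L, S, .seq hpre hrun, by omega, hLS, by rw [hs'.out, hout], ?_,
    fun i v hv => ?_⟩
  · rw [hs'.low 0 (by simp [GrundyTD.base]), h0]
  · have : i < S.length := (List.getElem?_eq_some_iff.1 hv).1
    rw [hs'.low (i + 1) (by simp only [GrundyTD.base]; omega), hS i v hv]
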